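/- **Setting.** One unit has unmeasured confounders $U$, covariates $X$, proxies $Z,W$, a binary treatment $A\in\{0,1\}$, a recanting witness $D$, a mediator $M$, a real outcome $Y$, and potential outcomes $D(a)$, $M(a,d)$, $Y(a,d,m)$ (jointly measurable in the random outcome and in $d,m$); $U,X,Z,W,D,M$ take values in standard Borel spaces, and are defined on a standard Borel probability space. Write $Y(a,m)=Y(a,D(a),m)$ and $Y(m)=Y(A,m)$. The parameter is $\psi=\mathbb E[Y(1,D(1),M(0,D(1)))]$, the counterfactual being integrable. Assume: 1. (Consistency) almost surely $D(A)=D$, $M(A,D)=M$, $Y(A,D,M)=Y$. 2. (Positivity) $P(A=a\mid U,X)>0$ a.s. for $a=0,1$, and, with respect to $\sigma$-finite reference measures, the conditional densities satisfy $f(d\mid A,U,X)>0$ and $f(m\mid D,A,U,X)>0$ a.s. for all $d,m$. 3. (Latent exchangeability and cross-world independence) for all $a,a^*,d,m$: $\{Y(a,m),D(a)\}\perp A\mid U,X$; $Y(m)\perp M\mid D,A,U,X$; $M(a,d)\perp\{D,A\}\mid U,X$; $\{Y(a,m),D(a)\}\perp M(a^*,d)\mid U,X$. For each of these conditions in which an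 index $d$ or $m$ occurs that ranges over an uncountable space, it is moreover assumed jointly for the random functions of the indices $d,m$ occurring in it: there are conditionally independent $\sigma$-algebras with respect to which the two sides, as random functions of $m$ or $d$, are jointly measurable. 4. (Proxies) $W\perp\{A,D,M\}\mid U,X$ and $Z\perp\{W,D,M,Y\}\mid A,U,X$. 5. (Completeness) If $g$ is measurable, $g(U,M,D,X)$ is square-integrable given $A=1$ and $\mathbb E[g(U,M,D,X)\mid Z,A=1,M,D,X]=0$ a.s., then $g(U,M,D,X)=0$ a.s. given $A=1$; likewise for $g(U,D,X)$ and $\mathbb E[\,\cdot\mid Z,A=0,D,X]$, and for $g(U,X)$ and $\mathbb E[\,\cdot\mid Z,A=1,X]$. Let $h_2(W,M,D,X)$, $h_1(W,D,X)$, $h_0(W,X)$, $q_2(Z,M,D,X)$, $q_1(Z,D,X)$, $q_0(Z,X)$ be measurable bridge functions, i.e. solutions of $$\mathbb E(Y\mid A{=}1,M,D,Z,X)=\mathbb E(h_2\mid A{=}1,M,D,Z,X),\quad \mathbb E(h_2\mid A{=}0,D,Z,X)=\mathbb E(h_1\mid A{=}0,D,Z,X),\quad \mathbb E(h_1\mid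 A{=}1,Z,X)=\mathbb E(h_0\mid A{=}1,Z,X),$$ $$\frac1{f(A{=}1\mid W,X)}=\mathbb E(q_0\mid A{=}1,W,X),\qquad \mathbb E(q_0\mid A{=}1,D,W,X)\frac{f(A{=}1\mid D,W,X)}{f(A{=}0\mid D,W,X)}=\mathbb E(q_1\mid A{=}0,D,W,X),$$ $$\mathbb E(q_1\mid A{=}0,M,D,W,X)\frac{f(A{=}0\mid M,D,W,X)}{f(A{=}1\mid M,D,W,X)}=\mathbb E(q_2\mid A{=}1,M,D,W,X),$$ the functions under these conditional expectations being integrable, with $h_2,h_1$ integrable and $h_0$ square-integrable under the law of the unit. Assume that for some constant $\eta>0$ the following are a.s. at most $\eta$, the squared variables being integrable under the respective law: $\mathbb E[(Y-h_2)^2\mid A{=}1,M,D,Z,X]$, $\mathbb E[(h_2-h_1)^2\mid A{=}0,D,Z,X]$, $\mathbb E[(h_1-h_0)^2\mid A{=}1,Z,X]$, $\mathbb E[(Aq_0-1)^2\mid W,X]$, $\mathbb E[((1-A)q_1-Aq_0)^2\mid W,D,X]$, $\mathbb E[(Aq_2-(1-A)q_1)^2\mid W,M,D,X]$. For $O=(Y,A,M,D,Z,W,X)$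 and $\zeta=(h_2,h_1,h_0,q_2,q_1,q_0)$ put $$\varphi(O;\zeta)=Aq_0(h_1-h_0)+(1-A)q_1(h_2-h_1)+Aq_2(Y-h_2)+h_0,\qquad \mathrm{EIF}_\psi(O)=\varphi(O;\zeta)-\psi .$$ **Estimator.** Let $O_1,O_2,\dots$ be i.i.d. copies of $O$, let $L\ge 1$ be fixed and let $n$ run through the multiples of $L$. The indices $1,\dots,n$ are split into folds $I_1,\dots,I_L$ of size $n/L$, uniformly at random and independently of the data. A measurable learning method, applied to the data outside $I_l$, gives $\hat\zeta_l=\hat\zeta((O_i)_{i\notin I_l})$, and $$\hat\psi=\frac1L\sum_{l=1}^L\hat\psi_l,\qquad \hat\psi_l=\frac Ln\sum_{i\in I_l}\varphi(O_i;\hat\zeta_l).$$ Suppose that there are positive exponents $\tau_{h_2},\tau_{h_1},\tau_{h_0},\tau_{q_2},\tau_{q_1},\tau_{q_0}$ such that for every fold $l$ and each component $r\in\{h_2,h_1,h_0,q_2,q_1,q_0\}$, $\sqrt{\mathbb E|\hat r_l(O)-r(O)|^2}=o(n^{-\tau_r})$ as $n\to\infty$, where $O$ is independent of the sample and the folds and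 the expectation is over all of them. **Theorem.** As $n\to\infty$, $$\sqrt n(\hat\psi-\psi)=\frac1{\sqrt n}\sum_{i=1}^n\mathrm{EIF}_\psi(O_i)+o_p(n^{-\alpha}),$$ $$\alpha=\min\{\tau_{h_2},\tau_{h_1},\tau_{h_0},\tau_{q_2},\tau_{q_1},\tau_{q_0},\tau_{h_2}{+}\tau_{q_2}{-}\tfrac12,\tau_{h_2}{+}\tau_{q_1}{-}\tfrac12,\tau_{h_1}{+}\tau_{q_0}{-}\tfrac12,\tau_{h_1}{+}\tau_{q_1}{-}\tfrac12,\tau_{h_0}{+}\tau_{q_0}{-}\tfrac12\}.$$ If moreover $\min\{\tau_{h_2}+\tau_{q_1},\tau_{h_2}+\tau_{q_2},\tau_{h_1}+\tau_{q_0},\tau_{h_1}+\tau_{q_1},\tau_{h_0}+\tau_{q_0}\}\ge\frac12$, then $\sqrt n(\hat\psi-\psi)=n^{-1/2}\sum_{i=1}^n\mathrm{EIF}_\psi(O_i)+o_p(1)$, $\sqrt n(\hat\psi-\psi)=O_p(1)$, $\mathbb E[\mathrm{EIF}_\psi(O)^2]<\infty$, and $\sqrt n(\hat\psi-\psi)$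 converges in distribution to $\mathcal N(0,\mathbb E[\mathrm{EIF}_\psi(O)^2])$. -/

import Mathlib

open MeasureTheory ProbabilityTheory Filter Topology
open scoped ENNReal NNReal

noncomputable section

/-! ### Conditional independence -/

/-- The σ-algebra generated by a random element. -/
abbrev sigmaOf {Ω E : Type*} [MeasurableSpace E] (f : Ω → E) : MeasurableSpace Ω :=
  MeasurableSpace.comap f inferInstance

/-- Conditional independence, given the random element `V`, of the members of two families
`(F j₁)` and `(G j₂)`: `F j₁ ⫫ G j₂ ∣ V` for all `j₁`, `j₂`.

If one of the index sets is uncountable, independence for every fixed index says nothing about the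
value of `F` or `G` at a random index; the families are then read as random functions: there are
σ-algebras, conditionally independent given `V`, with respect to which the random functions
`j₁ ↦ F j₁` and `j₂ ↦ G j₂` are (jointly) measurable. For countable index sets this second clause
is void, and the notion is exactly the one for fixed indices. -/
def CondIndepFamilies {Ω 𝓥 J₁ J₂ E₁ E₂ : Type*} [mΩ : MeasurableSpace Ω] [StandardBorelSpace Ω]
    [MeasurableSpace 𝓥] [mJ₁ : MeasurableSpace J₁] [mJ₂ : MeasurableSpace J₂]
    [mE₁ : MeasurableSpace E₁] [mE₂ : MeasurableSpace E₂]
    (V : Ω → 𝓥) (hV : Measurable V) (F : J₁ → Ω → E₁) (G : J₂ → Ω → E₂)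
    (P : Measure Ω) [IsFiniteMeasure P] : Prop :=
  (∀ j₁ j₂, CondIndepFun (sigmaOf V) hV.comap_le (F j₁) (G j₂) P) ∧
  ((Countable J₁ ∧ Countable J₂) ∨
    ∃ 𝒢₁ 𝒢₂ : MeasurableSpace Ω, 𝒢₁ ≤ mΩ ∧ 𝒢₂ ≤ mΩ ∧
      @Measurable (Ω × J₁) E₁ (@Prod.instMeasurableSpace Ω J₁ 𝒢₁ mJ₁) mE₁ (fun p => F p.2 p.1) ∧
      @Measurable (Ω × J₂) E₂ (@Prod.instMeasurableSpace Ω J₂ 𝒢₂ mJ₂) mE₂ (fun p => G p.2 p.1) ∧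
      CondIndep (sigmaOf V) 𝒢₁ 𝒢₂ hV.comap_le P)

/-! ### Observations, nuisance functions, scores -/

/-- One observation `(Y, A, M, D, Z, W, X)`. -/
abbrev Obs (𝓜 𝓓 𝓩 𝓦 𝓧 : Type*) := ℝ × Fin 2 × 𝓜 × 𝓓 × 𝓩 × 𝓦 × 𝓧

namespace Obs

variable {𝓜 𝓓 𝓩 𝓦 𝓧 : Type*}

/-- The outcome `Y`. -/
def y (o : Obs 𝓜 𝓓 𝓩 𝓦 𝓧) : ℝ := o.1
/-- The treatment `A`, as a real number `0` or `1`. -/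
def a (o : Obs 𝓜 𝓓 𝓩 𝓦 𝓧) : ℝ := if o.2.1 = 1 then 1 else 0
/-- The mediator `M`. -/
def m (o : Obs 𝓜 𝓓 𝓩 𝓦 𝓧) : 𝓜 := o.2.2.1
/-- The recanting witness `D`. -/
def d (o : Obs 𝓜 𝓓 𝓩 𝓦 𝓧) : 𝓓 := o.2.2.2.1
/-- The treatment-inducing proxy `Z`. -/
def z (o : Obs 𝓜 𝓓 𝓩 𝓦 𝓧) : 𝓩 := o.2.2.2.2.1
/-- The outcome-inducing proxy `W`. -/
def w (o : Obs 𝓜 𝓓 𝓩 𝓦 𝓧) : 𝓦 := o.2.2.2.2.2.1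
/-- The covariates `X`. -/
def x (o : Obs 𝓜 𝓓 𝓩 𝓦 𝓧) : 𝓧 := o.2.2.2.2.2.2

end Obs

/-- A tuple `ζ = (h₂, h₁, h₀, q₂, q₁, q₀)` of functions with the arguments of the confounding
bridge functions. -/
structure Nuisance (𝓜 𝓓 𝓩 𝓦 𝓧 : Type*) where
  h₂ : 𝓦 × 𝓜 × 𝓓 × 𝓧 → ℝ
  h₁ : 𝓦 × 𝓓 × 𝓧 → ℝ
  h₀ : 𝓦 × 𝓧 → ℝ
  q₂ : 𝓩 × 𝓜 × 𝓓 × 𝓧 → ℝ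
  q₁ : 𝓩 × 𝓓 × 𝓧 → ℝ
  q₀ : 𝓩 × 𝓧 → ℝ

namespace Nuisance

variable {𝓜 𝓓 𝓩 𝓦 𝓧 : Type*}

/-- `h₂(W, M, D, X)`. -/
def evalH₂ (ζ : Nuisance 𝓜 𝓓 𝓩 𝓦 𝓧) (o : Obs 𝓜 𝓓 𝓩 𝓦 𝓧) : ℝ := ζ.h₂ (o.w, o.m, o.d, o.x)
/-- `h₁(W, D, X)`. -/
def evalH₁ (ζ : Nuisance 𝓜 𝓓 𝓩 𝓦 𝓧) (o : Obs 𝓜 𝓓 𝓩 𝓦 𝓧) : ℝ := ζ.h₁ (o.w, o.d, o.x)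
/-- `h₀(W, X)`. -/
def evalH₀ (ζ : Nuisance 𝓜 𝓓 𝓩 𝓦 𝓧) (o : Obs 𝓜 𝓓 𝓩 𝓦 𝓧) : ℝ := ζ.h₀ (o.w, o.x)
/-- `q₂(Z, M, D, X)`. -/
def evalQ₂ (ζ : Nuisance 𝓜 𝓓 𝓩 𝓦 𝓧) (o : Obs 𝓜 𝓓 𝓩 𝓦 𝓧) : ℝ := ζ.q₂ (o.z, o.m, o.d, o.x)
/-- `q₁(Z, D, X)`. -/
def evalQ₁ (ζ : Nuisance 𝓜 𝓓 𝓩 𝓦 𝓧) (o : Obs 𝓜 𝓓 𝓩 𝓦 𝓧) : ℝ := ζ.q₁ (o.z, o.d, o.x)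
/-- `q₀(Z, X)`. -/
def evalQ₀ (ζ : Nuisance 𝓜 𝓓 𝓩 𝓦 𝓧) (o : Obs 𝓜 𝓓 𝓩 𝓦 𝓧) : ℝ := ζ.q₀ (o.z, o.x)

/-- The summand of the estimator: `A q₀ (h₁ - h₀) + (1 - A) q₁ (h₂ - h₁) + A q₂ (Y - h₂) + h₀`. -/
def score (ζ : Nuisance 𝓜 𝓓 𝓩 𝓦 𝓧) (o : Obs 𝓜 𝓓 𝓩 𝓦 𝓧) : ℝ :=
  o.a * ζ.evalQ₀ o * (ζ.evalH₁ o - ζ.evalH₀ o)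
    + (1 - o.a) * ζ.evalQ₁ o * (ζ.evalH₂ o - ζ.evalH₁ o)
    + o.a * ζ.evalQ₂ o * (o.y - ζ.evalH₂ o)
    + ζ.evalH₀ o

/-- The efficient influence function of `ψ`, as a function of one observation. -/
def eif (ζ : Nuisance 𝓜 𝓓 𝓩 𝓦 𝓧) (ψ : ℝ) (o : Obs 𝓜 𝓓 𝓩 𝓦 𝓧) : ℝ :=
  o.a * ζ.evalQ₀ o * (ζ.evalH₁ o - ζ.evalH₀ o)
    + (1 - o.a) * ζ.evalQ₁ o * (ζ.evalH₂ o - ζ.evalH₁ o)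
    + o.a * ζ.evalQ₂ o * (o.y - ζ.evalH₂ o)
    + ζ.evalH₀ o - ψ

end Nuisance

/-! ### The causal model -/

/-- The random variables of one unit: unmeasured confounders `U`, covariates `X`, proxies `Z`, `W`,
treatment `A`, recanting witness `D`, mediator `M`, outcome `Y`, and the potential outcomes
`D(a)`, `M(a, d)`, `Y(a, d, m)`. -/
structure PathModel (Ω 𝓤 𝓜 𝓓 𝓩 𝓦 𝓧 : Type*) [MeasurableSpace Ω] [MeasurableSpace 𝓤]
    [MeasurableSpace 𝓜] [MeasurableSpace 𝓓] [MeasurableSpace 𝓩] [MeasurableSpace 𝓦]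
    [MeasurableSpace 𝓧] where
  U : Ω → 𝓤
  X : Ω → 𝓧
  Z : Ω → 𝓩
  W : Ω → 𝓦
  A : Ω → Fin 2
  D : Ω → 𝓓
  M : Ω → 𝓜
  Y : Ω → ℝ
  Dpot : Fin 2 → Ω → 𝓓
  Mpot : Fin 2 → 𝓓 → Ω → 𝓜
  Ypot : Fin 2 → 𝓓 → 𝓜 → Ω → ℝ
  measurable_U : Measurable U
  measurable_X : Measurable X
  measurable_Z : Measurable Z
  measurable_W : Measurable W
  measurable_A : Measurable A
  measurable_D : Measurable D
  measurable_M : Measurable M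
  measurable_Y : Measurable Y
  measurable_Dpot : ∀ a, Measurable (Dpot a)
  measurable_Mpot : ∀ a, Measurable (fun p : Ω × 𝓓 => Mpot a p.2 p.1)
  measurable_Ypot : ∀ a, Measurable (fun p : Ω × 𝓓 × 𝓜 => Ypot a p.2.1 p.2.2 p.1)

namespace PathModel

variable {Ω 𝓤 𝓜 𝓓 𝓩 𝓦 𝓧 : Type*} [MeasurableSpace Ω] [MeasurableSpace 𝓤]
    [MeasurableSpace 𝓜] [MeasurableSpace 𝓓] [MeasurableSpace 𝓩] [MeasurableSpace 𝓦]
    [MeasurableSpace 𝓧]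

/-- The observed data of the unit. -/
def obs (S : PathModel Ω 𝓤 𝓜 𝓓 𝓩 𝓦 𝓧) (ω : Ω) : Obs 𝓜 𝓓 𝓩 𝓦 𝓧 :=
  (S.Y ω, S.A ω, S.M ω, S.D ω, S.Z ω, S.W ω, S.X ω)

/-- `Y(a, m) = Y(a, D(a), m)`. -/
def Yam (S : PathModel Ω 𝓤 𝓜 𝓓 𝓩 𝓦 𝓧) (a : Fin 2) (m : 𝓜) (ω : Ω) : ℝ :=
  S.Ypot a (S.Dpot a ω) m ω

/-- `Y(m) = Y(A, m)`: only the mediator is intervened on. -/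
def Ym (S : PathModel Ω 𝓤 𝓜 𝓓 𝓩 𝓦 𝓧) (m : 𝓜) (ω : Ω) : ℝ := S.Yam (S.A ω) m ω

/-- The nested counterfactual `Y(1, D(1), M(0, D(1)))`. -/
def Ynested (S : PathModel Ω 𝓤 𝓜 𝓓 𝓩 𝓦 𝓧) (ω : Ω) : ℝ :=
  S.Ypot 1 (S.Dpot 1 ω) (S.Mpot 0 (S.Dpot 1 ω) ω) ω

/-- The mediation functional `ψ = E[Y(1, D(1), M(0, D(1)))]`. -/
def psi (S : PathModel Ω 𝓤 𝓜 𝓓 𝓩 𝓦 𝓧) (P : Measure Ω) : ℝ := ∫ ω, S.Ynested ω ∂P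

/-- The conditional law given `A = a`. -/
def given (S : PathModel Ω 𝓤 𝓜 𝓓 𝓩 𝓦 𝓧) (P : Measure Ω) (a : Fin 2) : Measure Ω :=
  ProbabilityTheory.cond P (S.A ⁻¹' {a})

/-- The propensity `f(A = a ∣ T)` given the random element `T`. -/
def propensity {E : Type*} [MeasurableSpace E] (S : PathModel Ω 𝓤 𝓜 𝓓 𝓩 𝓦 𝓧) (P : Measure Ω)
    (a : Fin 2) (T : Ω → E) : Ω → ℝ :=
  condExp (sigmaOf T) P ((S.A ⁻¹' {a}).indicator fun _ => (1 : ℝ))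

lemma measurable_UX (S : PathModel Ω 𝓤 𝓜 𝓓 𝓩 𝓦 𝓧) : Measurable (fun ω => (S.U ω, S.X ω)) :=
  S.measurable_U.prodMk S.measurable_X

lemma measurable_AUX (S : PathModel Ω 𝓤 𝓜 𝓓 𝓩 𝓦 𝓧) :
    Measurable (fun ω => (S.A ω, S.U ω, S.X ω)) :=
  S.measurable_A.prodMk S.measurable_UX

lemma measurable_DAUX (S : PathModel Ω 𝓤 𝓜 𝓓 𝓩 𝓦 𝓧) :
    Measurable (fun ω => (S.D ω, S.A ω, S.U ω, S.X ω)) :=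
  S.measurable_D.prodMk S.measurable_AUX

/-- Consistency: almost surely, `D(A) = D`, `M(A, D) = M` and `Y(A, D, M) = Y`. -/
structure Consistency (S : PathModel Ω 𝓤 𝓜 𝓓 𝓩 𝓦 𝓧) (P : Measure Ω) : Prop where
  witness : ∀ᵐ ω ∂P, ∀ a, S.A ω = a → S.Dpot a ω = S.D ω
  mediator : ∀ᵐ ω ∂P, ∀ a d, S.A ω = a → S.D ω = d → S.Mpot a d ω = S.M ω
  outcome : ∀ᵐ ω ∂P, ∀ a d m, S.A ω = a → S.D ω = d → S.M ω = m → S.Ypot a d m ω = S.Y ω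

/-- Positivity: `P(A = a ∣ U, X) > 0`, and the conditional laws of `D` given `(A, U, X)` and of `M`
given `(D, A, U, X)` have positive densities with respect to σ-finite reference measures. -/
structure Positivity (S : PathModel Ω 𝓤 𝓜 𝓓 𝓩 𝓦 𝓧) (P : Measure Ω) : Prop where
  treatment : ∀ a, ∀ᵐ ω ∂P, 0 < S.propensity P a (fun ω => (S.U ω, S.X ω)) ω
  witness : ∃ (ν : Measure 𝓓) (f : (Fin 2 × 𝓤 × 𝓧) × 𝓓 → ℝ≥0∞), SigmaFinite ν ∧ Measurable f ∧
    P.map (fun ω => ((S.A ω, S.U ω, S.X ω), S.D ω))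
      = ((P.map fun ω => (S.A ω, S.U ω, S.X ω)).prod ν).withDensity f ∧
    ∀ d, ∀ᵐ ω ∂P, 0 < f ((S.A ω, S.U ω, S.X ω), d)
  mediator : ∃ (ν : Measure 𝓜) (f : (𝓓 × Fin 2 × 𝓤 × 𝓧) × 𝓜 → ℝ≥0∞), SigmaFinite ν ∧
    Measurable f ∧
    P.map (fun ω => ((S.D ω, S.A ω, S.U ω, S.X ω), S.M ω))
      = ((P.map fun ω => (S.D ω, S.A ω, S.U ω, S.X ω)).prod ν).withDensity f ∧
    ∀ m, ∀ᵐ ω ∂P, 0 < f ((S.D ω, S.A ω, S.U ω, S.X ω), m)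

/-- Latent conditional exchangeability:
(i) `{Y(a, m), D(a)} ⫫ A ∣ U, X`; (ii) `Y(m) ⫫ M ∣ D, A, U, X`; (iii) `M(a, d) ⫫ {D, A} ∣ U, X`. -/
structure LatentExchangeability [StandardBorelSpace Ω] (S : PathModel Ω 𝓤 𝓜 𝓓 𝓩 𝓦 𝓧)
    (P : Measure Ω) [IsFiniteMeasure P] : Prop where
  treatment : ∀ a, CondIndepFamilies (fun ω => (S.U ω, S.X ω)) S.measurable_UX
    (fun (m : 𝓜) ω => (S.Yam a m ω, S.Dpot a ω)) (fun (_ : Unit) ω => S.A ω) P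
  outcome : CondIndepFamilies (fun ω => (S.D ω, S.A ω, S.U ω, S.X ω)) S.measurable_DAUX
    (fun (m : 𝓜) ω => S.Ym m ω) (fun (_ : Unit) ω => S.M ω) P
  mediator : ∀ a, CondIndepFamilies (fun ω => (S.U ω, S.X ω)) S.measurable_UX
    (fun (d : 𝓓) ω => S.Mpot a d ω) (fun (_ : Unit) ω => (S.D ω, S.A ω)) P

/-- Latent cross-world independence: `{Y(a, m), D(a)} ⫫ M(a', d) ∣ U, X`. -/
def CrossWorld [StandardBorelSpace Ω] (S : PathModel Ω 𝓤 𝓜 𝓓 𝓩 𝓦 𝓧)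
    (P : Measure Ω) [IsFiniteMeasure P] : Prop :=
  ∀ a a', CondIndepFamilies (fun ω => (S.U ω, S.X ω)) S.measurable_UX
    (fun (m : 𝓜) ω => (S.Yam a m ω, S.Dpot a ω)) (fun (d : 𝓓) ω => S.Mpot a' d ω) P

/-- Proxy variables: (i) `W ⫫ {A, D, M} ∣ U, X`; (ii) `Z ⫫ {W, D, M, Y} ∣ A, U, X`. -/
structure ProxyVariables [StandardBorelSpace Ω] (S : PathModel Ω 𝓤 𝓜 𝓓 𝓩 𝓦 𝓧)
    (P : Measure Ω) [IsFiniteMeasure P] : Prop where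
  outcome_proxy : CondIndepFun (sigmaOf fun ω => (S.U ω, S.X ω)) S.measurable_UX.comap_le
    S.W (fun ω => (S.A ω, S.D ω, S.M ω)) P
  treatment_proxy : CondIndepFun (sigmaOf fun ω => (S.A ω, S.U ω, S.X ω)) S.measurable_AUX.comap_le
    S.Z (fun ω => (S.W ω, S.D ω, S.M ω, S.Y ω)) P

/-- Completeness of `Z`: a square-integrable function of `U`, which may vary with the values
`(m, d, x)`, `(d, x)`, `x` conditioned on, is zero if its conditional expectation given `Z` within
the strata `(A = 1, M, D, X)`, `(A = 0, D, X)`, `(A = 1, X)`, respectively, is zero. -/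
structure CompletenessZ (S : PathModel Ω 𝓤 𝓜 𝓓 𝓩 𝓦 𝓧) (P : Measure Ω) : Prop where
  mediator : ∀ g : 𝓤 × 𝓜 × 𝓓 × 𝓧 → ℝ, Measurable g →
    MemLp (fun ω => g (S.U ω, S.M ω, S.D ω, S.X ω)) 2 (S.given P 1) →
    condExp (sigmaOf fun ω => (S.Z ω, S.M ω, S.D ω, S.X ω)) (S.given P 1)
      (fun ω => g (S.U ω, S.M ω, S.D ω, S.X ω)) =ᵐ[S.given P 1] 0 →
    (fun ω => g (S.U ω, S.M ω, S.D ω, S.X ω)) =ᵐ[S.given P 1] 0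
  witness : ∀ g : 𝓤 × 𝓓 × 𝓧 → ℝ, Measurable g →
    MemLp (fun ω => g (S.U ω, S.D ω, S.X ω)) 2 (S.given P 0) →
    condExp (sigmaOf fun ω => (S.Z ω, S.D ω, S.X ω)) (S.given P 0)
      (fun ω => g (S.U ω, S.D ω, S.X ω)) =ᵐ[S.given P 0] 0 →
    (fun ω => g (S.U ω, S.D ω, S.X ω)) =ᵐ[S.given P 0] 0
  covariate : ∀ g : 𝓤 × 𝓧 → ℝ, Measurable g →
    MemLp (fun ω => g (S.U ω, S.X ω)) 2 (S.given P 1) →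
    condExp (sigmaOf fun ω => (S.Z ω, S.X ω)) (S.given P 1)
      (fun ω => g (S.U ω, S.X ω)) =ᵐ[S.given P 1] 0 →
    (fun ω => g (S.U ω, S.X ω)) =ᵐ[S.given P 1] 0

/-! ### Confounding bridge functions -/

/-- `h₂, h₁, h₀` are outcome confounding bridge functions:
`E(Y ∣ A=1, M, D, Z, X) = E[h₂ ∣ A=1, M, D, Z, X]`, `E[h₂ ∣ A=0, D, Z, X] = E[h₁ ∣ A=0, D, Z, X]`,
`E[h₁ ∣ A=1, Z, X] = E[h₀ ∣ A=1, Z, X]`. -/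
structure IsOutcomeBridge (S : PathModel Ω 𝓤 𝓜 𝓓 𝓩 𝓦 𝓧) (P : Measure Ω)
    (ζ : Nuisance 𝓜 𝓓 𝓩 𝓦 𝓧) : Prop where
  measurable_h₂ : Measurable ζ.h₂
  measurable_h₁ : Measurable ζ.h₁
  measurable_h₀ : Measurable ζ.h₀
  integrable_Y : Integrable S.Y (S.given P 1)
  integrable_h₂ : Integrable (fun ω => ζ.evalH₂ (S.obs ω)) P
  integrable_h₁ : Integrable (fun ω => ζ.evalH₁ (S.obs ω)) P
  integrable_h₀ : Integrable (fun ω => ζ.evalH₀ (S.obs ω)) P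
  eq_h₂ :
    condExp (sigmaOf fun ω => (S.M ω, S.D ω, S.Z ω, S.X ω)) (S.given P 1) S.Y
      =ᵐ[S.given P 1]
    condExp (sigmaOf fun ω => (S.M ω, S.D ω, S.Z ω, S.X ω)) (S.given P 1)
      (fun ω => ζ.evalH₂ (S.obs ω))
  eq_h₁ :
    condExp (sigmaOf fun ω => (S.D ω, S.Z ω, S.X ω)) (S.given P 0) (fun ω => ζ.evalH₂ (S.obs ω))
      =ᵐ[S.given P 0]
    condExp (sigmaOf fun ω => (S.D ω, S.Z ω, S.X ω)) (S.given P 0) (fun ω => ζ.evalH₁ (S.obs ω))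
  eq_h₀ :
    condExp (sigmaOf fun ω => (S.Z ω, S.X ω)) (S.given P 1) (fun ω => ζ.evalH₁ (S.obs ω))
      =ᵐ[S.given P 1]
    condExp (sigmaOf fun ω => (S.Z ω, S.X ω)) (S.given P 1) (fun ω => ζ.evalH₀ (S.obs ω))

/-- `q₀, q₁, q₂` are treatment confounding bridge functions:
`1 / f(A=1 ∣ W, X) = E[q₀ ∣ A=1, W, X]`,
`E[q₀ ∣ A=1, D, W, X] f(A=1 ∣ D, W, X) / f(A=0 ∣ D, W, X) = E[q₁ ∣ A=0, D, W, X]`,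
`E[q₁ ∣ A=0, M, D, W, X] f(A=0 ∣ M, D, W, X) / f(A=1 ∣ M, D, W, X) = E[q₂ ∣ A=1, M, D, W, X]`. -/
structure IsTreatmentBridge (S : PathModel Ω 𝓤 𝓜 𝓓 𝓩 𝓦 𝓧) (P : Measure Ω)
    (ζ : Nuisance 𝓜 𝓓 𝓩 𝓦 𝓧) : Prop where
  measurable_q₂ : Measurable ζ.q₂
  measurable_q₁ : Measurable ζ.q₁
  measurable_q₀ : Measurable ζ.q₀
  integrable_q₂ : Integrable (fun ω => ζ.evalQ₂ (S.obs ω)) (S.given P 1)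
  integrable_q₁ : Integrable (fun ω => ζ.evalQ₁ (S.obs ω)) (S.given P 0)
  integrable_q₀ : Integrable (fun ω => ζ.evalQ₀ (S.obs ω)) (S.given P 1)
  eq_q₀ : ∀ᵐ ω ∂P,
    1 / S.propensity P 1 (fun ω => (S.W ω, S.X ω)) ω
      = condExp (sigmaOf fun ω => (S.W ω, S.X ω)) (S.given P 1)
          (fun ω => ζ.evalQ₀ (S.obs ω)) ω
  eq_q₁ : ∀ᵐ ω ∂P,
    condExp (sigmaOf fun ω => (S.D ω, S.W ω, S.X ω)) (S.given P 1)
        (fun ω => ζ.evalQ₀ (S.obs ω)) ω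
        * (S.propensity P 1 (fun ω => (S.D ω, S.W ω, S.X ω)) ω
          / S.propensity P 0 (fun ω => (S.D ω, S.W ω, S.X ω)) ω)
      = condExp (sigmaOf fun ω => (S.D ω, S.W ω, S.X ω)) (S.given P 0)
          (fun ω => ζ.evalQ₁ (S.obs ω)) ω
  eq_q₂ : ∀ᵐ ω ∂P,
    condExp (sigmaOf fun ω => (S.M ω, S.D ω, S.W ω, S.X ω)) (S.given P 0)
        (fun ω => ζ.evalQ₁ (S.obs ω)) ω
        * (S.propensity P 0 (fun ω => (S.M ω, S.D ω, S.W ω, S.X ω)) ω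
          / S.propensity P 1 (fun ω => (S.M ω, S.D ω, S.W ω, S.X ω)) ω)
      = condExp (sigmaOf fun ω => (S.M ω, S.D ω, S.W ω, S.X ω)) (S.given P 1)
          (fun ω => ζ.evalQ₂ (S.obs ω)) ω

end PathModel

/-- `E[f² ∣ 𝒢] ≤ η` almost surely (in particular `f` is square-integrable). -/
def CondSecondMomentLE {Ω : Type*} [MeasurableSpace Ω] (μ : Measure Ω) (𝒢 : MeasurableSpace Ω)
    (f : Ω → ℝ) (η : ℝ) : Prop :=
  MemLp f 2 μ ∧ ∀ᵐ ω ∂μ, condExp 𝒢 μ (fun ω => f ω ^ 2) ω ≤ η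

namespace PathModel

variable {Ω 𝓤 𝓜 𝓓 𝓩 𝓦 𝓧 : Type*} [MeasurableSpace Ω] [MeasurableSpace 𝓤]
    [MeasurableSpace 𝓜] [MeasurableSpace 𝓓] [MeasurableSpace 𝓩] [MeasurableSpace 𝓦]
    [MeasurableSpace 𝓧]

/-- The conditional second moments of the residuals are bounded by `η`. -/
structure FiniteSecondMoments (S : PathModel Ω 𝓤 𝓜 𝓓 𝓩 𝓦 𝓧) (P : Measure Ω)
    (ζ : Nuisance 𝓜 𝓓 𝓩 𝓦 𝓧) (η : ℝ) : Prop where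
  h₂ : CondSecondMomentLE (S.given P 1) (sigmaOf fun ω => (S.M ω, S.D ω, S.Z ω, S.X ω))
    (fun ω => S.Y ω - ζ.evalH₂ (S.obs ω)) η
  h₁ : CondSecondMomentLE (S.given P 0) (sigmaOf fun ω => (S.D ω, S.Z ω, S.X ω))
    (fun ω => ζ.evalH₂ (S.obs ω) - ζ.evalH₁ (S.obs ω)) η
  h₀ : CondSecondMomentLE (S.given P 1) (sigmaOf fun ω => (S.Z ω, S.X ω))
    (fun ω => ζ.evalH₁ (S.obs ω) - ζ.evalH₀ (S.obs ω)) η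
  q₀ : CondSecondMomentLE P (sigmaOf fun ω => (S.W ω, S.X ω))
    (fun ω => (S.obs ω).a * ζ.evalQ₀ (S.obs ω) - 1) η
  q₁ : CondSecondMomentLE P (sigmaOf fun ω => (S.W ω, S.D ω, S.X ω))
    (fun ω => (1 - (S.obs ω).a) * ζ.evalQ₁ (S.obs ω) - (S.obs ω).a * ζ.evalQ₀ (S.obs ω)) η
  q₂ : CondSecondMomentLE P (sigmaOf fun ω => (S.W ω, S.M ω, S.D ω, S.X ω))
    (fun ω => (S.obs ω).a * ζ.evalQ₂ (S.obs ω)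
      - (1 - (S.obs ω).a) * ζ.evalQ₁ (S.obs ω)) η

end PathModel

/-! ### The cross-fitted estimator -/

/-- A learning method: for every sample size `n` and every training index set `I ⊆ {1, …, n}`, it
maps the training data `(O_i)_{i ∈ I}` to an estimate of the bridge functions. -/
abbrev Learner (𝓜 𝓓 𝓩 𝓦 𝓧 : Type*) :=
  (n : ℕ) → (I : Finset (Fin n)) → (I → Obs 𝓜 𝓓 𝓩 𝓦 𝓧) → Nuisance 𝓜 𝓓 𝓩 𝓦 𝓧

/-- The estimated functions are jointly measurable in the training data and their arguments. -/
structure Learner.IsMeasurable {𝓜 𝓓 𝓩 𝓦 𝓧 : Type*}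
    [MeasurableSpace 𝓜] [MeasurableSpace 𝓓] [MeasurableSpace 𝓩] [MeasurableSpace 𝓦]
    [MeasurableSpace 𝓧] (learn : Learner 𝓜 𝓓 𝓩 𝓦 𝓧) : Prop where
  h₂ : ∀ n (I : Finset (Fin n)), Measurable
    (fun p : (I → Obs 𝓜 𝓓 𝓩 𝓦 𝓧) × (𝓦 × 𝓜 × 𝓓 × 𝓧) => (learn n I p.1).h₂ p.2)
  h₁ : ∀ n (I : Finset (Fin n)), Measurable
    (fun p : (I → Obs 𝓜 𝓓 𝓩 𝓦 𝓧) × (𝓦 × 𝓓 × 𝓧) => (learn n I p.1).h₁ p.2)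
  h₀ : ∀ n (I : Finset (Fin n)), Measurable
    (fun p : (I → Obs 𝓜 𝓓 𝓩 𝓦 𝓧) × (𝓦 × 𝓧) => (learn n I p.1).h₀ p.2)
  q₂ : ∀ n (I : Finset (Fin n)), Measurable
    (fun p : (I → Obs 𝓜 𝓓 𝓩 𝓦 𝓧) × (𝓩 × 𝓜 × 𝓓 × 𝓧) => (learn n I p.1).q₂ p.2)
  q₁ : ∀ n (I : Finset (Fin n)), Measurable
    (fun p : (I → Obs 𝓜 𝓓 𝓩 𝓦 𝓧) × (𝓩 × 𝓓 × 𝓧) => (learn n I p.1).q₁ p.2)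
  q₀ : ∀ n (I : Finset (Fin n)), Measurable
    (fun p : (I → Obs 𝓜 𝓓 𝓩 𝓦 𝓧) × (𝓩 × 𝓧) => (learn n I p.1).q₀ p.2)

/-- The fold `I_l = {i : J_i = l}`. -/
def fold {n L : ℕ} (J : Fin n → Fin L) (l : Fin L) : Finset (Fin n) :=
  Finset.univ.filter fun i => J i = l

/-- The fold assignments of `n = L k` indices to `L` folds in which each fold has `k = n / L`
members, that is, the arrangements of `k` copies of each fold index. -/
def balancedAssignments (L k : ℕ) : Set (Fin (L * k) → Fin L) :=
  {J | ∀ l, (fold J l).card = k}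

/-- The estimate `ζ̂_l`, computed from the data outside the fold `I_l`. -/
def crossFit {𝓜 𝓓 𝓩 𝓦 𝓧 : Type*} (learn : Learner 𝓜 𝓓 𝓩 𝓦 𝓧) {n L : ℕ} (J : Fin n → Fin L)
    (o : Fin n → Obs 𝓜 𝓓 𝓩 𝓦 𝓧) (l : Fin L) : Nuisance 𝓜 𝓓 𝓩 𝓦 𝓧 :=
  learn n (fold J l)ᶜ (fun i => o i)

/-- The estimator `(L / n) ∑_{i ∈ I_l} score(O_i; ζ̂_l)` of the `l`-th fold. -/
def foldEstimator {𝓜 𝓓 𝓩 𝓦 𝓧 : Type*} (learn : Learner 𝓜 𝓓 𝓩 𝓦 𝓧) {n L : ℕ}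
    (J : Fin n → Fin L) (o : Fin n → Obs 𝓜 𝓓 𝓩 𝓦 𝓧) (l : Fin L) : ℝ :=
  (L : ℝ) / (n : ℝ) * ∑ i ∈ fold J l, (crossFit learn J o l).score (o i)

/-- The proximal debiased machine learning estimator, the average of the fold estimators. -/
def dmlEstimator {𝓜 𝓓 𝓩 𝓦 𝓧 : Type*} (learn : Learner 𝓜 𝓓 𝓩 𝓦 𝓧) {n L : ℕ}
    (J : Fin n → Fin L) (o : Fin n → Obs 𝓜 𝓓 𝓩 𝓦 𝓧) : ℝ :=
  1 / (L : ℝ) * ∑ l, foldEstimator learn J o l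

/-! ### Rates -/

/-- The exponents of the convergence rates `n ^ (-τ)` of the six nuisance estimators. -/
structure Rates where
  h₂ : ℝ
  h₁ : ℝ
  h₀ : ℝ
  q₂ : ℝ
  q₁ : ℝ
  q₀ : ℝ

namespace Rates

/-- The exponents are positive. -/
structure Positive (τ : Rates) : Prop where
  h₂ : 0 < τ.h₂
  h₁ : 0 < τ.h₁
  h₀ : 0 < τ.h₀
  q₂ : 0 < τ.q₂
  q₁ : 0 < τ.q₁
  q₀ : 0 < τ.q₀

/-- The smallest of the relevant pairwise sums of exponents. -/
def pairwise (τ : Rates) : ℝ :=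
  min (τ.h₂ + τ.q₁) (min (τ.h₂ + τ.q₂)
    (min (τ.h₁ + τ.q₀) (min (τ.h₁ + τ.q₁) (τ.h₀ + τ.q₀))))

/-- The exponent of the remainder. -/
def alpha (τ : Rates) : ℝ :=
  min τ.h₂ (min τ.h₁ (min τ.h₀ (min τ.q₂ (min τ.q₁ (min τ.q₀
    (min (τ.h₂ + τ.q₂ - 1 / 2) (min (τ.h₂ + τ.q₁ - 1 / 2) (min (τ.h₁ + τ.q₀ - 1 / 2)
      (min (τ.h₁ + τ.q₁ - 1 / 2) (τ.h₀ + τ.q₀ - 1 / 2))))))))))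

end Rates

/-- The root mean square error `(E |ζ̂(O) - ζ(O)|²)^{1/2}` of one component `ev` of an estimated
nuisance function, where the expectation is over the sample (with its fold assignment) and an
independent observation `O` with law `Q`. -/
def rmse {Ω' 𝓜 𝓓 𝓩 𝓦 𝓧 : Type*} [MeasurableSpace Ω']
    [MeasurableSpace 𝓜] [MeasurableSpace 𝓓] [MeasurableSpace 𝓩] [MeasurableSpace 𝓦]
    [MeasurableSpace 𝓧] (Pr : Measure Ω') (Q : Measure (Obs 𝓜 𝓓 𝓩 𝓦 𝓧))
    (ev : Nuisance 𝓜 𝓓 𝓩 𝓦 𝓧 → Obs 𝓜 𝓓 𝓩 𝓦 𝓧 → ℝ)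
    (ζhat : Ω' → Nuisance 𝓜 𝓓 𝓩 𝓦 𝓧) (ζ : Nuisance 𝓜 𝓓 𝓩 𝓦 𝓧) : ℝ≥0∞ :=
  eLpNorm (fun p : Ω' × Obs 𝓜 𝓓 𝓩 𝓦 𝓧 => ev (ζhat p.1) p.2 - ev ζ p.2) 2 (Pr.prod Q)

/-- The error sequence `e`, indexed by the fold size `k`, is `o(n ^ (-τ))`, where `n = L k`. -/
def IsLittleORate (L : ℕ) (e : ℕ → ℝ≥0∞) (τ : ℝ) : Prop :=
  Tendsto (fun k : ℕ => ENNReal.ofReal (((L * k : ℕ) : ℝ) ^ τ) * e k) atTop (𝓝 0)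

/-- All six cross-fitted nuisance estimators converge, in the root mean square error sense and on
every fold, with the rates `o(n ^ (-τ))`. Here `ζhat k l` is the estimate for fold `l` from a
sample of size `n = L k`. -/
structure HasRates {Ω' 𝓜 𝓓 𝓩 𝓦 𝓧 : Type*} [MeasurableSpace Ω']
    [MeasurableSpace 𝓜] [MeasurableSpace 𝓓] [MeasurableSpace 𝓩] [MeasurableSpace 𝓦]
    [MeasurableSpace 𝓧] (Pr : Measure Ω') (Q : Measure (Obs 𝓜 𝓓 𝓩 𝓦 𝓧)) (L : ℕ)
    (ζhat : ℕ → Fin L → Ω' → Nuisance 𝓜 𝓓 𝓩 𝓦 𝓧) (ζ : Nuisance 𝓜 𝓓 𝓩 𝓦 𝓧)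
    (τ : Rates) : Prop where
  h₂ : ∀ l, IsLittleORate L (fun k => rmse Pr Q Nuisance.evalH₂ (ζhat k l) ζ) τ.h₂
  h₁ : ∀ l, IsLittleORate L (fun k => rmse Pr Q Nuisance.evalH₁ (ζhat k l) ζ) τ.h₁
  h₀ : ∀ l, IsLittleORate L (fun k => rmse Pr Q Nuisance.evalH₀ (ζhat k l) ζ) τ.h₀
  q₂ : ∀ l, IsLittleORate L (fun k => rmse Pr Q Nuisance.evalQ₂ (ζhat k l) ζ) τ.q₂
  q₁ : ∀ l, IsLittleORate L (fun k => rmse Pr Q Nuisance.evalQ₁ (ζhat k l) ζ) τ.q₁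
  q₀ : ∀ l, IsLittleORate L (fun k => rmse Pr Q Nuisance.evalQ₀ (ζhat k l) ζ) τ.q₀

/-- A sequence of random variables is `O_p(1)`. -/
def IsBigOpOne {Ω' : Type*} [MeasurableSpace Ω'] (Pr : Measure Ω') (R : ℕ → Ω' → ℝ) : Prop :=
  ∀ ε : ℝ≥0∞, 0 < ε → ∃ C : ℝ, ∀ᶠ k in atTop, Pr {s | C < |R k s|} ≤ ε

/-- The centred and scaled estimator `√n (ψ̂ - ψ)` for the sample `o` of size `n`. -/
def scaledError {𝓜 𝓓 𝓩 𝓦 𝓧 : Type*} (learn : Learner 𝓜 𝓓 𝓩 𝓦 𝓧) (ψ : ℝ) {n L : ℕ}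
    (J : Fin n → Fin L) (o : Fin n → Obs 𝓜 𝓓 𝓩 𝓦 𝓧) : ℝ :=
  √(n : ℝ) * (dmlEstimator learn J o - ψ)

/-- The leading term `n^{-1/2} ∑ EIF(O_i)` for the sample `o` of size `n`. -/
def leadingTerm {𝓜 𝓓 𝓩 𝓦 𝓧 : Type*} (ζ : Nuisance 𝓜 𝓓 𝓩 𝓦 𝓧) (ψ : ℝ) {n : ℕ}
    (o : Fin n → Obs 𝓜 𝓓 𝓩 𝓦 𝓧) : ℝ :=
  1 / √(n : ℝ) * ∑ i, ζ.eif ψ (o i)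

end

/-! The proof has two halves: the identification `ψ = E[h₀(W, X)]`, and a linear expansion of the
estimator whose remainder is controlled by cross-fitting.

Identification. Put `V = (U, X)`. Each outcome bridge equation says that a residual has mean zero
given `Z` and some observed variables. As `Z` is independent of `(W, D, M, Y)` given `(A, V)`, the
regression of the residual on the latent variables does not change when `Z` is added to them; hence
it is a function whose conditional expectation given `Z` vanishes, and completeness makes it zero
(`condExp_eq_zero_of_complete`). The bridge equations thus hold with `U` in place of `Z`. Since `W`
has one conditional law given `V` in all strata, they become equations between fixed functions
`meanH₂`, `meanH₁`, `meanH₀`. On the causal side, `map_nested` writes the law of the nested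
counterfactual as a chain of kernels: `lawD` (that of `D` in the stratum `A = 1`), `lawM` (that of
`M` given `D` in the stratum `A = 0`) and `lawY` (that of `Y` given `M, D` in the stratum `A = 1`).
Integrating from the inside outwards turns the mean of `lawY` into `meanH₂`, then `meanH₁`, then
`meanH₀`, and the outer mean of the last is `E[h₀]` (`integral_evalH₀_eq_psi`). Each equation is
known only almost everywhere in one stratum; positivity carries null sets from there to the
counterfactual law. The delicate point is that mediator and outcome are random functions evaluated
at random indices. `CondIndepFamilies.lintegral_decouple` handles this by drawing two independent
copies of the outcome `ω` given `V`.

Expansion. The score is affine in the `h`'s and in the `q`'s separately. Its error is therefore a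
sum of six first-order terms (a residual times an error of a `q`, or a balancing weight times an
error of an `h`) and five products of two errors (`Nuisance.score_sub_score`). By the bridge
equations the residuals are centred given the arguments of the `q`'s, and the weights are centred
given the arguments of the `h`'s (`isBalanced_bridge`). Given the data outside a fold, a first-order
sum is thus a sum of independent centred variables, of order `√n` times a root mean square error; a
product sum is of order `n` times two such errors, by Cauchy–Schwarz. Division by `√n` yields the
exponent `alpha`. The same two facts, centring and bounded conditional second moments, show that the
influence function is centred and square-integrable, so the central limit theorem and Slutsky's
lemma finish the proof. -/

namespace ProbabilityTheory

/-! ### Conditional laws as kernels. -/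

section ConditionalLaws

variable {Ω α β γ : Type*} [mΩ : MeasurableSpace Ω] [MeasurableSpace α] [MeasurableSpace β]
  [MeasurableSpace γ] {P : Measure Ω}

lemma HasCondDistrib.lintegral_eq [SFinite P] {T : Ω → α} {F : Ω → β} {κ : Kernel α β}
    [IsSFiniteKernel κ] (h : HasCondDistrib F T κ P) (hT : Measurable T) (hF : Measurable F)
    {φ : α × β → ℝ≥0∞} (hφ : Measurable φ) :
    ∫⁻ ω, φ (T ω, F ω) ∂P = ∫⁻ ω, ∫⁻ y, φ (T ω, y) ∂κ (T ω) ∂P := by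
  rw [← lintegral_map (f := φ) hφ (hT.prodMk hF), h.map_eq, Measure.lintegral_compProd hφ,
    lintegral_map hφ.lintegral_kernel_prod_right' hT]

lemma hasCondDistrib_of_lintegral [SFinite P] {T : Ω → α} {F : Ω → β} {κ : Kernel α β}
    [IsSFiniteKernel κ] (hT : Measurable T) (hF : Measurable F)
    (h : ∀ φ : α × β → ℝ≥0∞, Measurable φ →
      ∫⁻ ω, φ (T ω, F ω) ∂P = ∫⁻ ω, ∫⁻ y, φ (T ω, y) ∂κ (T ω) ∂P) :
    HasCondDistrib F T κ P := by
  refine ⟨(hT.prodMk hF).aemeasurable, Measure.ext_of_lintegral _ fun φ hφ => ?_⟩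
  rw [lintegral_map hφ (hT.prodMk hF), Measure.lintegral_compProd hφ,
    lintegral_map hφ.lintegral_kernel_prod_right' hT, h φ hφ]

lemma hasCondDistrib_condDistrib [IsFiniteMeasure P] [StandardBorelSpace β] [Nonempty β]
    {T : Ω → α} {F : Ω → β} (hT : Measurable T) (hF : Measurable F) :
    HasCondDistrib F T (condDistrib F T P) P :=
  ⟨(hT.prodMk hF).aemeasurable, (compProd_map_condDistrib hF.aemeasurable).symm⟩

lemma HasCondDistrib.lintegral_cond [SFinite P] {T : Ω → α} {F : Ω → β} {κ : Kernel α β}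
    [IsSFiniteKernel κ] (h : HasCondDistrib F T κ P) (hT : Measurable T) (hF : Measurable F)
    {B : Set α} (hB : MeasurableSet B) {φ : α × β → ℝ≥0∞} (hφ : Measurable φ) :
    ∫⁻ ω, φ (T ω, F ω) ∂(P[|T ⁻¹' B])
      = ∫⁻ ω, ∫⁻ y, φ (T ω, y) ∂κ (T ω) ∂(P[|T ⁻¹' B]) := by
  simp only [ProbabilityTheory.cond, lintegral_smul_measure]
  congr 1
  rw [← lintegral_indicator (hT hB), ← lintegral_indicator (hT hB)]
  have h1 := h.lintegral_eq hT hF (φ := (Prod.fst ⁻¹' B).indicator φ)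
    (hφ.indicator (measurable_fst hB))
  calc _ = ∫⁻ ω, (Prod.fst ⁻¹' B).indicator φ (T ω, F ω) ∂P := rfl
    _ = _ := h1
    _ = _ := by
      refine lintegral_congr fun ω => ?_
      by_cases hω : T ω ∈ B
      · simp [Set.indicator, hω]
      · simp [Set.indicator, hω]

/-- An event determined by the conditioning variable only restricts the values at which the kernel
is used. This is how kernels pass from `P` to the strata of the treatment. -/
lemma HasCondDistrib.cond [IsFiniteMeasure P] {T : Ω → α} {F : Ω → β} {κ : Kernel α β}
    [IsSFiniteKernel κ] (h : HasCondDistrib F T κ P) (hT : Measurable T) (hF : Measurable F)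
    {B : Set α} (hB : MeasurableSet B) {s : Set Ω} (hs : s = T ⁻¹' B) :
    HasCondDistrib F T κ P[|s] :=
  hs ▸ hasCondDistrib_of_lintegral hT hF fun _ hφ => h.lintegral_cond hT hF hB hφ

lemma HasCondDistrib.congr_left {T : Ω → α} {F F' : Ω → β} {κ : Kernel α β}
    (h : HasCondDistrib F T κ P) (hFF' : F =ᵐ[P] F') :
    HasCondDistrib F' T κ P := by
  have : (fun ω => (T ω, F ω)) =ᵐ[P] fun ω => (T ω, F' ω) := by
    filter_upwards [hFF'] with ω hω using by rw [hω]
  exact ⟨h.aemeasurable.congr this, (Measure.map_congr this).symm.trans h.map_eq⟩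

/-- The conditional expectation as an integral over a conditional law. -/
lemma HasCondDistrib.condExp_ae_eq [IsFiniteMeasure P] [StandardBorelSpace β] [Nonempty β]
    {T : Ω → α} {F : Ω → β} {κ : Kernel α β} [IsFiniteKernel κ] (h : HasCondDistrib F T κ P)
    (hT : Measurable T) (hF : Measurable F) {f : α × β → ℝ} (hf : Measurable f)
    (hi : Integrable (fun ω => f (T ω, F ω)) P) :
    condExp (sigmaOf T) P (fun ω => f (T ω, F ω)) =ᵐ[P] fun ω => ∫ y, f (T ω, y) ∂κ (T ω) := by
  have h1 := condExp_prod_ae_eq_integral_condDistrib hT hF.aemeasurable hf.stronglyMeasurable hi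
  have h2 := condDistrib_ae_eq_of_measure_eq_compProd T hF.aemeasurable h.map_eq
  filter_upwards [h1, ae_of_ae_map hT.aemeasurable h2] with ω h1 h2
  rw [h1, h2]

/-- A conditionally independent variable can be added to the conditioning variables. -/
lemma HasCondDistrib.add_indep [SFinite P] {T : Ω → α} {F : Ω → β} {G : Ω → γ} {κ : Kernel α β}
    {η : Kernel α γ} [IsSFiniteKernel κ] [IsSFiniteKernel η]
    (hT : Measurable T) (hF : Measurable F) (hG : Measurable G)
    (hκ : HasCondDistrib F T κ P)
    (hη : HasCondDistrib G (fun ω => (T ω, F ω)) (η.prodMkRight β) P) :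
    HasCondDistrib F (fun ω => (T ω, G ω)) (κ.prodMkRight γ) P := by
  have hη' : ∀ ψ : α × γ → ℝ≥0∞, Measurable ψ →
      ∫⁻ ω, ψ (T ω, G ω) ∂P = ∫⁻ ω, ∫⁻ z, ψ (T ω, z) ∂η (T ω) ∂P := fun ψ hψ =>
    hη.lintegral_eq (hT.prodMk hF) hG (φ := fun p => ψ (p.1.1, p.2)) (by fun_prop)
  refine hasCondDistrib_of_lintegral (hT.prodMk hG) hF fun φ hφ => ?_
  -- Integrate out `G` given `(T, F)`, then `F` given `T`; the remaining integral over `η (T ω)` is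
  -- read back as one over `G`, by the marginal form `hη'`.
  have h1 := hη.lintegral_eq (hT.prodMk hF) hG (φ := fun p => φ ((p.1.1, p.2), p.1.2))
    (by fun_prop)
  have h2 := hκ.lintegral_eq hT hF
    (φ := fun p => ∫⁻ z, φ ((p.1, z), p.2) ∂η p.1) (by
      have : Measurable fun p : (α × β) × γ => φ ((p.1.1, p.2), p.1.2) := by fun_prop
      exact this.lintegral_kernel_prod_right' (κ := η.prodMkRight β))
  have h3 := hη' (fun p => ∫⁻ y, φ (p, y) ∂κ p.1)
    (hφ.lintegral_kernel_prod_right' (κ := κ.prodMkRight γ))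
  simp only [Kernel.prodMkRight_apply] at h1 ⊢
  rw [h1, h2, h3]
  refine lintegral_congr fun ω => ?_
  dsimp only
  rw [lintegral_lintegral_swap]
  exact (hφ.comp (by fun_prop : Measurable fun p : β × γ => ((T ω, p.2), p.1))).aemeasurable

/-- Conditional laws can be composed. -/
lemma HasCondDistrib.compProd [SFinite P] {T : Ω → α} {F : Ω → β} {G : Ω → γ} {κ : Kernel α β}
    {η : Kernel (α × β) γ} [IsSFiniteKernel κ] [IsSFiniteKernel η]
    (hT : Measurable T) (hF : Measurable F) (hG : Measurable G)
    (hκ : HasCondDistrib F T κ P) (hη : HasCondDistrib G (fun ω => (T ω, F ω)) η P) :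
    HasCondDistrib (fun ω => (F ω, G ω)) T (κ ⊗ₖ η) P := by
  refine hasCondDistrib_of_lintegral hT (hF.prodMk hG) fun φ hφ => ?_
  have h1 := hη.lintegral_eq (hT.prodMk hF) hG (φ := fun p => φ (p.1.1, p.1.2, p.2))
    (by fun_prop)
  have h2 := hκ.lintegral_eq hT hF (φ := fun p => ∫⁻ z, φ (p.1, p.2, z) ∂η p) (by
      have : Measurable fun p : (α × β) × γ => φ (p.1.1, p.1.2, p.2) := by fun_prop
      exact this.lintegral_kernel_prod_right')
  rw [h1, h2]
  refine lintegral_congr fun ω => ?_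
  rw [Kernel.lintegral_compProd]
  fun_prop

end ConditionalLaws

/-! ### Conditional independence and decoupling. -/

section CondIndep

variable {Ω 𝓥 β γ : Type*} [mΩ : MeasurableSpace Ω] [StandardBorelSpace Ω] [Nonempty Ω]
  [MeasurableSpace 𝓥] [MeasurableSpace β] [MeasurableSpace γ] {P : Measure Ω} [IsFiniteMeasure P]
  {V : Ω → 𝓥} (hV : Measurable V)

/-- The product rule for conditional probabilities, integrated over events of `V`, is this equality
on rectangles. Both factors are images of the conditional law of `ω` itself, so the value spaces
need not be standard Borel; this matters when they are `Ω` with a smaller σ-algebra. -/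
lemma CondIndepFun.map_eq_compProd {F : Ω → β} {G : Ω → γ} (hF : Measurable F) (hG : Measurable G)
    (h : CondIndepFun (sigmaOf V) hV.comap_le F G P) :
    P.map (fun ω => (V ω, F ω, G ω))
      = P.map V ⊗ₘ ((condDistrib id V P).map F ×ₖ (condDistrib id V P).map G) := by
  rw [Measure.ext_prod₃_iff]
  intro s t u hs ht hu
  set κ := condDistrib id V P with hκ
  have key : ∀ᵐ ω ∂P, κ (V ω) (F ⁻¹' t ∩ G ⁻¹' u) = κ (V ω) (F ⁻¹' t) * κ (V ω) (G ⁻¹' u) := by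
    have h0 := (condIndepFun_iff_condExp_inter_preimage_eq_mul hF hG).1 h t u ht hu
    filter_upwards [h0, condDistrib_ae_eq_condExp hV measurable_id (μ := P) ((hF ht).inter (hG hu)),
      condDistrib_ae_eq_condExp hV measurable_id (μ := P) (hF ht),
      condDistrib_ae_eq_condExp hV measurable_id (μ := P) (hG hu)] with ω h0 h1 h2 h3
    simp only [Set.preimage_id] at h1 h2 h3
    replace h0 : _ = _ * _ := h0
    rw [← h1, ← h2, ← h3, measureReal_def, measureReal_def, measureReal_def,
      ← ENNReal.toReal_mul] at h0
    rwa [ENNReal.toReal_eq_toReal_iff' (measure_ne_top _ _)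
      (ENNReal.mul_ne_top (measure_ne_top _ _) (measure_ne_top _ _))] at h0
  rw [Measure.map_apply (by fun_prop) (hs.prod (ht.prod hu)),
    Measure.compProd_apply_prod hs (ht.prod hu)]
  simp only [Kernel.prod_apply_prod, Kernel.map_apply' _ hF _ ht, Kernel.map_apply' _ hG _ hu]
  rw [setLIntegral_map hs ((Kernel.measurable_coe κ (hF ht)).fun_mul
    (Kernel.measurable_coe κ (hG hu))) hV]
  calc P ((fun ω => (V ω, F ω, G ω)) ⁻¹' s ×ˢ t ×ˢ u)
        = P (V ⁻¹' s ∩ id ⁻¹' (F ⁻¹' t ∩ G ⁻¹' u)) := rfl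
    _ = ∫⁻ ω in V ⁻¹' s, κ (V ω) (F ⁻¹' t ∩ G ⁻¹' u) ∂P :=
        (setLIntegral_preimage_condDistrib hV aemeasurable_id ((hF ht).inter (hG hu)) hs).symm
    _ = _ := lintegral_congr_ae (ae_restrict_of_ae key)

/-- Conditionally independent variables are decoupled by two independent draws from the conditional
law of the outcome. -/
lemma CondIndepFun.lintegral_decouple {F : Ω → β} {G : Ω → γ} (hF : Measurable F)
    (hG : Measurable G) (h : CondIndepFun (sigmaOf V) hV.comap_le F G P)
    {φ : 𝓥 × β × γ → ℝ≥0∞} (hφ : Measurable φ) :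
    ∫⁻ ω, φ (V ω, F ω, G ω) ∂P = ∫⁻ ω, ∫⁻ ω₁, ∫⁻ ω₂, φ (V ω, F ω₁, G ω₂)
      ∂condDistrib id V P (V ω) ∂condDistrib id V P (V ω) ∂P := by
  rw [← lintegral_map (f := φ) hφ (by fun_prop), CondIndepFun.map_eq_compProd hV hF hG h,
    Measure.lintegral_compProd hφ, lintegral_map hφ.lintegral_kernel_prod_right' hV]
  refine lintegral_congr fun ω => ?_
  rw [Kernel.prod_apply, Kernel.map_apply _ hF, Kernel.map_apply _ hG, lintegral_prod,
    lintegral_map _ hF]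
  · refine lintegral_congr fun ω₁ => ?_
    rw [lintegral_map (by fun_prop) hG]
  · exact Measurable.lintegral_prod_right' (f := fun p : β × γ => φ (V ω, p.1, p.2)) (by fun_prop)
  · fun_prop

lemma measurable_section {α J E : Type*} [MeasurableSpace α] [MeasurableSpace J] [MeasurableSpace E]
    {F : J → α → E} (hF : Measurable fun q : α × J => F q.2 q.1) (j : J) : Measurable (F j) :=
  hF.comp (measurable_id.prodMk measurable_const)

/-- The two copies of the sample space are separate types, so that they can later be `Ω` with two
different σ-algebras. The index `p` of `G` may depend on the first copy only. -/
lemma measurable_decoupled {α₁ α₂ : Type*} [MeasurableSpace α₁]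
    [MeasurableSpace α₂] {J₁ J₂ E₁ E₂ : Type*} [MeasurableSpace J₁]
    [MeasurableSpace J₂] [MeasurableSpace E₁] [MeasurableSpace E₂] {F : J₁ → α₁ → E₁}
    {G : J₂ → α₂ → E₂} {p : α₁ → J₂}
    (hF : Measurable fun q : α₁ × J₁ => F q.2 q.1) (hG : Measurable fun q : α₂ × J₂ => G q.2 q.1)
    (hp : Measurable p) {ρ : E₂ → J₁} (hρ : Measurable ρ) {φ : 𝓥 × E₁ × E₂ → ℝ≥0∞}
    (hφ : Measurable φ) :
    Measurable fun x : 𝓥 × α₁ × α₂ =>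
      φ (x.1, F (ρ (G (p x.2.1) x.2.2)) x.2.1, G (p x.2.1) x.2.2) := by
  have h1 : Measurable fun x : 𝓥 × α₁ × α₂ => G (p x.2.1) x.2.2 :=
    hG.comp (f := fun x : 𝓥 × α₁ × α₂ => (x.2.2, p x.2.1)) (by fun_prop)
  have h2 : Measurable fun x : 𝓥 × α₁ × α₂ => F (ρ (G (p x.2.1) x.2.2)) x.2.1 :=
    hF.comp (f := fun x : 𝓥 × α₁ × α₂ => (x.2.1, ρ (G (p x.2.1) x.2.2)))
      ((measurable_fst.comp measurable_snd).prodMk (hρ.comp h1))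
  exact hφ.comp (measurable_fst.prodMk (h2.prodMk h1))

/-- Decoupling of conditionally independent random functions, evaluated at random indices: the index
of `G` is the common component `π (F j)` of the values of `F`, and the index of `F` is a
component of the value of `G` there. -/
theorem CondIndepFamilies.lintegral_decouple {J₁ J₂ E₁ E₂ : Type*} [mJ₁ : MeasurableSpace J₁]
    [mJ₂ : MeasurableSpace J₂] [MeasurableSpace E₁] [MeasurableSpace E₂] [MeasurableSingletonClass J₁]
    [MeasurableSingletonClass J₂] [Nonempty J₁] {F : J₁ → Ω → E₁} {G : J₂ → Ω → E₂}
    (h : CondIndepFamilies V hV F G P)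
    (hF : Measurable fun q : Ω × J₁ => F q.2 q.1) (hG : Measurable fun q : Ω × J₂ => G q.2 q.1)
    {π : E₁ → J₂} (hπ : Measurable π) {p : Ω → J₂} (hp : ∀ j ω, π (F j ω) = p ω)
    {ρ : E₂ → J₁} (hρ : Measurable ρ) {φ : 𝓥 × E₁ × E₂ → ℝ≥0∞} (hφ : Measurable φ) :
    ∫⁻ ω, φ (V ω, F (ρ (G (p ω) ω)) ω, G (p ω) ω) ∂P
      = ∫⁻ ω, ∫⁻ ω₁, ∫⁻ ω₂, φ (V ω, F (ρ (G (p ω₁) ω₂)) ω₁, G (p ω₁) ω₂)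
        ∂condDistrib id V P (V ω) ∂condDistrib id V P (V ω) ∂P := by
  obtain ⟨j₀⟩ := ‹Nonempty J₁›
  have hp' : p = fun ω => π (F j₀ ω) := funext fun ω => (hp j₀ ω).symm
  obtain ⟨hfix, ⟨hc₁, hc₂⟩ | ⟨𝒢₁, 𝒢₂, h𝒢₁, h𝒢₂, hF', hG', hind⟩⟩ := h
  · have hF1 (j) : Measurable (F j) := measurable_section hF j
    have hG1 (j) : Measurable (G j) := measurable_section hG j
    -- For countable index sets the integrand is split according to the values `q` of the two random
    -- indices. On each piece the indices are constant, and independence at fixed indices applies.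
    let Φ (q : J₁ × J₂) : 𝓥 × E₁ × E₂ → ℝ≥0∞ :=
      {e : 𝓥 × E₁ × E₂ | π e.2.1 = q.2 ∧ ρ e.2.2 = q.1}.indicator φ
    have hΦ (q) : Measurable (Φ q) := by
      refine hφ.indicator (MeasurableSet.inter ?_ ?_)
      · exact (measurableSet_singleton q.2).preimage (hπ.comp (by fun_prop))
      · exact (measurableSet_singleton q.1).preimage (hρ.comp (by fun_prop))
    have hsum (v : 𝓥) (ω₁ ω₂ : Ω) : φ (v, F (ρ (G (p ω₁) ω₂)) ω₁, G (p ω₁) ω₂)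
        = ∑' q : J₁ × J₂, Φ q (v, F q.1 ω₁, G q.2 ω₂) := by
      rw [tsum_eq_single (ρ (G (p ω₁) ω₂), p ω₁)]
      · simp [Φ, hp]
      · rintro ⟨j₁, j₂⟩ hj
        refine Set.indicator_of_notMem ?_ _
        rintro ⟨h1, h2⟩
        simp only [hp] at h1 h2
        subst h1 h2
        exact hj rfl
    have hM : ∀ q : J₁ × J₂, Measurable fun x : (𝓥 × Ω) × Ω => Φ q (x.1.1, F q.1 x.1.2, G q.2 x.2) :=
      fun q => (hΦ q).comp (by have := hF1 q.1; have := hG1 q.2; fun_prop)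
    simp_rw [hsum]
    have hM2 : ∀ q : J₁ × J₂, Measurable fun x : 𝓥 × Ω =>
        ∫⁻ ω₂, Φ q (x.1, F q.1 x.2, G q.2 ω₂) ∂condDistrib id V P x.1 := fun q =>
      (hM q).lintegral_kernel_prod_right' (κ := (condDistrib id V P).prodMkRight Ω)
    have hM3 : ∀ q : J₁ × J₂, Measurable fun x : 𝓥 =>
        ∫⁻ ω₁, ∫⁻ ω₂, Φ q (x, F q.1 ω₁, G q.2 ω₂) ∂condDistrib id V P x
          ∂condDistrib id V P x := fun q =>
      (hM2 q).lintegral_kernel_prod_right' (κ := condDistrib id V P)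
    have e1 (ω ω₁ : Ω) : ∫⁻ ω₂, ∑' q : J₁ × J₂, Φ q (V ω, F q.1 ω₁, G q.2 ω₂)
          ∂condDistrib id V P (V ω)
        = ∑' q : J₁ × J₂, ∫⁻ ω₂, Φ q (V ω, F q.1 ω₁, G q.2 ω₂) ∂condDistrib id V P (V ω) :=
      lintegral_tsum fun q => ((hM q).comp (by fun_prop : Measurable fun ω₂ : Ω =>
        ((V ω, ω₁), ω₂))).aemeasurable
    have e2 (ω : Ω) : ∫⁻ ω₁, ∑' q : J₁ × J₂, ∫⁻ ω₂, Φ q (V ω, F q.1 ω₁, G q.2 ω₂)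
          ∂condDistrib id V P (V ω) ∂condDistrib id V P (V ω)
        = ∑' q : J₁ × J₂, ∫⁻ ω₁, ∫⁻ ω₂, Φ q (V ω, F q.1 ω₁, G q.2 ω₂) ∂condDistrib id V P (V ω)
          ∂condDistrib id V P (V ω) :=
      lintegral_tsum fun q => ((hM2 q).comp (by fun_prop : Measurable fun ω₁ : Ω =>
        (V ω, ω₁))).aemeasurable
    simp_rw [e1, e2]
    refine (lintegral_tsum fun q => ((hΦ q).comp
      (hV.prodMk ((hF1 q.1).prodMk (hG1 q.2)))).aemeasurable).trans ((tsum_congr fun q => ?_).trans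
      (lintegral_tsum fun q => ((hM3 q).comp hV).aemeasurable).symm)
    exact CondIndepFun.lintegral_decouple hV (hF1 q.1) (hG1 q.2) (hfix q.1 q.2) (hΦ q)
  -- In general the two σ-algebras become random elements: the identity maps of `Ω` into `(Ω, 𝒢₁)`
  -- and `(Ω, 𝒢₂)` are conditionally independent, and decoupling them decouples everything
  -- measurable with respect to them.
  · have hind' : @CondIndepFun Ω (sigmaOf V) mΩ _ hV.comap_le Ω Ω 𝒢₁ 𝒢₂ id id P _ := by
      rw [condIndepFun_iff_condIndep]
      simpa using hind
    -- The index `p` is a component of any single `F j₀`, hence belongs to the first copy.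
    have hpm : @Measurable Ω J₂ 𝒢₁ mJ₂ p := by
      rw [hp']
      exact @Measurable.comp _ _ _ 𝒢₁ _ _ π (F j₀) hπ
        (@measurable_section Ω J₁ E₁ 𝒢₁ _ _ F hF' j₀)
    have hm := @measurable_decoupled 𝓥 _ Ω Ω 𝒢₁ 𝒢₂ J₁ J₂ E₁ E₂ _ _ _ _ F G p hF' hG' hpm ρ hρ φ hφ
    have key := @CondIndepFun.lintegral_decouple Ω 𝓥 Ω Ω mΩ _ _ _ 𝒢₁ 𝒢₂ P _ V hV id id h𝒢₁ h𝒢₂ hind'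
      (fun x => φ (x.1, F (ρ (G (p x.2.1) x.2.2)) x.2.1, G (p x.2.1) x.2.2)) hm
    exact key

/-- The law under `κ x` of the value at `x` of a function with a parameter. -/
noncomputable def Kernel.mapParam {α β γ : Type*} [MeasurableSpace α] [MeasurableSpace β]
    [MeasurableSpace γ] (κ : Kernel α β) (g : α × β → γ) : Kernel α γ :=
  (Kernel.id ×ₖ κ).map g

instance {α β γ : Type*} [MeasurableSpace α] [MeasurableSpace β] [MeasurableSpace γ]
    (κ : Kernel α β) [IsFiniteKernel κ] (g : α × β → γ) : IsFiniteKernel (κ.mapParam g) := by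
  unfold Kernel.mapParam; infer_instance

lemma Kernel.isMarkovKernel_mapParam {α β γ : Type*} [MeasurableSpace α] [MeasurableSpace β]
    [MeasurableSpace γ] (κ : Kernel α β) [IsMarkovKernel κ] {g : α × β → γ} (hg : Measurable g) :
    IsMarkovKernel (κ.mapParam g) :=
  Kernel.IsMarkovKernel.map _ hg

lemma Kernel.lintegral_mapParam {α β γ : Type*} [MeasurableSpace α] [MeasurableSpace β]
    [MeasurableSpace γ] (κ : Kernel α β) [IsSFiniteKernel κ] {g : α × β → γ} (hg : Measurable g)
    {φ : γ → ℝ≥0∞} (hφ : Measurable φ) (x : α) :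
    ∫⁻ z, φ z ∂κ.mapParam g x = ∫⁻ y, φ (g (x, y)) ∂κ x := by
  rw [Kernel.mapParam, Kernel.lintegral_map _ hg _ hφ, Kernel.prod_apply, Kernel.id_apply,
    MeasureTheory.lintegral_prod _ (by fun_prop), lintegral_dirac']
  exact Measurable.lintegral_prod_right' (f := fun p : α × β => φ (g p)) (by fun_prop)

/-- Disintegration of `P` along `V`. After decoupling, it merges one of the two draws back into the
actual outcome. -/
lemma lintegral_eq_condDistrib_id {V : Ω → 𝓥} (hV : Measurable V) {ψ : 𝓥 × Ω → ℝ≥0∞} (hψ : Measurable ψ) :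
    ∫⁻ ω, ψ (V ω, ω) ∂P = ∫⁻ ω, ∫⁻ ω₁, ψ (V ω, ω₁) ∂condDistrib id V P (V ω) ∂P :=
  (hasCondDistrib_condDistrib (P := P) hV measurable_id).lintegral_eq hV measurable_id hψ

/-- The conditional law, given `V` and a conditionally independent `G`, of a random function at an
index depending on `G`. -/
theorem CondIndepFamilies.hasCondDistrib_eval {J E : Type*} [MeasurableSpace J] [MeasurableSpace E]
    [MeasurableSingletonClass J] [Nonempty J] {F : J → Ω → E} {G : Ω → γ}
    (h : CondIndepFamilies V hV F (fun _ : Unit => G) P)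
    (hF : Measurable fun q : Ω × J => F q.2 q.1) (hG : Measurable G)
    {ρ : γ → J} (hρ : Measurable ρ) :
    HasCondDistrib (fun ω => F (ρ (G ω)) ω) (fun ω => (V ω, G ω))
      (((condDistrib id V P).prodMkRight γ).mapParam fun x => F (ρ x.1.2) x.2) P := by
  have hFm : Measurable fun ω => F (ρ (G ω)) ω :=
    hF.comp (f := fun ω => (ω, ρ (G ω))) (measurable_id.prodMk (hρ.comp hG))
  have hFp : Measurable fun x : (𝓥 × γ) × Ω => F (ρ x.1.2) x.2 :=
    hF.comp (f := fun x : (𝓥 × γ) × Ω => (x.2, ρ x.1.2))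
      (measurable_snd.prodMk (hρ.comp (by fun_prop)))
  refine hasCondDistrib_of_lintegral (hV.prodMk hG) hFm fun φ hφ => ?_
  have h1 := CondIndepFamilies.lintegral_decouple hV h hF
    (hG.comp measurable_fst : Measurable fun q : Ω × Unit => G q.1)
    (π := fun _ => ()) measurable_const (p := fun _ => ()) (fun _ _ => rfl) hρ
    (φ := fun x => φ ((x.1, x.2.2), x.2.1)) (by fun_prop)
  have hM : Measurable fun x : (𝓥 × Ω) × Ω => φ ((x.1.1, G x.1.2), F (ρ (G x.1.2)) x.2) :=
    hφ.comp (f := fun x : (𝓥 × Ω) × Ω => ((x.1.1, G x.1.2), F (ρ (G x.1.2)) x.2))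
      ((by fun_prop : Measurable fun x : (𝓥 × Ω) × Ω => (x.1.1, G x.1.2)).prodMk
        (hFp.comp (f := fun x : (𝓥 × Ω) × Ω => ((x.1.1, G x.1.2), x.2)) (by fun_prop)))
  have h2 := lintegral_eq_condDistrib_id (P := P) hV
    (ψ := fun x => ∫⁻ ω₁, φ ((x.1, G x.2), F (ρ (G x.2)) ω₁) ∂condDistrib id V P x.1)
    (hM.lintegral_kernel_prod_right' (κ := (condDistrib id V P).prodMkRight Ω))
  have h3 (ω : Ω) : ∫⁻ y, φ ((V ω, G ω), y) ∂((condDistrib id V P).prodMkRight γ).mapParam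
      (fun x => F (ρ x.1.2) x.2) (V ω, G ω)
      = ∫⁻ ω₁, φ ((V ω, G ω), F (ρ (G ω)) ω₁) ∂condDistrib id V P (V ω) :=
    Kernel.lintegral_mapParam _ hFp (by fun_prop) _
  simp_rw [h3]
  rw [h1, h2]
  refine lintegral_congr fun ω => ?_
  dsimp only
  rw [lintegral_lintegral_swap]
  exact (hM.comp (f := fun p : Ω × Ω => ((V ω, p.2), p.1)) (by fun_prop)).aemeasurable

/-- The conditional law of `F` given `V` is not changed by conditioning on a conditionally
independent variable. -/
lemma CondIndepFun.hasCondDistrib {F : Ω → β} {G : Ω → γ}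
    (hF : Measurable F) (hG : Measurable G) (h : CondIndepFun (sigmaOf V) hV.comap_le F G P) :
    HasCondDistrib F (fun ω => (V ω, G ω)) (((condDistrib id V P).map F).prodMkRight γ) P := by
  refine hasCondDistrib_of_lintegral (hV.prodMk hG) hF fun φ hφ => ?_
  have h1 := CondIndepFun.lintegral_decouple hV hF hG h (φ := fun p => φ ((p.1, p.2.2), p.2.1))
    (by fun_prop)
  have hm : Measurable fun p : 𝓥 × Ω =>
      ∫⁻ y, φ ((p.1, G p.2), y) ∂(condDistrib id V P).map F p.1 := by
    have : Measurable fun p : (𝓥 × Ω) × β => φ ((p.1.1, G p.1.2), p.2) := by fun_prop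
    exact this.lintegral_kernel_prod_right' (κ := ((condDistrib id V P).map F).prodMkRight Ω)
  have h2 := lintegral_eq_condDistrib_id (P := P) hV hm
  simp only [Kernel.prodMkRight_apply] at h2 ⊢
  rw [h1, h2]
  refine lintegral_congr fun ω => ?_
  dsimp only
  rw [lintegral_lintegral_swap]
  · refine lintegral_congr fun ω₂ => ?_
    rw [Kernel.lintegral_map _ hF _ (by fun_prop)]
  · exact (hφ.comp (by fun_prop : Measurable fun p : Ω × Ω => ((V ω, G p.2), F p.1))).aemeasurable

end CondIndep

end ProbabilityTheory

/-! ### Change of conditioning variables, positive densities, completeness. -/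

namespace ProbabilityTheory

section ConditionalLaws

variable {Ω α α' β γ : Type*} [mΩ : MeasurableSpace Ω] [MeasurableSpace α] [MeasurableSpace α']
  [MeasurableSpace β] [MeasurableSpace γ] {P : Measure Ω}

/-- The conditioning variable can be replaced by a function of it which determines it. -/
lemma HasCondDistrib.reparam [SFinite P] {T : Ω → α} {F : Ω → β} {κ : Kernel α β}
    [IsSFiniteKernel κ] (h : HasCondDistrib F T κ P) (hT : Measurable T) (hF : Measurable F)
    {f : α → α'} (hf : Measurable f) {e : α' → α} (he : Measurable e)
    (hfe : ∀ᵐ ω ∂P, e (f (T ω)) = T ω) :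
    HasCondDistrib F (fun ω => f (T ω)) (κ.comap e he) P := by
  refine hasCondDistrib_of_lintegral (hf.comp hT) hF fun φ hφ => ?_
  rw [h.lintegral_eq hT hF (φ := fun p => φ (f p.1, p.2)) (by fun_prop)]
  refine lintegral_congr_ae ?_
  filter_upwards [hfe] with ω hω
  rw [Kernel.comap_apply, hω]

/-- A conditional law which depends only on `f T` is the conditional law given `f T`. -/
lemma HasCondDistrib.coarsen [SFinite P] {T : Ω → α} {F : Ω → β} {κ : Kernel α' β}
    [IsSFiniteKernel κ] {f : α → α'} {hf : Measurable f} (h : HasCondDistrib F T (κ.comap f hf) P) :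
    HasCondDistrib F (fun ω => f (T ω)) κ P :=
  h.comp_right

/-- A positive conditional density makes the joint law equivalent to a product, also after
conditioning on an event of the conditioning variable. -/
lemma absolutelyContinuous_of_density [IsFiniteMeasure P] {T : Ω → α} {F : Ω → β}
    (hT : Measurable T) (hF : Measurable F) {ν : Measure β} [SigmaFinite ν] {f : α × β → ℝ≥0∞}
    (hf : Measurable f)
    (h : P.map (fun ω => (T ω, F ω)) = ((P.map T).prod ν).withDensity f)
    (hpos : ∀ y, ∀ᵐ ω ∂P, 0 < f (T ω, y)) {E : Set α} (hE : MeasurableSet E) :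
    (P[|T ⁻¹' E]).map (fun ω => (T ω, F ω)) ≪ ((P[|T ⁻¹' E]).map T).prod ν ∧
      ((P[|T ⁻¹' E]).map T).prod ν ≪ (P[|T ⁻¹' E]).map (fun ω => (T ω, F ω)) := by
  -- Positivity is given almost surely for each fixed `y`; Fubini, with the coordinates swapped,
  -- makes it hold almost everywhere for the product.
  have hpos' : ∀ᵐ p ∂(P.map T).prod ν, f p ≠ 0 := by
    have hs : MeasurableSet {p : α × β | f p ≠ 0} :=
      (hf (measurableSet_singleton 0)).compl
    have h1 : ∀ᵐ q ∂ν.prod (P.map T), f q.swap ≠ 0 := by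
      rw [Measure.ae_prod_iff_ae_ae (p := fun q : β × α => f q.swap ≠ 0) (measurable_swap hs)]
      refine Eventually.of_forall fun y => ?_
      rw [ae_map_iff hT.aemeasurable (by exact hs.preimage (by fun_prop :
        Measurable fun x : α => (x, y)))]
      filter_upwards [hpos y] with ω hω using hω.ne'
    have h2 := Measure.prod_swap (μ := ν) (ν := P.map T)
    rw [← h2]
    exact (ae_map_iff measurable_swap.aemeasurable hs).2 (by simpa using h1)
  have hac1 : P.map (fun ω => (T ω, F ω)) ≪ (P.map T).prod ν := by
    rw [h]; exact withDensity_absolutelyContinuous _ _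
  have hac2 : (P.map T).prod ν ≪ P.map (fun ω => (T ω, F ω)) := by
    rw [h]; exact withDensity_absolutelyContinuous' hf.aemeasurable hpos'
  by_cases h0 : P (T ⁻¹' E) = 0
  · simp [cond_eq_zero_of_meas_eq_zero h0]
  -- Conditioning on an event of `T` restricts both measures to the same cylinder and scales them by
  -- the same constant, so their equivalence is preserved.
  have hr1 : (P[|T ⁻¹' E]).map (fun ω => (T ω, F ω))
      = (P (T ⁻¹' E))⁻¹ • (P.map (fun ω => (T ω, F ω))).restrict (E ×ˢ Set.univ) := by
    rw [cond, Measure.map_smul, Measure.restrict_map (hT.prodMk hF) (hE.prod .univ)]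
    congr 4
    ext ω; simp
  have hr2 : ((P[|T ⁻¹' E]).map T).prod ν
      = (P (T ⁻¹' E))⁻¹ • ((P.map T).prod ν).restrict (E ×ˢ Set.univ) := by
    rw [cond, Measure.map_smul, ← Measure.restrict_map hT hE, ← Measure.prod_restrict,
      Measure.restrict_univ, Measure.prod_smul_left]
  rw [hr1, hr2]
  have hc : (P (T ⁻¹' E))⁻¹ ≠ 0 := by simp
  exact ⟨((hac1.restrict _).smul_left _).trans (Measure.absolutelyContinuous_smul hc),
    ((hac2.restrict _).smul_left _).trans (Measure.absolutelyContinuous_smul hc)⟩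

/-- A residual whose conditional expectation given a coarse σ-algebra with an instrument `Z` is zero
has conditional expectation zero given `T`, if the instrument is complete for functions of `T`. -/
lemma condExp_eq_zero_of_complete [IsProbabilityMeasure P] [StandardBorelSpace β] [Nonempty β]
    {T : Ω → α} {F : Ω → β} {Z : Ω → γ} (hT : Measurable T) (hF : Measurable F) (hZ : Measurable Z)
    {η : Kernel α γ} [IsSFiniteKernel η]
    (hη : HasCondDistrib Z (fun ω => (T ω, F ω)) (η.prodMkRight β) P)
    {δ : Type*} [MeasurableSpace δ] {R : Ω → δ} (hm : sigmaOf R ≤ sigmaOf fun ω => (T ω, Z ω))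
    {f : α × β → ℝ} (hf : Measurable f) (hf2 : MemLp (fun ω => f (T ω, F ω)) 2 P)
    (h0 : condExp (sigmaOf R) P (fun ω => f (T ω, F ω)) =ᵐ[P] 0)
    (hcompl : ∀ g : α → ℝ, Measurable g → MemLp (fun ω => g (T ω)) 2 P →
      condExp (sigmaOf R) P (fun ω => g (T ω)) =ᵐ[P] 0 → (fun ω => g (T ω)) =ᵐ[P] 0) :
    condExp (sigmaOf T) P (fun ω => f (T ω, F ω)) =ᵐ[P] 0 := by
  have hi : Integrable (fun ω => f (T ω, F ω)) P := hf2.integrable (by norm_num)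
  have hκ := hasCondDistrib_condDistrib (P := P) hT hF
  set κ := condDistrib F T P
  let g : α → ℝ := fun t => ∫ y, f (t, y) ∂κ t
  have hg : Measurable g := (hf.stronglyMeasurable.integral_kernel_prod_right' (κ := κ)).measurable
  have h1 : condExp (sigmaOf T) P (fun ω => f (T ω, F ω)) =ᵐ[P] fun ω => g (T ω) :=
    hκ.condExp_ae_eq hT hF hf hi
  -- Adding `Z` to the conditioning leaves the regression `g (T)` unchanged. The σ-algebra of `R` is
  -- coarser than that of `(T, Z)`, so the tower property gives `g (T)` conditional mean zero given
  -- `R`, and completeness applies.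
  have hκ' := HasCondDistrib.add_indep hT hF hZ hκ hη
  have h2 : condExp (sigmaOf fun ω => (T ω, Z ω)) P (fun ω => f (T ω, F ω))
      =ᵐ[P] fun ω => g (T ω) :=
    hκ'.condExp_ae_eq (hT.prodMk hZ) hF (f := fun p => f (p.1.1, p.2)) (by fun_prop) hi
  have hg2 : MemLp (fun ω => g (T ω)) 2 P := (memLp_congr_ae h1).1 (hf2.condExp (by norm_num))
  have h3 : condExp (sigmaOf R) P (fun ω => g (T ω)) =ᵐ[P] 0 :=
    (condExp_congr_ae h2.symm).trans
      ((condExp_condExp_of_le hm (hT.prodMk hZ).comap_le).trans h0)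
  exact h1.trans (hcompl g hg hg2 h3)

end ConditionalLaws

end ProbabilityTheory

/-! ### Positivity: comparison of the treatment strata. -/

namespace PathModel

variable {Ω 𝓤 𝓜 𝓓 𝓩 𝓦 𝓧 : Type*} [mΩ : MeasurableSpace Ω]
    [MeasurableSpace 𝓤] [MeasurableSpace 𝓜] [MeasurableSpace 𝓓] [MeasurableSpace 𝓩]
    [MeasurableSpace 𝓦] [MeasurableSpace 𝓧]
    (S : PathModel Ω 𝓤 𝓜 𝓓 𝓩 𝓦 𝓧) (P : Measure Ω)

instance (a : Fin 2) : IsFiniteMeasure (S.given P a) := by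
  unfold given; infer_instance

section Positivity

variable {E : Type*} [MeasurableSpace E] {T : Ω → E}

lemma measurableSet_event (a : Fin 2) : MeasurableSet (S.A ⁻¹' {a}) :=
  S.measurable_A (measurableSet_singleton a)

lemma ae_given (a : Fin 2) : ∀ᵐ ω ∂S.given P a, S.A ω = a := by
  have := ae_cond_mem (μ := P) (S.measurableSet_event a)
  filter_upwards [this] with ω hω using hω

lemma given_absolutelyContinuous (a : Fin 2) : S.given P a ≪ P :=
  cond_absolutelyContinuous

lemma given_le (a : Fin 2) : S.given P a ≤ (P (S.A ⁻¹' {a}))⁻¹ • P := by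
  rw [given, ProbabilityTheory.cond]
  gcongr
  exact Measure.restrict_le_self

variable {P} in
lemma integrable_given [IsFiniteMeasure P] {f : Ω → ℝ} (hf : Integrable f P) {a : Fin 2} :
    Integrable f (S.given P a) := by
  by_cases h0 : P (S.A ⁻¹' {a}) = 0
  · rw [given, cond_eq_zero_of_meas_eq_zero h0]
    exact integrable_zero_measure
  · exact (hf.smul_measure (ENNReal.inv_ne_top.2 h0)).mono_measure (S.given_le P a)

variable [IsProbabilityMeasure P]

lemma measure_event_ne_zero {a : Fin 2} (h : ∀ᵐ ω ∂P, 0 < S.propensity P a T ω) :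
    P (S.A ⁻¹' {a}) ≠ 0 := by
  intro h0
  have h1 : ((S.A ⁻¹' {a}).indicator fun _ => (1 : ℝ)) =ᵐ[P] 0 :=
    indicator_meas_zero h0
  have h2 : S.propensity P a T =ᵐ[P] 0 :=
    (condExp_congr_ae h1).trans (by rw [condExp_zero])
  have h3 : ∀ᵐ _ ∂P, False := by
    filter_upwards [h, h2] with ω h h2
    rw [h2] at h
    exact lt_irrefl _ h
  exact IsProbabilityMeasure.ne_zero P (by simpa using h3)

lemma isProbabilityMeasure_given {a : Fin 2} (h : P (S.A ⁻¹' {a}) ≠ 0) :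
    IsProbabilityMeasure (S.given P a) :=
  cond_isProbabilityMeasure h

lemma setIntegral_propensity (hT : Measurable T) (a : Fin 2) {B : Set E} (hB : MeasurableSet B) :
    ∫ ω in T ⁻¹' B, S.propensity P a T ω ∂P = P.real (S.A ⁻¹' {a} ∩ T ⁻¹' B) := by
  unfold propensity
  rw [setIntegral_condExp hT.comap_le
    ((integrable_const _).indicator (S.measurableSet_event a)) ⟨B, hB, rfl⟩,
    integral_indicator (S.measurableSet_event a), integral_const, smul_eq_mul, mul_one,
    measureReal_restrict_apply_univ, measureReal_restrict_apply (S.measurableSet_event a)]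

/-- Over an event of `T` that is null in the stratum, the propensity integrates to zero; being
positive, it forces the event to be null. -/
lemma map_absolutelyContinuous_given (hT : Measurable T) {a : Fin 2}
    (h : ∀ᵐ ω ∂P, 0 < S.propensity P a T ω) : P.map T ≪ (S.given P a).map T := by
  refine Measure.AbsolutelyContinuous.mk fun B hB h0 => ?_
  rw [Measure.map_apply hT hB] at h0 ⊢
  have h1 : P (S.A ⁻¹' {a} ∩ T ⁻¹' B) = 0 := by
    rw [given, cond_apply (S.measurableSet_event a)] at h0
    simpa using h0
  have h2 := S.setIntegral_propensity P hT a hB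
  rw [measureReal_def, h1, ENNReal.toReal_zero,
    setIntegral_eq_zero_iff_of_nonneg_ae (ae_restrict_of_ae (h.mono fun _ h => h.le))
      integrable_condExp.integrableOn] at h2
  rw [← Measure.restrict_eq_zero, ← ae_eq_bot, ← Filter.eventually_false_iff_eq_bot]
  filter_upwards [h2, ae_restrict_of_ae h] with ω h2 h
  rw [h2] at h
  exact lt_irrefl _ h

/-- The converse: the set where the propensity is not positive is an event of `T` without mass in
the stratum. -/
lemma propensity_pos (hT : Measurable T) {a : Fin 2} (h : P.map T ≪ (S.given P a).map T) :
    ∀ᵐ ω ∂P, 0 < S.propensity P a T ω := by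
  have hm : Measurable[sigmaOf T] (S.propensity P a T) := stronglyMeasurable_condExp.measurable
  obtain ⟨B, hB, hBeq⟩ : MeasurableSet[sigmaOf T] {ω | S.propensity P a T ω ≤ 0} :=
    measurableSet_le hm measurable_const
  have h2 := S.setIntegral_propensity P hT a hB
  have h3 : ∫ ω in T ⁻¹' B, S.propensity P a T ω ∂P ≤ 0 := by
    refine setIntegral_nonpos (hT hB) fun ω hω => ?_
    rw [hBeq] at hω
    exact hω
  have h4 : P (S.A ⁻¹' {a} ∩ T ⁻¹' B) = 0 := by
    have : P.real (S.A ⁻¹' {a} ∩ T ⁻¹' B) = 0 :=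
      le_antisymm (h2 ▸ h3) measureReal_nonneg
    rwa [measureReal_eq_zero_iff] at this
  have h5 : P.map T B = 0 := by
    refine h ?_
    rw [Measure.map_apply hT hB, given, cond_apply (S.measurableSet_event a), h4, mul_zero]
  rw [Measure.map_apply hT hB, hBeq] at h5
  rw [ae_iff]
  simpa using h5

lemma map_absolutelyContinuous_given_of_forall (hT : Measurable T)
    (h : ∀ a b, (S.given P a).map T ≪ (S.given P b).map T) (b : Fin 2) :
    P.map T ≪ (S.given P b).map T := by
  refine Measure.AbsolutelyContinuous.mk fun B hB h0 => ?_
  rw [Measure.map_apply hT hB]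
  have h1 (a : Fin 2) : P (S.A ⁻¹' {a} ∩ T ⁻¹' B) = 0 := by
    have := h a b h0
    rw [Measure.map_apply hT hB, given, cond_apply (S.measurableSet_event a)] at this
    simpa using this
  refine measure_mono_null (t := ⋃ a, S.A ⁻¹' {a} ∩ T ⁻¹' B) (fun ω hω => ?_)
    (measure_iUnion_null h1)
  exact Set.mem_iUnion.2 ⟨S.A ω, rfl, hω⟩

end Positivity

lemma measurable_UXD : Measurable fun ω => ((S.U ω, S.X ω), S.D ω) :=
  S.measurable_UX.prodMk S.measurable_D

lemma measurable_UXDM : Measurable fun ω => (((S.U ω, S.X ω), S.D ω), S.M ω) :=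
  S.measurable_UXD.prodMk S.measurable_M

variable {S P} [IsProbabilityMeasure P]

lemma Positivity.event_ne_zero (hpos : S.Positivity P) (a : Fin 2) : P (S.A ⁻¹' {a}) ≠ 0 :=
  S.measure_event_ne_zero P (hpos.treatment a)

lemma Positivity.map_UX (hpos : S.Positivity P) (a : Fin 2) :
    P.map (fun ω => (S.U ω, S.X ω)) ≪ (S.given P a).map fun ω => (S.U ω, S.X ω) :=
  S.map_absolutelyContinuous_given P S.measurable_UX (hpos.treatment a)

/-- Equivalence with a product measure survives conditioning on `A = a` and the push-forward
forgetting `A`. That one `ν` serves both strata is what makes them comparable. -/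
lemma Positivity.exists_dominating_witness (hpos : S.Positivity P) :
    ∃ ν : Measure 𝓓, SigmaFinite ν ∧ ∀ a,
      (S.given P a).map (fun ω => ((S.U ω, S.X ω), S.D ω))
        ≪ ((S.given P a).map fun ω => (S.U ω, S.X ω)).prod ν ∧
      ((S.given P a).map fun ω => (S.U ω, S.X ω)).prod ν
        ≪ (S.given P a).map fun ω => ((S.U ω, S.X ω), S.D ω) := by
  obtain ⟨ν, f, hν, hf, heq, hp⟩ := hpos.witness
  refine ⟨ν, hν, fun a => ?_⟩
  have hE : MeasurableSet {c : Fin 2 × 𝓤 × 𝓧 | c.1 = a} :=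
    measurable_fst (measurableSet_singleton a)
  have h : _ ∧ _ := absolutelyContinuous_of_density S.measurable_AUX S.measurable_D hf heq hp hE
  have hg : Measurable (Prod.map Prod.snd id : (Fin 2 × 𝓤 × 𝓧) × 𝓓 → (𝓤 × 𝓧) × 𝓓) := by fun_prop
  have e1 : ((S.given P a).map fun ω => ((S.A ω, S.U ω, S.X ω), S.D ω)).map (Prod.map Prod.snd id)
      = (S.given P a).map fun ω => ((S.U ω, S.X ω), S.D ω) :=
    Measure.map_map hg (S.measurable_AUX.prodMk S.measurable_D)
  have e2 : (((S.given P a).map fun ω => (S.A ω, S.U ω, S.X ω)).prod ν).map (Prod.map Prod.snd id)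
      = ((S.given P a).map fun ω => (S.U ω, S.X ω)).prod ν := by
    rw [← Measure.map_prod_map _ _ measurable_snd measurable_id, Measure.map_id,
      Measure.map_map measurable_snd S.measurable_AUX]
    rfl
  rw [← e1, ← e2]
  exact ⟨h.1.map hg, h.2.map hg⟩

lemma Positivity.exists_dominating_mediator (hpos : S.Positivity P) :
    ∃ ν : Measure 𝓜, SigmaFinite ν ∧ ∀ a,
      (S.given P a).map (fun ω => (((S.U ω, S.X ω), S.D ω), S.M ω))
        ≪ ((S.given P a).map fun ω => ((S.U ω, S.X ω), S.D ω)).prod ν ∧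
      ((S.given P a).map fun ω => ((S.U ω, S.X ω), S.D ω)).prod ν
        ≪ (S.given P a).map fun ω => (((S.U ω, S.X ω), S.D ω), S.M ω) := by
  obtain ⟨ν, f, hν, hf, heq, hp⟩ := hpos.mediator
  refine ⟨ν, hν, fun a => ?_⟩
  have hE : MeasurableSet {c : 𝓓 × Fin 2 × 𝓤 × 𝓧 | c.2.1 = a} :=
    (measurable_fst.comp measurable_snd) (measurableSet_singleton a)
  have h : _ ∧ _ := absolutelyContinuous_of_density S.measurable_DAUX S.measurable_M hf heq hp hE
  let r : 𝓓 × Fin 2 × 𝓤 × 𝓧 → (𝓤 × 𝓧) × 𝓓 := fun c => (c.2.2, c.1)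
  have hr : Measurable r := by fun_prop
  have hg : Measurable (Prod.map r id : (𝓓 × Fin 2 × 𝓤 × 𝓧) × 𝓜 → _ × 𝓜) := by fun_prop
  have e1 : ((S.given P a).map fun ω => ((S.D ω, S.A ω, S.U ω, S.X ω), S.M ω)).map (Prod.map r id)
      = (S.given P a).map fun ω => (((S.U ω, S.X ω), S.D ω), S.M ω) :=
    Measure.map_map hg (S.measurable_DAUX.prodMk S.measurable_M)
  have e2 : (((S.given P a).map fun ω => (S.D ω, S.A ω, S.U ω, S.X ω)).prod ν).map (Prod.map r id)
      = ((S.given P a).map fun ω => ((S.U ω, S.X ω), S.D ω)).prod ν := by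
    rw [← Measure.map_prod_map _ _ hr measurable_id, Measure.map_id,
      Measure.map_map hr S.measurable_DAUX]
    rfl
  rw [← e1, ← e2]
  exact ⟨h.1.map hg, h.2.map hg⟩

/-- Each side is equivalent to the law of `(U, X)` in its stratum times the common `ν`, and positive
propensities make the two laws of `(U, X)` comparable. `Positivity.map_UXDM` repeats the argument
one variable further. -/
lemma Positivity.map_UXD (hpos : S.Positivity P) (a b : Fin 2) :
    (S.given P a).map (fun ω => ((S.U ω, S.X ω), S.D ω))
      ≪ (S.given P b).map fun ω => ((S.U ω, S.X ω), S.D ω) := by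
  obtain ⟨ν, hν, h⟩ := hpos.exists_dominating_witness
  exact (h a).1.trans (((((S.given_absolutelyContinuous P a).map S.measurable_UX).trans
    (hpos.map_UX b)).prod Measure.AbsolutelyContinuous.rfl).trans (h b).2)

lemma Positivity.map_UXDM (hpos : S.Positivity P) (a b : Fin 2) :
    (S.given P a).map (fun ω => (((S.U ω, S.X ω), S.D ω), S.M ω))
      ≪ (S.given P b).map fun ω => (((S.U ω, S.X ω), S.D ω), S.M ω) := by
  obtain ⟨ν, hν, h⟩ := hpos.exists_dominating_mediator
  exact (h a).1.trans (((hpos.map_UXD a b).prod Measure.AbsolutelyContinuous.rfl).trans (h b).2)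

end PathModel

/-! ### Proxies, and bridge equations given the latent confounders. -/

lemma sigmaOf_comp_le {Ω α β : Type*} [MeasurableSpace α] [MeasurableSpace β] {f : Ω → α}
    {g : α → β} (hg : Measurable g) : sigmaOf (fun ω => g (f ω)) ≤ sigmaOf f := by
  rintro _ ⟨s, hs, rfl⟩
  exact ⟨g ⁻¹' s, hg hs, rfl⟩

namespace PathModel

variable {Ω 𝓤 𝓜 𝓓 𝓩 𝓦 𝓧 : Type*} [mΩ : MeasurableSpace Ω]
    [MeasurableSpace 𝓤] [MeasurableSpace 𝓜] [MeasurableSpace 𝓓] [MeasurableSpace 𝓩]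
    [MeasurableSpace 𝓦] [MeasurableSpace 𝓧]
    {S : PathModel Ω 𝓤 𝓜 𝓓 𝓩 𝓦 𝓧} {P : Measure Ω}

lemma measurable_WDMY (S : PathModel Ω 𝓤 𝓜 𝓓 𝓩 𝓦 𝓧) :
    Measurable fun ω => (S.W ω, S.D ω, S.M ω, S.Y ω) :=
  S.measurable_W.prodMk (S.measurable_D.prodMk (S.measurable_M.prodMk S.measurable_Y))

lemma measurable_ADM (S : PathModel Ω 𝓤 𝓜 𝓓 𝓩 𝓦 𝓧) :
    Measurable fun ω => (S.A ω, S.D ω, S.M ω) :=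
  S.measurable_A.prodMk (S.measurable_D.prodMk S.measurable_M)

lemma condExp_sub_eq_zero {Q : Measure Ω} {δ δ' : Type*} [MeasurableSpace δ] [MeasurableSpace δ']
    {R : Ω → δ} {R' : Ω → δ'} {f g : Ω → ℝ} (hf : Integrable f Q) (hg : Integrable g Q)
    (hR : sigmaOf R = sigmaOf R')
    (h : condExp (sigmaOf R) Q f =ᵐ[Q] condExp (sigmaOf R) Q g) :
    condExp (sigmaOf R') Q (fun ω => f ω - g ω) =ᵐ[Q] 0 := by
  rw [← hR]
  refine (condExp_sub hf hg (sigmaOf R)).trans ?_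
  filter_upwards [h] with ω hω
  simp [hω]

variable [StandardBorelSpace Ω]

section Proxies

variable [Nonempty Ω] [IsProbabilityMeasure P]

/-- The conditional law of `W` given `(U, X)`. -/
noncomputable def lawW (S : PathModel Ω 𝓤 𝓜 𝓓 𝓩 𝓦 𝓧) (P : Measure Ω) [IsProbabilityMeasure P] :
    Kernel (𝓤 × 𝓧) 𝓦 :=
  (condDistrib id (fun ω => (S.U ω, S.X ω)) P).map S.W

instance : IsMarkovKernel (S.lawW P) := Kernel.IsMarkovKernel.map _ S.measurable_W

lemma hasCondDistrib_W_UX : HasCondDistrib S.W (fun ω => (S.U ω, S.X ω)) (S.lawW P) P :=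
  (hasCondDistrib_condDistrib S.measurable_UX measurable_id).comp_left S.measurable_W

/-- The kernel depends on `(U, X)` alone, so the same `lawW` remains the conditional law of `W` in
either stratum and after dropping `D` or `M` from the conditioning. -/
lemma ProxyVariables.hasCondDistrib_W (hproxy : S.ProxyVariables P) (a : Fin 2) :
    HasCondDistrib S.W (fun ω => ((S.U ω, S.X ω), (S.A ω, S.D ω, S.M ω)))
      ((S.lawW P).comap (fun c : (𝓤 × 𝓧) × (Fin 2 × 𝓓 × 𝓜) => c.1) (by fun_prop)) (S.given P a) := by
  have h := CondIndepFun.hasCondDistrib S.measurable_UX S.measurable_W S.measurable_ADM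
    hproxy.outcome_proxy
  have hE : MeasurableSet {c : (𝓤 × 𝓧) × (Fin 2 × 𝓓 × 𝓜) | c.2.1 = a} :=
    (measurable_fst.comp measurable_snd) (measurableSet_singleton a)
  exact HasCondDistrib.cond h (S.measurable_UX.prodMk S.measurable_ADM) S.measurable_W hE rfl

lemma ProxyVariables.hasCondDistrib_W_UXDM (hproxy : S.ProxyVariables P) (a : Fin 2) :
    HasCondDistrib S.W (fun ω => (((S.U ω, S.X ω), S.D ω), S.M ω))
      ((S.lawW P).comap (fun t : ((𝓤 × 𝓧) × 𝓓) × 𝓜 => t.1.1) (by fun_prop)) (S.given P a) :=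
  HasCondDistrib.coarsen (T := fun ω => ((S.U ω, S.X ω), (S.A ω, S.D ω, S.M ω)))
    (f := fun c : (𝓤 × 𝓧) × (Fin 2 × 𝓓 × 𝓜) => ((c.1, c.2.2.1), c.2.2.2))
    (hf := by fun_prop) (hproxy.hasCondDistrib_W a)

lemma ProxyVariables.hasCondDistrib_W_UXD (hproxy : S.ProxyVariables P) (a : Fin 2) :
    HasCondDistrib S.W (fun ω => ((S.U ω, S.X ω), S.D ω))
      ((S.lawW P).comap (fun t : (𝓤 × 𝓧) × 𝓓 => t.1) (by fun_prop)) (S.given P a) :=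
  HasCondDistrib.coarsen (T := fun ω => ((S.U ω, S.X ω), (S.A ω, S.D ω, S.M ω)))
    (f := fun c : (𝓤 × 𝓧) × (Fin 2 × 𝓓 × 𝓜) => (c.1, c.2.2.1))
    (hf := by fun_prop) (hproxy.hasCondDistrib_W a)

lemma ProxyVariables.hasCondDistrib_W_UX_given (hproxy : S.ProxyVariables P) (a : Fin 2) :
    HasCondDistrib S.W (fun ω => (S.U ω, S.X ω)) (S.lawW P) (S.given P a) :=
  HasCondDistrib.coarsen (T := fun ω => ((S.U ω, S.X ω), (S.A ω, S.D ω, S.M ω)))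
    (f := fun c : (𝓤 × 𝓧) × (Fin 2 × 𝓓 × 𝓜) => c.1)
    (hf := by fun_prop) (hproxy.hasCondDistrib_W a)

/-- Within a stratum the constant value of `A` is absorbed into the kernel. The map `t` selects the
latent conditioning variables, in the applications `(V, D, M)`, `(V, D)` or `V` with `V = (U, X)`,
and `v` recovers `V` from them. -/
lemma ProxyVariables.exists_hasCondDistrib_Z (hproxy : S.ProxyVariables P) (a : Fin 2)
    {τ : Type*} [MeasurableSpace τ] {t : (𝓤 × 𝓧) × 𝓦 × 𝓓 × 𝓜 × ℝ → τ} (ht : Measurable t)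
    {v : τ → 𝓤 × 𝓧} (hv : Measurable v) (hvt : ∀ c, v (t c) = c.1) :
    ∃ η : Kernel τ 𝓩, IsMarkovKernel η ∧
      HasCondDistrib S.Z (fun ω => (t ((S.U ω, S.X ω), (S.W ω, S.D ω, S.M ω, S.Y ω)),
        (S.W ω, S.D ω, S.M ω, S.Y ω))) (η.prodMkRight _) (S.given P a) := by
  let K := (condDistrib id (fun ω => (S.A ω, S.U ω, S.X ω)) P).map S.Z
  have : IsMarkovKernel K := Kernel.IsMarkovKernel.map _ S.measurable_Z
  have h : HasCondDistrib S.Z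
      (fun ω => ((S.A ω, S.U ω, S.X ω), (S.W ω, S.D ω, S.M ω, S.Y ω))) (K.prodMkRight _) P :=
    CondIndepFun.hasCondDistrib S.measurable_AUX S.measurable_Z S.measurable_WDMY
      hproxy.treatment_proxy
  have hE : MeasurableSet {c : (Fin 2 × 𝓤 × 𝓧) × (𝓦 × 𝓓 × 𝓜 × ℝ) | c.1.1 = a} :=
    (measurable_fst.comp measurable_fst) (measurableSet_singleton a)
  have hm := S.measurable_AUX.prodMk S.measurable_WDMY
  have h1 : HasCondDistrib S.Z (fun ω => ((S.A ω, S.U ω, S.X ω), (S.W ω, S.D ω, S.M ω, S.Y ω)))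
      (K.prodMkRight _) (S.given P a) := HasCondDistrib.cond h hm S.measurable_Z hE rfl
  refine ⟨K.comap (fun c => (a, v c)) (by fun_prop), inferInstance, ?_⟩
  have h2 := h1.reparam hm S.measurable_Z
    (f := fun c : (Fin 2 × 𝓤 × 𝓧) × (𝓦 × 𝓓 × 𝓜 × ℝ) => (t (c.1.2, c.2), c.2)) (by fun_prop)
    (e := fun c => ((a, v c.1), c.2)) (by fun_prop) (by
      filter_upwards [S.ae_given P a] with ω hω
      simp [hvt, hω])
  exact h2

end Proxies

section Residuals

variable [IsProbabilityMeasure P] [StandardBorelSpace 𝓜] [StandardBorelSpace 𝓓]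
    [StandardBorelSpace 𝓦]

/-- Residuals with mean zero given a complete instrument have mean zero given the confounders. -/
lemma ProxyVariables.condExp_eq_zero (hproxy : S.ProxyVariables P) {a : Fin 2}
    (ha : P (S.A ⁻¹' {a}) ≠ 0)
    {τ : Type*} [MeasurableSpace τ] {t : (𝓤 × 𝓧) × 𝓦 × 𝓓 × 𝓜 × ℝ → τ} (ht : Measurable t)
    {v : τ → 𝓤 × 𝓧} (hv : Measurable v) (hvt : ∀ c, v (t c) = c.1)
    {δ : Type*} [MeasurableSpace δ] {r : τ × 𝓩 → δ} (hr : Measurable r)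
    {f : τ × (𝓦 × 𝓓 × 𝓜 × ℝ) → ℝ} (hf : Measurable f) {T : Ω → τ} {R : Ω → δ} {g : Ω → ℝ}
    (hTeq : T = fun ω => t ((S.U ω, S.X ω), (S.W ω, S.D ω, S.M ω, S.Y ω)))
    (hReq : R = fun ω => r (T ω, S.Z ω))
    (hgeq : g = fun ω => f (T ω, (S.W ω, S.D ω, S.M ω, S.Y ω)))
    (hg2 : MemLp g 2 (S.given P a))
    (h0 : condExp (sigmaOf R) (S.given P a) g =ᵐ[S.given P a] 0)
    (hcompl : ∀ g : τ → ℝ, Measurable g → MemLp (fun ω => g (T ω)) 2 (S.given P a) →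
      condExp (sigmaOf R) (S.given P a) (fun ω => g (T ω)) =ᵐ[S.given P a] 0 →
      (fun ω => g (T ω)) =ᵐ[S.given P a] 0) :
    condExp (sigmaOf T) (S.given P a) g =ᵐ[S.given P a] 0 := by
  have : Nonempty Ω := P.nonempty_of_neZero
  have : Nonempty (𝓦 × 𝓓 × 𝓜 × ℝ) := ‹Nonempty Ω›.map fun ω => (S.W ω, S.D ω, S.M ω, S.Y ω)
  have := S.isProbabilityMeasure_given P ha
  obtain ⟨η, hη, hZ⟩ := hproxy.exists_hasCondDistrib_Z a ht hv hvt
  subst hgeq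
  have hZ : HasCondDistrib S.Z (fun ω => (T ω, (S.W ω, S.D ω, S.M ω, S.Y ω))) (η.prodMkRight _)
      (S.given P a) := by
    rw [hTeq]; exact hZ
  have hT : Measurable T := by
    rw [hTeq]; exact ht.comp (S.measurable_UX.prodMk S.measurable_WDMY)
  refine condExp_eq_zero_of_complete hT S.measurable_WDMY S.measurable_Z hZ ?_ hf hg2 h0 hcompl
  rw [hReq]
  exact sigmaOf_comp_le hr

variable {ζ : Nuisance 𝓜 𝓓 𝓩 𝓦 𝓧} {η : ℝ}

/-- Completeness exchanges `Z` for `U` in the conditioning. The theorems `condExp_residual_witness`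
and `condExp_residual_covariate` do the same for the next two bridge equations, in the strata `A =
0` and `A = 1`. -/
theorem condExp_residual_mediator (hpos : S.Positivity P) (hproxy : S.ProxyVariables P)
    (hcompl : S.CompletenessZ P) (hh : S.IsOutcomeBridge P ζ)
    (hmom : S.FiniteSecondMoments P ζ η) :
    condExp (sigmaOf fun ω => (((S.U ω, S.X ω), S.D ω), S.M ω)) (S.given P 1)
      (fun ω => S.Y ω - ζ.evalH₂ (S.obs ω)) =ᵐ[S.given P 1] 0 := by
  have := hh.measurable_h₂
  refine hproxy.condExp_eq_zero (hpos.event_ne_zero 1)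
    (t := fun c : (𝓤 × 𝓧) × 𝓦 × 𝓓 × 𝓜 × ℝ => ((c.1, c.2.2.1), c.2.2.2.1)) (by fun_prop)
    (v := fun t => t.1.1) (by fun_prop) (fun _ => rfl)
    (r := fun p => (p.2, p.1.2, p.1.1.2, p.1.1.1.2)) (by fun_prop)
    (f := fun p => p.2.2.2.2 - ζ.h₂ (p.2.1, p.1.2, p.1.1.2, p.1.1.1.2)) (by fun_prop)
    rfl rfl rfl hmom.h₂.1 ?_ fun g hg hg2 hg0 => ?_
  · refine condExp_sub_eq_zero hh.integrable_Y
      (S.integrable_given hh.integrable_h₂) ?_ hh.eq_h₂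
    -- The bridge equation and the completeness condition list the same variables in different
    -- orders, so their σ-algebras agree.
    exact le_antisymm
      (sigmaOf_comp_le (f := fun ω => (S.Z ω, S.M ω, S.D ω, S.X ω))
        (g := fun p => (p.2.1, p.2.2.1, p.1, p.2.2.2)) (by fun_prop))
      (sigmaOf_comp_le (f := fun ω => (S.M ω, S.D ω, S.Z ω, S.X ω))
        (g := fun p => (p.2.2.1, p.1, p.2.1, p.2.2.2)) (by fun_prop))
  · exact hcompl.mediator (fun p => g (((p.1, p.2.2.2), p.2.2.1), p.2.1)) (by fun_prop) hg2 hg0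

theorem condExp_residual_witness (hpos : S.Positivity P) (hproxy : S.ProxyVariables P)
    (hcompl : S.CompletenessZ P) (hh : S.IsOutcomeBridge P ζ)
    (hmom : S.FiniteSecondMoments P ζ η) :
    condExp (sigmaOf fun ω => ((S.U ω, S.X ω), S.D ω)) (S.given P 0)
      (fun ω => ζ.evalH₂ (S.obs ω) - ζ.evalH₁ (S.obs ω)) =ᵐ[S.given P 0] 0 := by
  have := hh.measurable_h₂
  have := hh.measurable_h₁
  refine hproxy.condExp_eq_zero (hpos.event_ne_zero 0)
    (t := fun c : (𝓤 × 𝓧) × 𝓦 × 𝓓 × 𝓜 × ℝ => (c.1, c.2.2.1)) (by fun_prop)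
    (v := fun t => t.1) (by fun_prop) (fun _ => rfl)
    (r := fun p => (p.2, p.1.2, p.1.1.2)) (by fun_prop)
    (f := fun p => ζ.h₂ (p.2.1, p.2.2.2.1, p.1.2, p.1.1.2) - ζ.h₁ (p.2.1, p.1.2, p.1.1.2))
    (by fun_prop)
    rfl rfl rfl hmom.h₁.1 ?_ fun g hg hg2 hg0 => ?_
  · refine condExp_sub_eq_zero (S.integrable_given hh.integrable_h₂)
      (S.integrable_given hh.integrable_h₁) ?_ hh.eq_h₁
    exact le_antisymm
      (sigmaOf_comp_le (f := fun ω => (S.Z ω, S.D ω, S.X ω))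
        (g := fun p => (p.2.1, p.1, p.2.2)) (by fun_prop))
      (sigmaOf_comp_le (f := fun ω => (S.D ω, S.Z ω, S.X ω))
        (g := fun p => (p.2.1, p.1, p.2.2)) (by fun_prop))
  · exact hcompl.witness (fun p => g ((p.1, p.2.2), p.2.1)) (by fun_prop) hg2 hg0

theorem condExp_residual_covariate (hpos : S.Positivity P) (hproxy : S.ProxyVariables P)
    (hcompl : S.CompletenessZ P) (hh : S.IsOutcomeBridge P ζ)
    (hmom : S.FiniteSecondMoments P ζ η) :
    condExp (sigmaOf fun ω => (S.U ω, S.X ω)) (S.given P 1)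
      (fun ω => ζ.evalH₁ (S.obs ω) - ζ.evalH₀ (S.obs ω)) =ᵐ[S.given P 1] 0 := by
  have := hh.measurable_h₁
  have := hh.measurable_h₀
  refine hproxy.condExp_eq_zero (hpos.event_ne_zero 1)
    (t := fun c : (𝓤 × 𝓧) × 𝓦 × 𝓓 × 𝓜 × ℝ => c.1) (by fun_prop)
    (v := fun t => t) (by fun_prop) (fun _ => rfl)
    (r := fun p => (p.2, p.1.2)) (by fun_prop)
    (f := fun p => ζ.h₁ (p.2.1, p.2.2.1, p.1.2) - ζ.h₀ (p.2.1, p.1.2))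
    (by fun_prop)
    rfl rfl rfl hmom.h₀.1 ?_ fun g hg hg2 hg0 => ?_
  · exact condExp_sub_eq_zero (S.integrable_given hh.integrable_h₁)
      (S.integrable_given hh.integrable_h₀) rfl hh.eq_h₀
  · exact hcompl.covariate g hg hg2 hg0

end Residuals

end PathModel

/-! ### Conditional laws of the potential outcomes. -/

namespace ProbabilityTheory

lemma Kernel.mapParam_apply {α β γ : Type*} [MeasurableSpace α] [MeasurableSpace β]
    [MeasurableSpace γ] (κ : Kernel α β) [IsSFiniteKernel κ] {g : α × β → γ} (hg : Measurable g)
    (x : α) : κ.mapParam g x = (κ x).map fun y => g (x, y) := by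
  refine Measure.ext_of_lintegral _ fun φ hφ => ?_
  rw [Kernel.lintegral_mapParam κ hg hφ, MeasureTheory.lintegral_map hφ (by fun_prop)]

lemma Kernel.comap_mapParam {α α' β γ : Type*} [MeasurableSpace α] [MeasurableSpace α']
    [MeasurableSpace β] [MeasurableSpace γ] (κ : Kernel α β) [IsSFiniteKernel κ] {g : α × β → γ}
    (hg : Measurable g) {f : α' → α} (hf : Measurable f) :
    (κ.mapParam g).comap f hf = (κ.comap f hf).mapParam fun p => g (f p.1, p.2) := by
  ext x : 1
  rw [Kernel.comap_apply, Kernel.mapParam_apply _ hg, Kernel.mapParam_apply _ (by fun_prop),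
    Kernel.comap_apply]

end ProbabilityTheory

namespace PathModel

variable {Ω 𝓤 𝓜 𝓓 𝓩 𝓦 𝓧 : Type*} [mΩ : MeasurableSpace Ω]
    [MeasurableSpace 𝓤] [MeasurableSpace 𝓜] [MeasurableSpace 𝓓] [MeasurableSpace 𝓩]
    [MeasurableSpace 𝓦] [MeasurableSpace 𝓧]
    (S : PathModel Ω 𝓤 𝓜 𝓓 𝓩 𝓦 𝓧) (P : Measure Ω)

lemma measurable_Yam (a : Fin 2) : Measurable fun q : Ω × 𝓜 => S.Yam a q.2 q.1 :=
  (S.measurable_Ypot a).comp (f := fun q : Ω × 𝓜 => (q.1, S.Dpot a q.1, q.2))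
    (measurable_fst.prodMk (((S.measurable_Dpot a).comp measurable_fst).prodMk measurable_snd))

lemma measurable_Ym : Measurable fun q : Ω × 𝓜 => S.Ym q.2 q.1 := by
  have h : (fun q : Ω × 𝓜 => S.Ym q.2 q.1)
      = fun q : Ω × 𝓜 => if S.A q.1 = 1 then S.Yam 1 q.2 q.1 else S.Yam 0 q.2 q.1 := by
    ext q
    unfold Ym
    split_ifs with h
    · rw [h]
    · rw [show S.A q.1 = 0 by omega]
  rw [h]
  exact Measurable.ite ((S.measurable_A.comp measurable_fst) (measurableSet_singleton 1))
    (S.measurable_Yam 1) (S.measurable_Yam 0)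

lemma measurable_evalM : Measurable fun x : ((𝓤 × 𝓧) × 𝓓) × Ω => S.Mpot 0 x.1.2 x.2 :=
  (S.measurable_Mpot 0).comp (f := fun x : ((𝓤 × 𝓧) × 𝓓) × Ω => (x.2, x.1.2)) (by fun_prop)

lemma measurable_evalY :
    Measurable fun x : (((𝓤 × 𝓧) × 𝓓) × 𝓜) × Ω => S.Ym x.1.2 x.2 :=
  S.measurable_Ym.comp (f := fun x : (((𝓤 × 𝓧) × 𝓓) × 𝓜) × Ω => (x.2, x.1.2)) (by fun_prop)

variable {S P} in
lemma Consistency.Dpot_eq (hcons : S.Consistency P) (a : Fin 2) :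
    S.Dpot a =ᵐ[S.given P a] S.D := by
  filter_upwards [(S.given_absolutelyContinuous P a).ae_le hcons.witness, S.ae_given P a]
    with ω h1 h2 using h1 a h2

variable [IsProbabilityMeasure P] [StandardBorelSpace Ω] [Nonempty Ω]

/-- The conditional law of `D(1)` given `(U, X)`. -/
noncomputable def lawD : Kernel (𝓤 × 𝓧) 𝓓 :=
  (condDistrib id (fun ω => (S.U ω, S.X ω)) P).map (S.Dpot 1)

/-- The conditional law of `M(0, d)` given `(U, X)`. -/
noncomputable def lawM : Kernel ((𝓤 × 𝓧) × 𝓓) 𝓜 :=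
  ((condDistrib id (fun ω => (S.U ω, S.X ω)) P).prodMkRight 𝓓).mapParam
    fun x => S.Mpot 0 x.1.2 x.2

/-- The conditional law of `Y(m)` given `D = d, A = 1, U, X`. -/
noncomputable def lawY : Kernel (((𝓤 × 𝓧) × 𝓓) × 𝓜) ℝ :=
  ((condDistrib id (fun ω => (S.D ω, S.A ω, S.U ω, S.X ω)) P).comap
    (fun t : ((𝓤 × 𝓧) × 𝓓) × 𝓜 => (t.1.2, (1 : Fin 2), t.1.1)) (by fun_prop)).mapParam
    fun x => S.Ym x.1.2 x.2

instance : IsMarkovKernel (S.lawD P) := Kernel.IsMarkovKernel.map _ (S.measurable_Dpot 1)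

instance : IsMarkovKernel (S.lawM P) := Kernel.isMarkovKernel_mapParam _ S.measurable_evalM

instance : IsMarkovKernel (S.lawY P) := Kernel.isMarkovKernel_mapParam _ S.measurable_evalY

variable {S P}

lemma hasCondDistrib_Dpot : HasCondDistrib (S.Dpot 1) (fun ω => (S.U ω, S.X ω)) (S.lawD P) P :=
  (hasCondDistrib_condDistrib S.measurable_UX measurable_id).comp_left (S.measurable_Dpot 1)

/-- By exchangeability, the conditional law under `P` persists in the stratum `A = 1`. A
deterministic `m` suffices; the random mediator is dealt with in `map_nested`. -/
lemma LatentExchangeability.hasCondDistrib_potential (hexch : S.LatentExchangeability P) (m : 𝓜) :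
    HasCondDistrib (fun ω => (S.Dpot 1 ω, S.Yam 1 m ω)) (fun ω => (S.U ω, S.X ω))
      ((condDistrib id (fun ω => (S.U ω, S.X ω)) P).map fun ω => (S.Dpot 1 ω, S.Yam 1 m ω))
      (S.given P 1) := by
  have hY : Measurable (S.Yam 1 m) := measurable_section (S.measurable_Yam 1) m
  have hF := (S.measurable_Dpot 1).prodMk hY
  have h0 := CondIndepFun.comp ((hexch.treatment 1).1 m ()) measurable_swap measurable_id
  have h1 := CondIndepFun.hasCondDistrib S.measurable_UX hF S.measurable_A h0
  have hE : MeasurableSet {c : (𝓤 × 𝓧) × Fin 2 | c.2 = 1} :=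
    measurable_snd (measurableSet_singleton 1)
  have h2 : HasCondDistrib _ _ _ (S.given P 1) :=
    HasCondDistrib.cond h1 (S.measurable_UX.prodMk S.measurable_A) hF hE rfl
  have : IsMarkovKernel ((condDistrib id (fun ω => (S.U ω, S.X ω)) P).map
    fun ω => (S.Dpot 1 ω, S.Yam 1 m ω)) := Kernel.IsMarkovKernel.map _ hF
  exact HasCondDistrib.coarsen (T := fun ω => ((S.U ω, S.X ω), S.A ω)) (f := Prod.fst)
    (hf := measurable_fst) h2

/-- Exchangeability concerns the pair `(Y(1, m), D(1))`, so some `m` must exist in order to extract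
`D(1)`; consistency then replaces `D(1)` by `D`. -/
lemma hasCondDistrib_D [Nonempty 𝓜] (hcons : S.Consistency P) (hexch : S.LatentExchangeability P) :
    HasCondDistrib S.D (fun ω => (S.U ω, S.X ω)) (S.lawD P) (S.given P 1) := by
  obtain ⟨m⟩ := ‹Nonempty 𝓜›
  have hY : Measurable (S.Yam 1 m) := measurable_section (S.measurable_Yam 1) m
  have hF := (S.measurable_Dpot 1).prodMk hY
  have : IsMarkovKernel ((condDistrib id (fun ω => (S.U ω, S.X ω)) P).map
    fun ω => (S.Dpot 1 ω, S.Yam 1 m ω)) := Kernel.IsMarkovKernel.map _ hF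
  have h := (hexch.hasCondDistrib_potential m).comp_left measurable_fst
  rw [← Kernel.map_comp_right _ hF measurable_fst] at h
  exact HasCondDistrib.congr_left h (hcons.Dpot_eq 1)

/-- In this stratum `M` is the random function `M(0, ·)` at the random index `D`, from which it is
conditionally independent, jointly in the index. -/
lemma hasCondDistrib_M [MeasurableSingletonClass 𝓓] (hcons : S.Consistency P)
    (hexch : S.LatentExchangeability P) :
    HasCondDistrib S.M (fun ω => ((S.U ω, S.X ω), S.D ω)) (S.lawM P) (S.given P 0) := by
  have : Nonempty 𝓓 := ‹Nonempty Ω›.map S.D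
  have hDA := S.measurable_D.prodMk S.measurable_A
  have h := CondIndepFamilies.hasCondDistrib_eval S.measurable_UX (hexch.mediator 0)
    (S.measurable_Mpot 0) hDA measurable_fst
  have hMm : Measurable fun ω => S.Mpot 0 (S.D ω) ω :=
    (S.measurable_Mpot 0).comp (measurable_id.prodMk S.measurable_D)
  have hE : MeasurableSet {c : (𝓤 × 𝓧) × 𝓓 × Fin 2 | c.2.2 = 0} :=
    (measurable_snd.comp measurable_snd) (measurableSet_singleton 0)
  have h2 : HasCondDistrib _ _ _ (S.given P 0) :=
    HasCondDistrib.cond h (S.measurable_UX.prodMk hDA) hMm hE rfl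
  have h3 : HasCondDistrib (fun ω => S.Mpot 0 (S.D ω) ω) (fun ω => ((S.U ω, S.X ω), S.D ω))
      (S.lawM P) (S.given P 0) := by
    refine HasCondDistrib.coarsen (T := fun ω => ((S.U ω, S.X ω), (S.D ω, S.A ω)))
      (f := fun c : (𝓤 × 𝓧) × 𝓓 × Fin 2 => (c.1, c.2.1)) (hf := by fun_prop) ?_
    rw [lawM, Kernel.comap_mapParam _ S.measurable_evalM]
    exact h2
  refine HasCondDistrib.congr_left h3 ?_
  filter_upwards [(S.given_absolutelyContinuous P 0).ae_le hcons.mediator, S.ae_given P 0]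
    with ω h1 h2 using h1 0 _ h2 rfl

/-- The random function is now `m ↦ Y(m)`, evaluated at `M`, with `(D, A, U, X)` as conditioning
variables; `A = 1` is inserted into the kernel afterwards. -/
lemma hasCondDistrib_Y [MeasurableSingletonClass 𝓜] (hcons : S.Consistency P)
    (hexch : S.LatentExchangeability P) :
    HasCondDistrib S.Y (fun ω => (((S.U ω, S.X ω), S.D ω), S.M ω)) (S.lawY P) (S.given P 1) := by
  have : Nonempty 𝓜 := ‹Nonempty Ω›.map S.M
  have h := CondIndepFamilies.hasCondDistrib_eval S.measurable_DAUX hexch.outcome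
    S.measurable_Ym S.measurable_M measurable_id
  have hYm : Measurable fun ω => S.Ym (S.M ω) ω :=
    S.measurable_Ym.comp (measurable_id.prodMk S.measurable_M)
  have hE : MeasurableSet {c : (𝓓 × Fin 2 × 𝓤 × 𝓧) × 𝓜 | c.1.2.1 = 1} :=
    (by fun_prop : Measurable fun c : (𝓓 × Fin 2 × 𝓤 × 𝓧) × 𝓜 => c.1.2.1)
      (measurableSet_singleton 1)
  have hm := S.measurable_DAUX.prodMk S.measurable_M
  have h2 : HasCondDistrib _ _ _ (S.given P 1) := HasCondDistrib.cond h hm hYm hE rfl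
  have hg : Measurable fun x : ((𝓓 × Fin 2 × 𝓤 × 𝓧) × 𝓜) × Ω => S.Ym x.1.2 x.2 :=
    S.measurable_Ym.comp (f := fun x : ((𝓓 × Fin 2 × 𝓤 × 𝓧) × 𝓜) × Ω => (x.2, x.1.2))
      (by fun_prop)
  have h3 := h2.reparam hm hYm
    (f := fun c : (𝓓 × Fin 2 × 𝓤 × 𝓧) × 𝓜 => ((c.1.2.2, c.1.1), c.2)) (by fun_prop)
    (e := fun t => ((t.1.2, (1 : Fin 2), t.1.1), t.2)) (by fun_prop) (by
      filter_upwards [S.ae_given P 1] with ω hω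
      rw [← hω])
  simp only [id] at h3
  rw [Kernel.comap_mapParam _ hg] at h3
  refine HasCondDistrib.congr_left (κ := S.lawY P) h3 ?_
  filter_upwards [(S.given_absolutelyContinuous P 1).ae_le hcons.outcome, S.ae_given P 1,
    hcons.Dpot_eq 1] with ω h1 h2 h3
  rw [Ym, Yam, h2, h3]
  exact h1 1 _ _ h2 rfl rfl

/-- For fixed `m`, the joint law of `(U, X)`, `D(1)` and `Y(1, m)`. -/
lemma lintegral_potential [StandardBorelSpace 𝓓] (hcons : S.Consistency P)
    (hpos : S.Positivity P) (hexch : S.LatentExchangeability P) (m : 𝓜)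
    {φ : (𝓤 × 𝓧) × 𝓓 × ℝ → ℝ≥0∞} (hφ : Measurable φ) :
    ∫⁻ ω, φ ((S.U ω, S.X ω), S.Dpot 1 ω, S.Yam 1 m ω) ∂P
      = ∫⁻ ω, ∫⁻ d, ∫⁻ y, φ ((S.U ω, S.X ω), d, y) ∂S.lawY P (((S.U ω, S.X ω), d), m)
        ∂S.lawD P (S.U ω, S.X ω) ∂P := by
  have hY : Measurable (S.Yam 1 m) := measurable_section (S.measurable_Yam 1) m
  have hF := (S.measurable_Dpot 1).prodMk hY
  have hYm : Measurable (S.Ym m) := measurable_section S.measurable_Ym m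
  have : Nonempty 𝓜 := ⟨m⟩
  let N : Kernel ((𝓤 × 𝓧) × 𝓓) ℝ := (S.lawY P).comap (fun t => (t, m)) (by fun_prop)
  let κ := (condDistrib id (fun ω => (S.U ω, S.X ω)) P).map fun ω => (S.Dpot 1 ω, S.Yam 1 m ω)
  have : IsMarkovKernel κ := Kernel.IsMarkovKernel.map _ hF
  have hN : HasCondDistrib (S.Ym m) (fun ω => ((S.U ω, S.X ω), S.D ω)) N (S.given P 1) := by
    have h := (hasCondDistrib_condDistrib (P := P) S.measurable_DAUX measurable_id).comp_left hYm
    have hE : MeasurableSet {c : 𝓓 × Fin 2 × 𝓤 × 𝓧 | c.2.1 = 1} :=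
      (by fun_prop : Measurable fun c : 𝓓 × Fin 2 × 𝓤 × 𝓧 => c.2.1) (measurableSet_singleton 1)
    have h2 : HasCondDistrib (S.Ym m) _ _ (S.given P 1) :=
      HasCondDistrib.cond h S.measurable_DAUX hYm hE rfl
    have h3 := h2.reparam S.measurable_DAUX hYm
      (f := fun c : 𝓓 × Fin 2 × 𝓤 × 𝓧 => (c.2.2, c.1)) (by fun_prop)
      (e := fun t => (t.2, (1 : Fin 2), t.1)) (by fun_prop) (by
        filter_upwards [S.ae_given P 1] with ω hω
        rw [← hω])
    convert h3 using 1
    ext x : 1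
    simp only [N, lawY, Kernel.comap_apply]
    rw [Kernel.mapParam_apply _ S.measurable_evalY, Kernel.comap_apply, Kernel.map_apply _ hYm]
  have h1 : HasCondDistrib (fun ω => (S.D ω, S.Ym m ω)) (fun ω => (S.U ω, S.X ω))
      (S.lawD P ⊗ₖ N) (S.given P 1) :=
    HasCondDistrib.compProd S.measurable_UX S.measurable_D hYm (hasCondDistrib_D hcons hexch) hN
  have h2 : HasCondDistrib (fun ω => (S.D ω, S.Ym m ω)) (fun ω => (S.U ω, S.X ω)) κ
      (S.given P 1) := by
    refine HasCondDistrib.congr_left (hexch.hasCondDistrib_potential m) ?_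
    filter_upwards [hcons.Dpot_eq 1, S.ae_given P 1] with ω h1 h2
    rw [h1, Ym, h2]
  -- The conditional law of `(D, Y(m))` in the stratum `A = 1` has two descriptions: `κ`, by
  -- exchangeability, and the chain of `lawD` and `lawY`. Disintegrations are unique, and positivity
  -- moves the identity from the stratum to `P`.
  have hae : κ =ᵐ[(S.given P 1).map fun ω => (S.U ω, S.X ω)] S.lawD P ⊗ₖ N := by
    have : Nonempty 𝓓 := ‹Nonempty Ω›.map S.D
    exact Kernel.ae_eq_of_compProd_eq (h2.map_eq.symm.trans h1.map_eq)
  have hae' := ae_of_ae_map S.measurable_UX.aemeasurable ((hpos.map_UX 1).ae_le hae)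
  have h3 : HasCondDistrib (fun ω => (S.Dpot 1 ω, S.Yam 1 m ω)) (fun ω => (S.U ω, S.X ω)) κ P :=
    (hasCondDistrib_condDistrib (P := P) S.measurable_UX measurable_id).comp_left hF
  rw [h3.lintegral_eq S.measurable_UX hF hφ]
  refine lintegral_congr_ae ?_
  filter_upwards [hae'] with ω hω
  rw [hω, Kernel.lintegral_compProd _ _ _ (by fun_prop)]
  rfl

end PathModel

/-! ### The law of the nested counterfactual. -/

namespace PathModel

variable {Ω 𝓤 𝓜 𝓓 𝓩 𝓦 𝓧 : Type*} [mΩ : MeasurableSpace Ω]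
    [MeasurableSpace 𝓤] [MeasurableSpace 𝓜] [MeasurableSpace 𝓓] [MeasurableSpace 𝓩]
    [MeasurableSpace 𝓦] [MeasurableSpace 𝓧]
    {S : PathModel Ω 𝓤 𝓜 𝓓 𝓩 𝓦 𝓧} {P : Measure Ω}

variable (S) in
lemma measurable_Mnested : Measurable fun ω => S.Mpot 0 (S.Dpot 1 ω) ω :=
  (S.measurable_Mpot 0).comp (measurable_id.prodMk (S.measurable_Dpot 1))

variable (S) in
lemma measurable_Ynested : Measurable S.Ynested :=
  (S.measurable_Yam 1).comp (measurable_id.prodMk S.measurable_Mnested)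

variable [StandardBorelSpace Ω] [IsProbabilityMeasure P] [Nonempty Ω]

section AbsolutelyContinuous

variable [Nonempty 𝓜]

/-- `D(1)` follows the stratum `A = 1`, while the equation between `h₂` and `h₁` holds almost
everywhere in the stratum `A = 0`; this lemma connects the two. -/
lemma compProd_lawD_absolutelyContinuous (hcons : S.Consistency P) (hpos : S.Positivity P)
    (hexch : S.LatentExchangeability P) :
    P.map (fun ω => (S.U ω, S.X ω)) ⊗ₘ S.lawD P
      ≪ (S.given P 0).map fun ω => ((S.U ω, S.X ω), S.D ω) := by
  refine ((hpos.map_UX 1).compProd_left _).trans ?_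
  rw [← (hasCondDistrib_D hcons hexch).map_eq]
  exact hpos.map_UXD 1 0

lemma compProd_lawM_absolutelyContinuous [StandardBorelSpace 𝓓] (hcons : S.Consistency P) (hpos : S.Positivity P)
    (hexch : S.LatentExchangeability P) :
    (P.map (fun ω => (S.U ω, S.X ω)) ⊗ₘ S.lawD P) ⊗ₘ S.lawM P
      ≪ (S.given P 1).map fun ω => (((S.U ω, S.X ω), S.D ω), S.M ω) := by
  refine ((compProd_lawD_absolutelyContinuous hcons hpos hexch).compProd_left _).trans ?_
  rw [← (hasCondDistrib_M hcons hexch).map_eq]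
  exact hpos.map_UXDM 0 1

end AbsolutelyContinuous

/-- The law of the nested counterfactuals, in terms of conditional laws within the strata of the
treatment. -/
theorem map_nested [StandardBorelSpace 𝓜] [StandardBorelSpace 𝓓] (hcons : S.Consistency P)
    (hpos : S.Positivity P) (hexch : S.LatentExchangeability P) (hcross : S.CrossWorld P) :
    P.map (fun ω => ((((S.U ω, S.X ω), S.Dpot 1 ω), S.Mpot 0 (S.Dpot 1 ω) ω), S.Ynested ω))
      = ((P.map (fun ω => (S.U ω, S.X ω)) ⊗ₘ S.lawD P) ⊗ₘ S.lawM P) ⊗ₘ S.lawY P := by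
  have : Nonempty 𝓜 := ‹Nonempty Ω›.map S.M
  have hVD : Measurable fun ω => ((S.U ω, S.X ω), S.Dpot 1 ω) :=
    S.measurable_UX.prodMk (S.measurable_Dpot 1)
  have hmap : P.map (fun ω => ((S.U ω, S.X ω), S.Dpot 1 ω))
      = P.map (fun ω => (S.U ω, S.X ω)) ⊗ₘ S.lawD P := hasCondDistrib_Dpot.map_eq
  obtain ⟨ν, hν, hac⟩ := hpos.exists_dominating_mediator
  -- An equivalent finite measure, so that the constant kernel `η` is finite and Radon–Nikodym
  -- derivatives of kernels are available.
  let ν' := ν.toFinite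
  have hR : ∀ᵐ x ∂P.map fun ω => ((S.U ω, S.X ω), S.Dpot 1 ω), S.lawM P x ≪ ν' := by
    have h1 := (hac 0).1.trans ((Measure.AbsolutelyContinuous.rfl).prod
      (absolutelyContinuous_toFinite ν))
    rw [(hasCondDistrib_M hcons hexch).map_eq, ← Measure.compProd_const] at h1
    have h2 := h1.kernel_of_compProd
    rw [hmap]
    filter_upwards [(compProd_lawD_absolutelyContinuous hcons hpos hexch).ae_le h2] with x hx
    simpa using hx
  let η : Kernel ((𝓤 × 𝓧) × 𝓓) 𝓜 := Kernel.const _ ν'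
  let ρ : ((𝓤 × 𝓧) × 𝓓) × 𝓜 → ℝ≥0∞ := fun t => Kernel.rnDeriv (S.lawM P) η t.1 t.2
  have hρ : Measurable ρ := Kernel.measurable_rnDeriv _ _
  have hdens : ∀ x, S.lawM P x ≪ ν' → ∀ g : 𝓜 → ℝ≥0∞, Measurable g →
      ∫⁻ m, g m ∂S.lawM P x = ∫⁻ m, ρ (x, m) * g m ∂ν' := by
    intro x hx g hg
    have h1 : Kernel.withDensity η (Kernel.rnDeriv (S.lawM P) η) x = S.lawM P x :=
      Kernel.withDensity_rnDeriv_eq hx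
    rw [← h1, Kernel.withDensity_apply _ hρ,
      lintegral_withDensity_eq_lintegral_mul _ (by exact hρ.comp (by fun_prop :
        Measurable fun m : 𝓜 => (x, m))) hg]
    rfl
  refine Measure.ext_of_lintegral _ fun φ hφ => ?_
  have hφ1 : Measurable fun q : ((𝓤 × 𝓧) × 𝓓) × Ω × 𝓜 => φ ((q.1, q.2.2), S.Yam 1 q.2.2 q.2.1) :=
    hφ.comp (Measurable.prodMk (by fun_prop) ((S.measurable_Yam 1).comp measurable_snd))
  have hφy : Measurable fun t : ((𝓤 × 𝓧) × 𝓓) × 𝓜 => ∫⁻ y, φ (t, y) ∂S.lawY P t :=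
    hφ.lintegral_kernel_prod_right'
  -- By cross-world independence the nested mediator can be replaced by a fresh draw from `lawM` at
  -- `D(1)`.
  have step1 : ∫⁻ ω, φ ((((S.U ω, S.X ω), S.Dpot 1 ω), S.Mpot 0 (S.Dpot 1 ω) ω), S.Ynested ω) ∂P
      = ∫⁻ ω, ∫⁻ m, φ ((((S.U ω, S.X ω), S.Dpot 1 ω), m), S.Yam 1 m ω)
        ∂S.lawM P ((S.U ω, S.X ω), S.Dpot 1 ω) ∂P := by
    have h1 := CondIndepFamilies.lintegral_decouple S.measurable_UX (hcross 1 0)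
      ((S.measurable_Yam 1).prodMk ((S.measurable_Dpot 1).comp measurable_fst))
      (S.measurable_Mpot 0) (π := Prod.snd) measurable_snd (p := S.Dpot 1) (fun _ _ => rfl)
      (ρ := id) measurable_id (φ := fun c => φ (((c.1, c.2.1.2), c.2.2), c.2.1.1)) (by fun_prop)
    have hm : Measurable fun q : (𝓤 × 𝓧) × Ω =>
        ∫⁻ m, φ (((q.1, S.Dpot 1 q.2), m), S.Yam 1 m q.2) ∂S.lawM P (q.1, S.Dpot 1 q.2) := by
      have hD : Measurable fun q : (𝓤 × 𝓧) × Ω => (q.1, S.Dpot 1 q.2) :=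
        measurable_fst.prodMk ((S.measurable_Dpot 1).comp measurable_snd)
      have : Measurable fun q : ((𝓤 × 𝓧) × Ω) × 𝓜 =>
          φ (((q.1.1, S.Dpot 1 q.1.2), q.2), S.Yam 1 q.2 q.1.2) :=
        hφ1.comp (f := fun q : ((𝓤 × 𝓧) × Ω) × 𝓜 => ((q.1.1, S.Dpot 1 q.1.2), (q.1.2, q.2)))
          ((hD.comp measurable_fst).prodMk (by fun_prop))
      exact this.lintegral_kernel_prod_right' (κ := (S.lawM P).comap _ hD)
    have h2 := lintegral_eq_condDistrib_id (P := P) S.measurable_UX hm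
    rw [h2]
    refine h1.trans (lintegral_congr fun ω => lintegral_congr fun ω₁ => ?_)
    dsimp only [id]
    rw [lawM, Kernel.lintegral_mapParam _ S.measurable_evalM (φ := fun m =>
      φ ((((S.U ω, S.X ω), S.Dpot 1 ω₁), m), S.Yam 1 m ω₁))
      (hφ1.comp (f := fun m => (((S.U ω, S.X ω), S.Dpot 1 ω₁), (ω₁, m))) (by fun_prop))]
    rfl
  -- The law of the draw depends on `ω` through `D(1)`. Written as a density against the fixed `ν'`,
  -- its integral can be pulled outside the expectation, and `lintegral_potential` applies at each
  -- deterministic `m`.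
  have step2 : ∀ᵐ ω ∂P, ∫⁻ m, φ ((((S.U ω, S.X ω), S.Dpot 1 ω), m), S.Yam 1 m ω)
        ∂S.lawM P ((S.U ω, S.X ω), S.Dpot 1 ω)
      = ∫⁻ m, ρ (((S.U ω, S.X ω), S.Dpot 1 ω), m)
        * φ ((((S.U ω, S.X ω), S.Dpot 1 ω), m), S.Yam 1 m ω) ∂ν' := by
    filter_upwards [ae_of_ae_map hVD.aemeasurable hR] with ω hω
    exact hdens _ hω _ (hφ1.comp (f := fun m => (((S.U ω, S.X ω), S.Dpot 1 ω), (ω, m)))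
      (by fun_prop))
  have step3 (m : 𝓜) : ∫⁻ ω, ρ (((S.U ω, S.X ω), S.Dpot 1 ω), m)
        * φ ((((S.U ω, S.X ω), S.Dpot 1 ω), m), S.Yam 1 m ω) ∂P
      = ∫⁻ ω, ∫⁻ d, ρ (((S.U ω, S.X ω), d), m)
          * ∫⁻ y, φ ((((S.U ω, S.X ω), d), m), y) ∂S.lawY P (((S.U ω, S.X ω), d), m)
        ∂S.lawD P (S.U ω, S.X ω) ∂P := by
    rw [lintegral_potential hcons hpos hexch m
      (φ := fun c => ρ ((c.1, c.2.1), m) * φ (((c.1, c.2.1), m), c.2.2)) (by fun_prop)]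
    refine lintegral_congr fun ω => lintegral_congr fun d => ?_
    exact lintegral_const_mul (ρ (((S.U ω, S.X ω), d), m))
      (f := fun y => φ ((((S.U ω, S.X ω), d), m), y)) (by fun_prop)
  rw [lintegral_map hφ (Measurable.prodMk (hVD.prodMk S.measurable_Mnested) S.measurable_Ynested),
    step1, lintegral_congr_ae step2, lintegral_lintegral_swap, Measure.lintegral_compProd hφ,
    Measure.lintegral_compProd hφy]
  · have hg : Measurable fun t : ((𝓤 × 𝓧) × 𝓓) × 𝓜 => ρ t * ∫⁻ y, φ (t, y) ∂S.lawY P t := hρ.mul hφy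
    simp_rw [step3]
    have e1 (m : 𝓜) : ∫⁻ ω, ∫⁻ d, ρ (((S.U ω, S.X ω), d), m)
          * ∫⁻ y, φ ((((S.U ω, S.X ω), d), m), y) ∂S.lawY P (((S.U ω, S.X ω), d), m)
        ∂S.lawD P (S.U ω, S.X ω) ∂P
        = ∫⁻ x, ρ (x, m) * ∫⁻ y, φ ((x, m), y) ∂S.lawY P (x, m)
          ∂(P.map (fun ω => (S.U ω, S.X ω)) ⊗ₘ S.lawD P) := by
      have hgm : Measurable fun x : (𝓤 × 𝓧) × 𝓓 =>
          ρ (x, m) * ∫⁻ y, φ ((x, m), y) ∂S.lawY P (x, m) :=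
        hg.comp (f := fun x => (x, m)) (by fun_prop)
      rw [Measure.lintegral_compProd hgm, lintegral_map hgm.lintegral_kernel_prod_right'
        S.measurable_UX]
    simp_rw [e1]
    rw [lintegral_lintegral_swap (f := fun m x => ρ (x, m) * ∫⁻ y, φ ((x, m), y) ∂S.lawY P (x, m))
      (hg.comp measurable_swap).aemeasurable]
    refine lintegral_congr_ae ?_
    rw [← hmap]
    filter_upwards [hR] with x hx
    exact (hdens x hx _ (hφy.comp (f := fun m => (x, m)) (by fun_prop))).symm
  · have h1 : Measurable fun q : Ω × 𝓜 => (((S.U q.1, S.X q.1), S.Dpot 1 q.1), q.2) :=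
      (hVD.comp measurable_fst).prodMk measurable_snd
    exact ((hρ.comp h1).mul (hφ.comp (h1.prodMk (S.measurable_Yam 1)))).aemeasurable

end PathModel

/-! ### Proximal identification of `ψ`. -/

namespace PathModel

variable {Ω 𝓤 𝓜 𝓓 𝓩 𝓦 𝓧 : Type*} [mΩ : MeasurableSpace Ω]
    [MeasurableSpace 𝓤] [MeasurableSpace 𝓜] [MeasurableSpace 𝓓] [MeasurableSpace 𝓩]
    [MeasurableSpace 𝓦] [MeasurableSpace 𝓧]
    {S : PathModel Ω 𝓤 𝓜 𝓓 𝓩 𝓦 𝓧} {P : Measure Ω} {ζ : Nuisance 𝓜 𝓓 𝓩 𝓦 𝓧} {η : ℝ}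

lemma condExp_eq_of_residual {Q : Measure Ω} {m : MeasurableSpace Ω} {f g : Ω → ℝ}
    (hf : Integrable f Q) (hg : Integrable g Q)
    (h : condExp m Q (fun ω => f ω - g ω) =ᵐ[Q] 0) : condExp m Q f =ᵐ[Q] condExp m Q g := by
  filter_upwards [h, condExp_sub hf hg m] with ω h1 h2
  have h3 : condExp m Q (f - g) ω = 0 := h1
  rw [h2] at h3
  exact sub_eq_zero.1 h3

variable [StandardBorelSpace Ω] [IsProbabilityMeasure P] [Nonempty Ω]

variable (S P ζ) in
/-- The latent outcome regression `E[h₂ ∣ M, D, X, U]`. -/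
noncomputable def meanH₂ (t : ((𝓤 × 𝓧) × 𝓓) × 𝓜) : ℝ :=
  ∫ w, ζ.h₂ (w, t.2, t.1.2, t.1.1.2) ∂S.lawW P t.1.1

variable (S P ζ) in
/-- The latent regression `E[h₁ ∣ D, X, U]`. -/
noncomputable def meanH₁ (t : (𝓤 × 𝓧) × 𝓓) : ℝ :=
  ∫ w, ζ.h₁ (w, t.2, t.1.2) ∂S.lawW P t.1

variable (S P ζ) in
/-- The latent regression `E[h₀ ∣ X, U]`. -/
noncomputable def meanH₀ (t : 𝓤 × 𝓧) : ℝ :=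
  ∫ w, ζ.h₀ (w, t.2) ∂S.lawW P t

lemma measurable_meanH₂ (hh : S.IsOutcomeBridge P ζ) : Measurable (S.meanH₂ P ζ) := by
  have := hh.measurable_h₂
  exact (StronglyMeasurable.integral_kernel_prod_right'
    (κ := (S.lawW P).comap (fun t : ((𝓤 × 𝓧) × 𝓓) × 𝓜 => t.1.1) (by fun_prop))
    (f := fun p => ζ.h₂ (p.2, p.1.2, p.1.1.2, p.1.1.1.2))
    (Measurable.stronglyMeasurable (by fun_prop))).measurable

lemma measurable_meanH₁ (hh : S.IsOutcomeBridge P ζ) : Measurable (S.meanH₁ P ζ) := by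
  have := hh.measurable_h₁
  exact (StronglyMeasurable.integral_kernel_prod_right'
    (κ := (S.lawW P).comap (fun t : (𝓤 × 𝓧) × 𝓓 => t.1) (by fun_prop))
    (f := fun p => ζ.h₁ (p.2, p.1.2, p.1.1.2))
    (Measurable.stronglyMeasurable (by fun_prop))).measurable

lemma measurable_meanH₀ (hh : S.IsOutcomeBridge P ζ) : Measurable (S.meanH₀ P ζ) := by
  have := hh.measurable_h₀
  exact (StronglyMeasurable.integral_kernel_prod_right' (κ := S.lawW P)
    (f := fun p => ζ.h₀ (p.2, p.1.2)) (Measurable.stronglyMeasurable (by fun_prop))).measurable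

lemma measurable_mean_lawY : Measurable fun t => ∫ y, y ∂S.lawY P t :=
  (StronglyMeasurable.integral_kernel_prod_right' (κ := S.lawY P) (f := Prod.snd)
    measurable_snd.stronglyMeasurable).measurable

lemma measurable_mean_lawM {f : ((𝓤 × 𝓧) × 𝓓) × 𝓜 → ℝ} (hf : Measurable f) :
    Measurable fun t => ∫ m, f (t, m) ∂S.lawM P t :=
  (StronglyMeasurable.integral_kernel_prod_right' (κ := S.lawM P) hf.stronglyMeasurable).measurable

lemma measurable_mean_lawD {f : (𝓤 × 𝓧) × 𝓓 → ℝ} (hf : Measurable f) :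
    Measurable fun t => ∫ m, f (t, m) ∂S.lawD P t :=
  (StronglyMeasurable.integral_kernel_prod_right' (κ := S.lawD P) hf.stronglyMeasurable).measurable

section Regressions

variable [StandardBorelSpace 𝓦]

/-- The regression function is the same for both values of `a`, because `lawW` is. Without this,
equations from different strata could not be chained. -/
lemma condExp_evalH₂ (hproxy : S.ProxyVariables P) (hh : S.IsOutcomeBridge P ζ) (a : Fin 2) :
    condExp (sigmaOf fun ω => (((S.U ω, S.X ω), S.D ω), S.M ω)) (S.given P a)
      (fun ω => ζ.evalH₂ (S.obs ω))
      =ᵐ[S.given P a] fun ω => S.meanH₂ P ζ (((S.U ω, S.X ω), S.D ω), S.M ω) := by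
  have := hh.measurable_h₂
  have : Nonempty 𝓦 := ‹Nonempty Ω›.map S.W
  exact HasCondDistrib.condExp_ae_eq (hproxy.hasCondDistrib_W_UXDM a) S.measurable_UXDM
    S.measurable_W (f := fun p => ζ.h₂ (p.2, p.1.2, p.1.1.2, p.1.1.1.2)) (by fun_prop)
    (S.integrable_given hh.integrable_h₂)

lemma condExp_evalH₁ (hproxy : S.ProxyVariables P) (hh : S.IsOutcomeBridge P ζ) (a : Fin 2) :
    condExp (sigmaOf fun ω => ((S.U ω, S.X ω), S.D ω)) (S.given P a)
      (fun ω => ζ.evalH₁ (S.obs ω))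
      =ᵐ[S.given P a] fun ω => S.meanH₁ P ζ ((S.U ω, S.X ω), S.D ω) := by
  have := hh.measurable_h₁
  have : Nonempty 𝓦 := ‹Nonempty Ω›.map S.W
  exact HasCondDistrib.condExp_ae_eq (hproxy.hasCondDistrib_W_UXD a) S.measurable_UXD
    S.measurable_W (f := fun p => ζ.h₁ (p.2, p.1.2, p.1.1.2)) (by fun_prop)
    (S.integrable_given hh.integrable_h₁)

lemma condExp_evalH₀ (hproxy : S.ProxyVariables P) (hh : S.IsOutcomeBridge P ζ) (a : Fin 2) :
    condExp (sigmaOf fun ω => (S.U ω, S.X ω)) (S.given P a) (fun ω => ζ.evalH₀ (S.obs ω))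
      =ᵐ[S.given P a] fun ω => S.meanH₀ P ζ (S.U ω, S.X ω) := by
  have := hh.measurable_h₀
  have : Nonempty 𝓦 := ‹Nonempty Ω›.map S.W
  exact HasCondDistrib.condExp_ae_eq (hproxy.hasCondDistrib_W_UX_given a) S.measurable_UX
    S.measurable_W (f := fun p => ζ.h₀ (p.2, p.1.2)) (by fun_prop)
    (S.integrable_given hh.integrable_h₀)

variable [StandardBorelSpace 𝓜] [StandardBorelSpace 𝓓]

/-- `E[Y ∣ A = 1, M, D, X, U] = E[h₂ ∣ A = 1, M, D, X, U]`, as an equality of regression functions. -/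
lemma mean_lawY_ae_eq (hcons : S.Consistency P) (hpos : S.Positivity P)
    (hexch : S.LatentExchangeability P) (hproxy : S.ProxyVariables P)
    (hcompl : S.CompletenessZ P) (hh : S.IsOutcomeBridge P ζ)
    (hmom : S.FiniteSecondMoments P ζ η) :
    ∀ᵐ t ∂(S.given P 1).map fun ω => (((S.U ω, S.X ω), S.D ω), S.M ω),
      ∫ y, y ∂S.lawY P t = S.meanH₂ P ζ t := by
  rw [ae_map_iff S.measurable_UXDM.aemeasurable
    (measurableSet_eq_fun measurable_mean_lawY (measurable_meanH₂ hh))]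
  have h1 := HasCondDistrib.condExp_ae_eq (hasCondDistrib_Y hcons hexch) S.measurable_UXDM
    S.measurable_Y (f := Prod.snd) measurable_snd hh.integrable_Y
  have h2 := condExp_eq_of_residual hh.integrable_Y (S.integrable_given hh.integrable_h₂)
    (condExp_residual_mediator hpos hproxy hcompl hh hmom)
  filter_upwards [h1, h2, condExp_evalH₂ hproxy hh 1] with ω h1 h2 h3
  exact h1.symm.trans (h2.trans h3)

/-- `E[h₂ ∣ A = 0, D, X, U] = E[h₁ ∣ A = 0, D, X, U]`, as an equality of regression functions. -/
lemma mean_lawM_ae_eq (hcons : S.Consistency P) (hpos : S.Positivity P)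
    (hexch : S.LatentExchangeability P) (hproxy : S.ProxyVariables P)
    (hcompl : S.CompletenessZ P) (hh : S.IsOutcomeBridge P ζ)
    (hmom : S.FiniteSecondMoments P ζ η) :
    ∀ᵐ t ∂(S.given P 0).map fun ω => ((S.U ω, S.X ω), S.D ω),
      ∫ m, S.meanH₂ P ζ (t, m) ∂S.lawM P t = S.meanH₁ P ζ t := by
  have : Nonempty 𝓜 := ‹Nonempty Ω›.map S.M
  have hle : sigmaOf (fun ω => ((S.U ω, S.X ω), S.D ω))
      ≤ sigmaOf fun ω => (((S.U ω, S.X ω), S.D ω), S.M ω) :=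
    sigmaOf_comp_le (f := fun ω => (((S.U ω, S.X ω), S.D ω), S.M ω)) measurable_fst
  rw [ae_map_iff S.measurable_UXD.aemeasurable
    (measurableSet_eq_fun (measurable_mean_lawM (measurable_meanH₂ hh)) (measurable_meanH₁ hh))]
  have hi : Integrable (fun ω => S.meanH₂ P ζ (((S.U ω, S.X ω), S.D ω), S.M ω)) (S.given P 0) :=
    integrable_condExp.congr (condExp_evalH₂ hproxy hh 0)
  have h1 := HasCondDistrib.condExp_ae_eq (hasCondDistrib_M hcons hexch) S.measurable_UXD
    S.measurable_M (f := S.meanH₂ P ζ) (measurable_meanH₂ hh) hi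
  have h2 := condExp_condExp_of_le (μ := S.given P 0) (f := fun ω => ζ.evalH₂ (S.obs ω)) hle
    S.measurable_UXDM.comap_le
  have h3 := condExp_congr_ae (m := sigmaOf fun ω => ((S.U ω, S.X ω), S.D ω))
    (condExp_evalH₂ hproxy hh 0)
  have h4 := condExp_eq_of_residual (S.integrable_given hh.integrable_h₂)
    (S.integrable_given hh.integrable_h₁) (condExp_residual_witness hpos hproxy hcompl hh hmom)
  filter_upwards [h1, h2, h3, h4, condExp_evalH₁ hproxy hh 0] with ω h1 h2 h3 h4 h5
  exact h1.symm.trans (h3.symm.trans (h2.trans (h4.trans h5)))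

/-- `E[h₁ ∣ A = 1, X, U] = E[h₀ ∣ A = 1, X, U]`, as an equality of regression functions. -/
lemma mean_lawD_ae_eq (hcons : S.Consistency P) (hpos : S.Positivity P)
    (hexch : S.LatentExchangeability P) (hproxy : S.ProxyVariables P)
    (hcompl : S.CompletenessZ P) (hh : S.IsOutcomeBridge P ζ)
    (hmom : S.FiniteSecondMoments P ζ η) :
    ∀ᵐ t ∂(S.given P 1).map fun ω => (S.U ω, S.X ω),
      ∫ d, S.meanH₁ P ζ (t, d) ∂S.lawD P t = S.meanH₀ P ζ t := by
  have : Nonempty 𝓓 := ‹Nonempty Ω›.map S.D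
  have : Nonempty 𝓜 := ‹Nonempty Ω›.map S.M
  have hle : sigmaOf (fun ω => (S.U ω, S.X ω)) ≤ sigmaOf fun ω => ((S.U ω, S.X ω), S.D ω) :=
    sigmaOf_comp_le (f := fun ω => ((S.U ω, S.X ω), S.D ω)) measurable_fst
  rw [ae_map_iff S.measurable_UX.aemeasurable
    (measurableSet_eq_fun (measurable_mean_lawD (measurable_meanH₁ hh)) (measurable_meanH₀ hh))]
  have hi : Integrable (fun ω => S.meanH₁ P ζ ((S.U ω, S.X ω), S.D ω)) (S.given P 1) :=
    integrable_condExp.congr (condExp_evalH₁ hproxy hh 1)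
  have h1 := HasCondDistrib.condExp_ae_eq (hasCondDistrib_D hcons hexch) S.measurable_UX
    S.measurable_D (f := S.meanH₁ P ζ) (measurable_meanH₁ hh) hi
  have h2 := condExp_condExp_of_le (μ := S.given P 1) (f := fun ω => ζ.evalH₁ (S.obs ω)) hle
    S.measurable_UXD.comap_le
  have h3 := condExp_congr_ae (m := sigmaOf fun ω => (S.U ω, S.X ω)) (condExp_evalH₁ hproxy hh 1)
  have h4 := condExp_eq_of_residual (S.integrable_given hh.integrable_h₁)
    (S.integrable_given hh.integrable_h₀) (condExp_residual_covariate hpos hproxy hcompl hh hmom)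
  filter_upwards [h1, h2, h3, h4, condExp_evalH₀ hproxy hh 1] with ω h1 h2 h3 h4 h5
  exact h1.symm.trans (h3.symm.trans (h2.trans (h4.trans h5)))

/-- Proximal identification of the mediation functional: `ψ = E[h₀(W, X)]`. -/
theorem integral_evalH₀_eq_psi (hcons : S.Consistency P) (hpos : S.Positivity P)
    (hexch : S.LatentExchangeability P) (hcross : S.CrossWorld P) (hproxy : S.ProxyVariables P)
    (hcompl : S.CompletenessZ P) (hpsi : Integrable S.Ynested P) (hh : S.IsOutcomeBridge P ζ)
    (hmom : S.FiniteSecondMoments P ζ η) :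
    ∫ ω, ζ.evalH₀ (S.obs ω) ∂P = S.psi P := by
  have : Nonempty 𝓜 := ‹Nonempty Ω›.map S.M
  have hm : Measurable fun ω =>
      ((((S.U ω, S.X ω), S.Dpot 1 ω), S.Mpot 0 (S.Dpot 1 ω) ω), S.Ynested ω) :=
    ((S.measurable_UX.prodMk (S.measurable_Dpot 1)).prodMk S.measurable_Mnested).prodMk
      S.measurable_Ynested
  have hmap := map_nested hcons hpos hexch hcross
  have hint : Integrable (fun p => p.2)
      (((P.map (fun ω => (S.U ω, S.X ω)) ⊗ₘ S.lawD P) ⊗ₘ S.lawM P) ⊗ₘ S.lawY P) := by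
    rw [← hmap, integrable_map_measure measurable_snd.aestronglyMeasurable hm.aemeasurable]
    exact hpsi
  -- Each equation is moved from the stratum in which it was derived to the counterfactual law.
  have e2 := (compProd_lawM_absolutelyContinuous hcons hpos hexch).ae_le
    (mean_lawY_ae_eq hcons hpos hexch hproxy hcompl hh hmom)
  have e1 := (compProd_lawD_absolutelyContinuous hcons hpos hexch).ae_le
    (mean_lawM_ae_eq hcons hpos hexch hproxy hcompl hh hmom)
  have e0 := (hpos.map_UX 1).ae_le (mean_lawD_ae_eq hcons hpos hexch hproxy hcompl hh hmom)
  -- Integrability under the counterfactual law descends level by level from that of the nested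
  -- outcome.
  have hint2 := hint.integral_compProd.congr e2
  have hint1 := hint2.integral_compProd.congr e1
  have hpsi_eq : S.psi P = ∫ p, p.2
      ∂(((P.map (fun ω => (S.U ω, S.X ω)) ⊗ₘ S.lawD P) ⊗ₘ S.lawM P) ⊗ₘ S.lawY P) := by
    rw [← hmap, integral_map hm.aemeasurable measurable_snd.aestronglyMeasurable]
    rfl
  rw [hpsi_eq, Measure.integral_compProd hint, integral_congr_ae e2,
    Measure.integral_compProd hint2, integral_congr_ae e1, Measure.integral_compProd hint1,
    integral_congr_ae e0,
    integral_map S.measurable_UX.aemeasurable (measurable_meanH₀ hh).aestronglyMeasurable]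
  have : Nonempty 𝓦 := ‹Nonempty Ω›.map S.W
  have := hh.measurable_h₀
  have h0 := HasCondDistrib.condExp_ae_eq hasCondDistrib_W_UX S.measurable_UX S.measurable_W
    (f := fun p => ζ.h₀ (p.2, p.1.2)) (by fun_prop) hh.integrable_h₀
  exact (integral_condExp S.measurable_UX.comap_le).symm.trans (integral_congr_ae h0)

end Regressions

end PathModel

/-! ### Conditional second moments and multipliers. -/

section ConditionalMoments

variable {Ω : Type*} {m mΩ : MeasurableSpace Ω} {μ : Measure Ω} {s : Set Ω}

lemma integrable_cond_iff [IsFiniteMeasure μ] (hs : MeasurableSet s) (h0 : μ s ≠ 0) {f : Ω → ℝ} :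
    Integrable f μ[|s] ↔ Integrable (s.indicator f) μ := by
  rw [integrable_indicator_iff hs, ProbabilityTheory.cond,
    integrable_smul_measure (ENNReal.inv_ne_zero.2 (measure_ne_top _ _)) (ENNReal.inv_ne_top.2 h0)]
  rfl

lemma lintegral_cond_eq (hs : MeasurableSet s) (f : Ω → ℝ≥0∞) :
    ∫⁻ ω, f ω ∂μ[|s] = (μ s)⁻¹ * ∫⁻ ω, s.indicator f ω ∂μ := by
  rw [ProbabilityTheory.cond, lintegral_smul_measure, lintegral_indicator hs, smul_eq_mul]

lemma integral_cond_eq (hs : MeasurableSet s) (f : Ω → ℝ) :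
    ∫ ω, f ω ∂μ[|s] = (μ.real s)⁻¹ * ∫ ω, s.indicator f ω ∂μ := by
  rw [ProbabilityTheory.cond, integral_smul_measure, integral_indicator hs, smul_eq_mul,
    ENNReal.toReal_inv, measureReal_def]

lemma setIntegral_cond_eq (hs : MeasurableSet s) {t : Set Ω} (ht : MeasurableSet t) (f : Ω → ℝ) :
    ∫ ω in t, f ω ∂μ[|s] = (μ.real s)⁻¹ * ∫ ω in t, s.indicator f ω ∂μ := by
  rw [← integral_indicator ht, integral_cond_eq hs, ← integral_indicator ht,
    Set.indicator_indicator, Set.indicator_indicator, Set.inter_comm]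

/-- Conditional expectations restricted to an event, and given that event. -/
theorem condExp_indicator_ae_eq_mul [IsFiniteMeasure μ] (hm : m ≤ mΩ)
    (hs : MeasurableSet s) (h0 : μ s ≠ 0) {f : Ω → ℝ} (hf : Integrable f μ[|s]) :
    condExp m μ (s.indicator f)
      =ᵐ[μ] fun ω => condExp m μ (s.indicator fun _ => (1 : ℝ)) ω * condExp m μ[|s] f ω := by
  have hc : (μ.real s)⁻¹ ≠ 0 := inv_ne_zero ((measureReal_ne_zero_iff).2 h0)
  have hf' := (integrable_cond_iff hs h0).1 hf
  have hg' : Integrable (s.indicator (condExp m μ[|s] f)) μ :=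
    (integrable_cond_iff hs h0).1 integrable_condExp
  have h1 : condExp m μ (s.indicator (condExp m μ[|s] f)) =ᵐ[μ] condExp m μ (s.indicator f) := by
    refine ae_eq_condExp_of_forall_setIntegral_eq hm hf'
      (fun _ _ _ => integrable_condExp.integrableOn) (fun t ht _ => ?_)
      stronglyMeasurable_condExp.aestronglyMeasurable
    rw [setIntegral_condExp hm hg' ht]
    have h2 := setIntegral_condExp (μ := μ[|s]) hm hf ht
    rw [setIntegral_cond_eq hs (hm t ht), setIntegral_cond_eq hs (hm t ht)] at h2
    exact mul_left_cancel₀ hc h2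
  have h3 : s.indicator (condExp m μ[|s] f)
      = (s.indicator fun _ => (1 : ℝ)) * condExp m μ[|s] f := by
    ext ω
    by_cases h : ω ∈ s <;> simp [h]
  refine h1.symm.trans ?_
  rw [h3] at hg' ⊢
  exact condExp_mul_of_stronglyMeasurable_right stronglyMeasurable_condExp hg'
    ((integrable_const _).indicator hs)

/-- A bound on conditional second moments is a bound for integrals against functions measurable
with respect to the conditioning σ-algebra. -/
lemma CondSecondMomentLE.lintegral_mul_le [IsFiniteMeasure μ] (hm : m ≤ mΩ)
    {f : Ω → ℝ} {η : ℝ} (h : CondSecondMomentLE μ m f η) {G : Ω → ℝ≥0∞} (hG : Measurable[m] G) :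
    ∫⁻ ω, ‖f ω‖ₑ ^ 2 * G ω ∂μ ≤ ENNReal.ofReal η * ∫⁻ ω, G ω ∂μ := by
  have hfm : AEMeasurable (fun ω => ‖f ω‖ₑ ^ 2) μ := by
    have := h.1.aestronglyMeasurable.enorm
    fun_prop
  have hsq (x : ℝ) : ‖x‖ₑ ^ 2 = ENNReal.ofReal (x ^ 2) := by
    rw [← Real.enorm_of_nonneg (sq_nonneg x), enorm_pow]
  have hi : Integrable (fun ω => f ω ^ 2) μ := h.1.integrable_sq
  -- The moment bound is a comparison of two measures on the coarse σ-algebra, and so extends at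
  -- once to all nonnegative integrands measurable there.
  have hle : (μ.withDensity fun ω => ‖f ω‖ₑ ^ 2).trim hm ≤ ENNReal.ofReal η • μ.trim hm := by
    refine Measure.le_iff.2 fun t ht => ?_
    rw [trim_measurableSet_eq hm ht, Measure.smul_apply, trim_measurableSet_eq hm ht,
      withDensity_apply _ (hm t ht), smul_eq_mul]
    simp_rw [hsq]
    rw [← ofReal_integral_eq_lintegral_ofReal hi.integrableOn (ae_of_all _ fun _ => sq_nonneg _),
      ← setIntegral_condExp hm hi ht]
    have h1 : ∫ ω in t, condExp m μ (fun ω => f ω ^ 2) ω ∂μ ≤ ∫ _ in t, η ∂μ :=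
      integral_mono_ae integrable_condExp.integrableOn (integrable_const _)
        (ae_restrict_of_ae h.2)
    refine (ENNReal.ofReal_le_ofReal h1).trans ?_
    rw [setIntegral_const, smul_eq_mul, mul_comm, ENNReal.ofReal_mul' measureReal_nonneg,
      ofReal_measureReal]
  calc ∫⁻ ω, ‖f ω‖ₑ ^ 2 * G ω ∂μ = ∫⁻ ω, G ω ∂(μ.withDensity fun ω => ‖f ω‖ₑ ^ 2) :=
        (lintegral_withDensity_eq_lintegral_mul₀ hfm (hG.mono hm le_rfl).aemeasurable).symm
    _ = ∫⁻ ω, G ω ∂((μ.withDensity fun ω => ‖f ω‖ₑ ^ 2).trim hm) := (lintegral_trim hm hG).symm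
    _ ≤ ∫⁻ ω, G ω ∂(ENNReal.ofReal η • μ.trim hm) := lintegral_mono' hle le_rfl
    _ = _ := by rw [lintegral_smul_measure, lintegral_trim hm hG, smul_eq_mul]

lemma integral_mul_eq_zero_of_condExp (hm : m ≤ mΩ)
    [SigmaFinite (μ.trim hm)] {f g : Ω → ℝ}
    (h : condExp m μ f =ᵐ[μ] 0) (hf : Integrable f μ) (hg : StronglyMeasurable[m] g)
    (hfg : Integrable (fun ω => f ω * g ω) μ) :
    ∫ ω, f ω * g ω ∂μ = 0 := by
  rw [← integral_condExp hm]
  have h1 := condExp_mul_of_stronglyMeasurable_right hg hfg hf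
  rw [integral_congr_ae (g := 0)]
  · simp
  filter_upwards [h, h1] with ω h h1
  exact h1.trans (by simp [h])

end ConditionalMoments

/-- The random variable `b` has conditional mean zero given `t`, and its conditional second moment
is at most `η`, within the stratum with indicator `c`. -/
structure IsMultiplier {α E : Type*} [MeasurableSpace α] [MeasurableSpace E] (Q : Measure α)
    (η : ℝ) (c b : α → ℝ) (t : α → E) : Prop where
  measurable_left : Measurable b
  measurable_right : Measurable t
  lintegral_le : ∀ g : E → ℝ, Measurable g →
    ∫⁻ o, ‖b o * g (t o)‖ₑ ^ 2 ∂Q ≤ ENNReal.ofReal η * ∫⁻ o, ‖c o * g (t o)‖ₑ ^ 2 ∂Q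
  integral_eq_zero : ∀ g : E → ℝ, Measurable g → MemLp (fun o => c o * g (t o)) 2 Q →
    ∫ o, b o * g (t o) ∂Q = 0

/-- The variable `b` is `ε` switched off outside the stratum, and the normalising constant `P s`
cancels. Two σ-algebras occur since the moment bound and the mean-zero equation may list their
variables in different orders; only that both contain `σ(t)` matters. -/
lemma isMultiplier_of_cond {Ω α E : Type*} {m m' mΩ : MeasurableSpace Ω} [MeasurableSpace α]
    [MeasurableSpace E] {P : Measure Ω} [IsFiniteMeasure P] {X : Ω → α} (hX : Measurable X)
    {B : Set α} (hB : MeasurableSet B) {s : Set Ω} (hs : s = X ⁻¹' B) (h0 : P s ≠ 0)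
    {t : α → E} (ht : Measurable t) (hm : m ≤ mΩ) (hm' : m' ≤ mΩ)
    (htm : sigmaOf (fun ω => t (X ω)) ≤ m) (htm' : sigmaOf (fun ω => t (X ω)) ≤ m')
    {c ε b : α → ℝ} (hc : c = B.indicator 1) (hbm : Measurable b) (hb : ∀ o, b o = c o * ε o)
    {η : ℝ} (hsq : CondSecondMomentLE P[|s] m (fun ω => ε (X ω)) η)
    (hmean : condExp m' P[|s] (fun ω => ε (X ω)) =ᵐ[P[|s]] 0) :
    IsMultiplier (P.map X) η c b t := by
  have hsm : MeasurableSet s := hs ▸ hX hB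
  have hcm : Measurable c := hc ▸ measurable_one.indicator hB
  have hcs (ω : Ω) : c (X ω) = s.indicator 1 ω := by rw [hc, hs]; rfl
  have hle (g : E → ℝ) (hg : Measurable g) :
      ∫⁻ o, ‖b o * g (t o)‖ₑ ^ 2 ∂P.map X
        ≤ ENNReal.ofReal η * ∫⁻ o, ‖c o * g (t o)‖ₑ ^ 2 ∂P.map X := by
    rw [lintegral_map (by fun_prop) hX, lintegral_map (by fun_prop) hX]
    have h1 := hsq.lintegral_mul_le hm (G := fun ω => ‖g (t (X ω))‖ₑ ^ 2) (by
      have : Measurable[m] fun ω => t (X ω) := (comap_measurable _).mono htm le_rfl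
      exact ((measurable_enorm.pow_const 2).comp (hg.comp this)))
    rw [lintegral_cond_eq hsm, lintegral_cond_eq hsm, mul_left_comm,
      ENNReal.mul_le_mul_iff_right (ENNReal.inv_ne_zero.2 (measure_ne_top _ _))
        (ENNReal.inv_ne_top.2 h0)] at h1
    convert h1 using 3 with ω
    · rw [hb, hcs]
      by_cases h : ω ∈ s <;> simp [h, mul_pow]
    · ext ω
      rw [hcs]
      by_cases h : ω ∈ s <;> simp [h]
  refine ⟨hbm, ht, hle, fun g hg hg2 => ?_⟩
  have hgm : Measurable[m'] fun ω => g (t (X ω)) :=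
    hg.comp ((comap_measurable _).mono htm' le_rfl)
  have hg2' : MemLp (fun ω => g (t (X ω))) 2 P[|s] := by
    refine (memLp_two_iff_integrable_sq (hg.comp (ht.comp hX)).aestronglyMeasurable).2 ?_
    rw [integrable_cond_iff hsm h0]
    have h1 := (hg2.comp_measurePreserving (hX.measurePreserving P)).integrable_sq
    refine h1.congr (ae_of_all _ fun ω => ?_)
    simp only [Function.comp_apply, hcs]
    by_cases h : ω ∈ s <;> simp [h]
  have h2 := integral_mul_eq_zero_of_condExp hm' hmean (hsq.1.integrable (by norm_num))
    hgm.stronglyMeasurable (hsq.1.integrable_mul hg2')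
  rw [integral_cond_eq hsm, mul_eq_zero,
    or_iff_right (inv_ne_zero ((measureReal_ne_zero_iff).2 h0))] at h2
  rw [integral_map hX.aemeasurable (by fun_prop), ← h2]
  refine integral_congr_ae (ae_of_all _ fun ω => ?_)
  simp only [hb, hcs]
  by_cases h : ω ∈ s <;> simp [h]

/-! ### Residuals and balancing weights as functions of an observation. -/

section Measurability

variable {𝓜 𝓓 𝓩 𝓦 𝓧 : Type*}

namespace Nuisance

/-- `h₁ - h₀` among the treated. -/
def residual₀ (ζ : Nuisance 𝓜 𝓓 𝓩 𝓦 𝓧) (o : Obs 𝓜 𝓓 𝓩 𝓦 𝓧) : ℝ :=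
  o.a * (ζ.evalH₁ o - ζ.evalH₀ o)
/-- `h₂ - h₁` among the untreated. -/
def residual₁ (ζ : Nuisance 𝓜 𝓓 𝓩 𝓦 𝓧) (o : Obs 𝓜 𝓓 𝓩 𝓦 𝓧) : ℝ :=
  (1 - o.a) * (ζ.evalH₂ o - ζ.evalH₁ o)
/-- `Y - h₂` among the treated. -/
def residual₂ (ζ : Nuisance 𝓜 𝓓 𝓩 𝓦 𝓧) (o : Obs 𝓜 𝓓 𝓩 𝓦 𝓧) : ℝ :=
  o.a * (o.y - ζ.evalH₂ o)
/-- The balancing weight `A q₀ - 1`. -/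
def balance₀ (ζ : Nuisance 𝓜 𝓓 𝓩 𝓦 𝓧) (o : Obs 𝓜 𝓓 𝓩 𝓦 𝓧) : ℝ :=
  o.a * ζ.evalQ₀ o - 1
/-- The balancing weight `(1 - A) q₁ - A q₀`. -/
def balance₁ (ζ : Nuisance 𝓜 𝓓 𝓩 𝓦 𝓧) (o : Obs 𝓜 𝓓 𝓩 𝓦 𝓧) : ℝ :=
  (1 - o.a) * ζ.evalQ₁ o - o.a * ζ.evalQ₀ o
/-- The balancing weight `A q₂ - (1 - A) q₁`. -/
def balance₂ (ζ : Nuisance 𝓜 𝓓 𝓩 𝓦 𝓧) (o : Obs 𝓜 𝓓 𝓩 𝓦 𝓧) : ℝ :=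
  o.a * ζ.evalQ₂ o - (1 - o.a) * ζ.evalQ₁ o

lemma eif_eq (ζ : Nuisance 𝓜 𝓓 𝓩 𝓦 𝓧) (ψ : ℝ) (o : Obs 𝓜 𝓓 𝓩 𝓦 𝓧) :
    ζ.eif ψ o = ζ.residual₀ o * ζ.evalQ₀ o + ζ.residual₁ o * ζ.evalQ₁ o
      + ζ.residual₂ o * ζ.evalQ₂ o + (ζ.evalH₀ o - ψ) := by
  simp only [eif, residual₀, residual₁, residual₂]
  ring

end Nuisance

namespace Obs

lemma a_eq_indicator :
    (a : Obs 𝓜 𝓓 𝓩 𝓦 𝓧 → ℝ) = {o : Obs 𝓜 𝓓 𝓩 𝓦 𝓧 | o.2.1 = 1}.indicator 1 := by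
  ext o
  simp [a, Set.indicator]

lemma one_sub_a_eq_indicator :
    (fun o : Obs 𝓜 𝓓 𝓩 𝓦 𝓧 => 1 - o.a) = {o : Obs 𝓜 𝓓 𝓩 𝓦 𝓧 | o.2.1 = 0}.indicator 1 := by
  ext o
  by_cases h : o.2.1 = 1
  · simp [a, Set.indicator, h]
  · have h' : o.2.1 = 0 := by omega
    simp [a, Set.indicator, h']

end Obs

variable [MeasurableSpace 𝓜] [MeasurableSpace 𝓓] [MeasurableSpace 𝓩] [MeasurableSpace 𝓦]
  [MeasurableSpace 𝓧]

namespace Obs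

lemma measurableSet_treatment (i : Fin 2) : MeasurableSet {o : Obs 𝓜 𝓓 𝓩 𝓦 𝓧 | o.2.1 = i} :=
  (measurable_fst.comp measurable_snd) (measurableSet_singleton i)

@[fun_prop]
lemma measurable_a : Measurable (a : Obs 𝓜 𝓓 𝓩 𝓦 𝓧 → ℝ) :=
  (congrArg _ a_eq_indicator).mpr (measurable_one.indicator (measurableSet_treatment 1))

@[fun_prop]
lemma measurable_y : Measurable (y : Obs 𝓜 𝓓 𝓩 𝓦 𝓧 → ℝ) := measurable_fst

lemma measurable_wx : Measurable fun o : Obs 𝓜 𝓓 𝓩 𝓦 𝓧 => (o.w, o.x) := by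
  unfold w x; fun_prop

lemma measurable_wdx : Measurable fun o : Obs 𝓜 𝓓 𝓩 𝓦 𝓧 => (o.w, o.d, o.x) := by
  unfold w d x; fun_prop

lemma measurable_wmdx : Measurable fun o : Obs 𝓜 𝓓 𝓩 𝓦 𝓧 => (o.w, o.m, o.d, o.x) := by
  unfold w m d x; fun_prop

lemma measurable_zx : Measurable fun o : Obs 𝓜 𝓓 𝓩 𝓦 𝓧 => (o.z, o.x) := by
  unfold z x; fun_prop

lemma measurable_zdx : Measurable fun o : Obs 𝓜 𝓓 𝓩 𝓦 𝓧 => (o.z, o.d, o.x) := by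
  unfold z d x; fun_prop

lemma measurable_zmdx : Measurable fun o : Obs 𝓜 𝓓 𝓩 𝓦 𝓧 => (o.z, o.m, o.d, o.x) := by
  unfold z m d x; fun_prop

end Obs

/-- All components of a tuple of nuisance functions are measurable. -/
structure Nuisance.IsMeasurable (ζ : Nuisance 𝓜 𝓓 𝓩 𝓦 𝓧) : Prop where
  h₂ : Measurable ζ.h₂
  h₁ : Measurable ζ.h₁
  h₀ : Measurable ζ.h₀
  q₂ : Measurable ζ.q₂
  q₁ : Measurable ζ.q₁
  q₀ : Measurable ζ.q₀

namespace Nuisance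

variable {ζ : Nuisance 𝓜 𝓓 𝓩 𝓦 𝓧}

lemma IsMeasurable.evalH₂ (h : ζ.IsMeasurable) : Measurable ζ.evalH₂ :=
  h.h₂.comp Obs.measurable_wmdx
lemma IsMeasurable.evalH₁ (h : ζ.IsMeasurable) : Measurable ζ.evalH₁ :=
  h.h₁.comp Obs.measurable_wdx
lemma IsMeasurable.evalH₀ (h : ζ.IsMeasurable) : Measurable ζ.evalH₀ :=
  h.h₀.comp Obs.measurable_wx
lemma IsMeasurable.evalQ₂ (h : ζ.IsMeasurable) : Measurable ζ.evalQ₂ :=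
  h.q₂.comp Obs.measurable_zmdx
lemma IsMeasurable.evalQ₁ (h : ζ.IsMeasurable) : Measurable ζ.evalQ₁ :=
  h.q₁.comp Obs.measurable_zdx
lemma IsMeasurable.evalQ₀ (h : ζ.IsMeasurable) : Measurable ζ.evalQ₀ :=
  h.q₀.comp Obs.measurable_zx

lemma IsMeasurable.residual₀ (h : ζ.IsMeasurable) : Measurable ζ.residual₀ :=
  Obs.measurable_a.mul (h.evalH₁.sub h.evalH₀)
lemma IsMeasurable.residual₁ (h : ζ.IsMeasurable) : Measurable ζ.residual₁ :=
  (measurable_const.sub Obs.measurable_a).mul (h.evalH₂.sub h.evalH₁)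
lemma IsMeasurable.residual₂ (h : ζ.IsMeasurable) : Measurable ζ.residual₂ :=
  Obs.measurable_a.mul (Obs.measurable_y.sub h.evalH₂)
lemma IsMeasurable.balance₀ (h : ζ.IsMeasurable) : Measurable ζ.balance₀ :=
  (Obs.measurable_a.mul h.evalQ₀).sub measurable_const
lemma IsMeasurable.balance₁ (h : ζ.IsMeasurable) : Measurable ζ.balance₁ :=
  ((measurable_const.sub Obs.measurable_a).mul h.evalQ₁).sub (Obs.measurable_a.mul h.evalQ₀)
lemma IsMeasurable.balance₂ (h : ζ.IsMeasurable) : Measurable ζ.balance₂ :=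
  (Obs.measurable_a.mul h.evalQ₂).sub ((measurable_const.sub Obs.measurable_a).mul h.evalQ₁)

end Nuisance

end Measurability

/-! ### The bridge equations as multiplier properties. -/

namespace PathModel

variable {Ω 𝓤 𝓜 𝓓 𝓩 𝓦 𝓧 : Type*} [mΩ : MeasurableSpace Ω]
    [MeasurableSpace 𝓤] [MeasurableSpace 𝓜] [MeasurableSpace 𝓓] [MeasurableSpace 𝓩]
    [MeasurableSpace 𝓦] [MeasurableSpace 𝓧]
    {S : PathModel Ω 𝓤 𝓜 𝓓 𝓩 𝓦 𝓧} {P : Measure Ω} {ζ : Nuisance 𝓜 𝓓 𝓩 𝓦 𝓧} {η : ℝ}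

lemma isMeasurable_bridge (hh : S.IsOutcomeBridge P ζ) (hq : S.IsTreatmentBridge P ζ) :
    ζ.IsMeasurable :=
  ⟨hh.measurable_h₂, hh.measurable_h₁, hh.measurable_h₀, hq.measurable_q₂, hq.measurable_q₁,
    hq.measurable_q₀⟩

variable (S) in
lemma measurable_obs : Measurable S.obs :=
  S.measurable_Y.prodMk (S.measurable_A.prodMk (S.measurable_M.prodMk (S.measurable_D.prodMk
    (S.measurable_Z.prodMk (S.measurable_W.prodMk S.measurable_X)))))

lemma a_obs_mul (f : Ω → ℝ) :
    (fun ω => (S.obs ω).a * f ω) = (S.A ⁻¹' {1}).indicator f := by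
  ext ω
  by_cases h : S.A ω = 1 <;> simp [Obs.a, obs, h]

lemma one_sub_a_obs_mul (f : Ω → ℝ) :
    (fun ω => (1 - (S.obs ω).a) * f ω) = (S.A ⁻¹' {0}).indicator f := by
  ext ω
  by_cases h : S.A ω = 1
  · simp [Obs.a, obs, h]
  · have h' : S.A ω = 0 := by omega
    simp [Obs.a, obs, h']

section Residuals

variable [IsProbabilityMeasure P]

lemma isMultiplier_residual₂ (hpos : S.Positivity P) (hh : S.IsOutcomeBridge P ζ)
    (hζ : ζ.IsMeasurable) (hmom : S.FiniteSecondMoments P ζ η) :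
    IsMultiplier (P.map S.obs) η Obs.a ζ.residual₂ fun o => (o.z, o.m, o.d, o.x) := by
  have hm : Measurable fun ω => (S.M ω, S.D ω, S.Z ω, S.X ω) :=
    S.measurable_M.prodMk (S.measurable_D.prodMk (S.measurable_Z.prodMk S.measurable_X))
  have hle : sigmaOf (fun ω => (S.Z ω, S.M ω, S.D ω, S.X ω))
      ≤ sigmaOf fun ω => (S.M ω, S.D ω, S.Z ω, S.X ω) :=
    sigmaOf_comp_le (f := fun ω => (S.M ω, S.D ω, S.Z ω, S.X ω))
      (g := fun p => (p.2.2.1, p.1, p.2.1, p.2.2.2)) (by fun_prop)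
  exact isMultiplier_of_cond S.measurable_obs (Obs.measurableSet_treatment 1) rfl
    (hpos.event_ne_zero 1) Obs.measurable_zmdx hm.comap_le hm.comap_le hle hle
    Obs.a_eq_indicator hζ.residual₂ (fun _ => rfl) hmom.h₂
    (condExp_sub_eq_zero hh.integrable_Y (S.integrable_given hh.integrable_h₂) rfl hh.eq_h₂)

lemma isMultiplier_residual₁ (hpos : S.Positivity P) (hh : S.IsOutcomeBridge P ζ)
    (hζ : ζ.IsMeasurable) (hmom : S.FiniteSecondMoments P ζ η) :
    IsMultiplier (P.map S.obs) η (fun o => 1 - o.a) ζ.residual₁ fun o => (o.z, o.d, o.x) := by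
  have hm : Measurable fun ω => (S.D ω, S.Z ω, S.X ω) :=
    S.measurable_D.prodMk (S.measurable_Z.prodMk S.measurable_X)
  have hle : sigmaOf (fun ω => (S.Z ω, S.D ω, S.X ω)) ≤ sigmaOf fun ω => (S.D ω, S.Z ω, S.X ω) :=
    sigmaOf_comp_le (f := fun ω => (S.D ω, S.Z ω, S.X ω))
      (g := fun p => (p.2.1, p.1, p.2.2)) (by fun_prop)
  exact isMultiplier_of_cond S.measurable_obs (Obs.measurableSet_treatment 0) rfl
    (hpos.event_ne_zero 0) Obs.measurable_zdx hm.comap_le hm.comap_le hle hle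
    Obs.one_sub_a_eq_indicator hζ.residual₁ (fun _ => rfl) hmom.h₁
    (condExp_sub_eq_zero (S.integrable_given hh.integrable_h₂)
      (S.integrable_given hh.integrable_h₁) rfl hh.eq_h₁)

lemma isMultiplier_residual₀ (hpos : S.Positivity P) (hh : S.IsOutcomeBridge P ζ)
    (hζ : ζ.IsMeasurable) (hmom : S.FiniteSecondMoments P ζ η) :
    IsMultiplier (P.map S.obs) η Obs.a ζ.residual₀ fun o => (o.z, o.x) := by
  have hm : Measurable fun ω => (S.Z ω, S.X ω) := S.measurable_Z.prodMk S.measurable_X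
  exact isMultiplier_of_cond S.measurable_obs (Obs.measurableSet_treatment 1) rfl
    (hpos.event_ne_zero 1) Obs.measurable_zx hm.comap_le hm.comap_le le_rfl le_rfl
    Obs.a_eq_indicator hζ.residual₀ (fun _ => rfl) hmom.h₀
    (condExp_sub_eq_zero (S.integrable_given hh.integrable_h₁)
      (S.integrable_given hh.integrable_h₀) rfl hh.eq_h₀)

end Residuals

section Balance

variable [IsProbabilityMeasure P]

lemma integrable_a_mul {f : Ω → ℝ} (h0 : P (S.A ⁻¹' {1}) ≠ 0) (hf : Integrable f (S.given P 1)) :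
    Integrable (fun ω => (S.obs ω).a * f ω) P := by
  rw [a_obs_mul]
  exact (integrable_cond_iff (S.measurableSet_event 1) h0).1 hf

lemma integrable_one_sub_a_mul {f : Ω → ℝ} (h0 : P (S.A ⁻¹' {0}) ≠ 0)
    (hf : Integrable f (S.given P 0)) : Integrable (fun ω => (1 - (S.obs ω).a) * f ω) P := by
  rw [one_sub_a_obs_mul]
  exact (integrable_cond_iff (S.measurableSet_event 0) h0).1 hf

lemma condExp_a_mul {E : Type*} [MeasurableSpace E] {T : Ω → E} (hT : Measurable T) {f : Ω → ℝ}
    (h0 : P (S.A ⁻¹' {1}) ≠ 0) (hf : Integrable f (S.given P 1)) :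
    condExp (sigmaOf T) P (fun ω => (S.obs ω).a * f ω)
      =ᵐ[P] fun ω => S.propensity P 1 T ω * condExp (sigmaOf T) (S.given P 1) f ω := by
  rw [a_obs_mul]
  exact condExp_indicator_ae_eq_mul hT.comap_le (S.measurableSet_event 1) h0 hf

lemma condExp_one_sub_a_mul {E : Type*} [MeasurableSpace E] {T : Ω → E} (hT : Measurable T)
    {f : Ω → ℝ} (h0 : P (S.A ⁻¹' {0}) ≠ 0) (hf : Integrable f (S.given P 0)) :
    condExp (sigmaOf T) P (fun ω => (1 - (S.obs ω).a) * f ω)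
      =ᵐ[P] fun ω => S.propensity P 0 T ω * condExp (sigmaOf T) (S.given P 0) f ω := by
  rw [one_sub_a_obs_mul]
  exact condExp_indicator_ae_eq_mul hT.comap_le (S.measurableSet_event 0) h0 hf

variable [StandardBorelSpace Ω]

/-- Given `(U, X, D, M)`, the proxy `W` follows `lawW` in both strata, so their equivalence extends
to `W`. -/
lemma Positivity.map_UXDMW (hpos : S.Positivity P) (hproxy : S.ProxyVariables P) (b : Fin 2) :
    P.map (fun ω => ((((S.U ω, S.X ω), S.D ω), S.M ω), S.W ω))
      ≪ (S.given P b).map fun ω => ((((S.U ω, S.X ω), S.D ω), S.M ω), S.W ω) := by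
  have : Nonempty Ω := P.nonempty_of_neZero
  refine S.map_absolutelyContinuous_given_of_forall P (S.measurable_UXDM.prodMk S.measurable_W)
    (fun a b => ?_) b
  rw [(hproxy.hasCondDistrib_W_UXDM a).map_eq, (hproxy.hasCondDistrib_W_UXDM b).map_eq]
  exact (hpos.map_UXDM a b).compProd_left _

/-- Needed to clear the denominators in the equations for the `q`'s, whose propensities condition on
observed functions of `(U, X, D, M, W)`. -/
lemma Positivity.propensity_pos (hpos : S.Positivity P) (hproxy : S.ProxyVariables P)
    {E : Type*} [MeasurableSpace E] {f : (((𝓤 × 𝓧) × 𝓓) × 𝓜) × 𝓦 → E} (hf : Measurable f)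
    {T : Ω → E} (hT : T = fun ω => f ((((S.U ω, S.X ω), S.D ω), S.M ω), S.W ω)) (a : Fin 2) :
    ∀ᵐ ω ∂P, 0 < S.propensity P a T ω := by
  have hm : Measurable fun ω => ((((S.U ω, S.X ω), S.D ω), S.M ω), S.W ω) :=
    S.measurable_UXDM.prodMk S.measurable_W
  subst hT
  refine S.propensity_pos P (hf.comp hm) ?_
  have h := (hpos.map_UXDMW hproxy a).map hf
  rw [Measure.map_map hf hm, Measure.map_map hf hm] at h
  exact h

/-- Multiplied by the propensity, the bridge equation says that `A q₀ - 1` is centred given `(W, X)`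
under `P` itself; hence the stratum is everything. The other two weights are treated likewise. -/
lemma isMultiplier_balance₀ (hpos : S.Positivity P) (hproxy : S.ProxyVariables P)
    (hq : S.IsTreatmentBridge P ζ) (hζ : ζ.IsMeasurable) (hmom : S.FiniteSecondMoments P ζ η) :
    IsMultiplier (P.map S.obs) η 1 ζ.balance₀ fun o => (o.w, o.x) := by
  have hm : Measurable fun ω => (S.W ω, S.X ω) := S.measurable_W.prodMk S.measurable_X
  have hmean : condExp (sigmaOf fun ω => (S.W ω, S.X ω)) P
      (fun ω => (S.obs ω).a * ζ.evalQ₀ (S.obs ω) - 1) =ᵐ[P] 0 := by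
    refine condExp_sub_eq_zero (integrable_a_mul (hpos.event_ne_zero 1) hq.integrable_q₀)
      (integrable_const 1) rfl ?_
    rw [condExp_const hm.comap_le]
    filter_upwards [condExp_a_mul hm (hpos.event_ne_zero 1) hq.integrable_q₀, hq.eq_q₀,
      hpos.propensity_pos hproxy (f := fun p => (p.2, p.1.1.1.2)) (by fun_prop) rfl 1]
      with ω h1 h2 h3
    rw [h1, ← h2, mul_one_div_cancel h3.ne']
  refine isMultiplier_of_cond (s := Set.univ) (ε := ζ.balance₀) S.measurable_obs MeasurableSet.univ
    Set.preimage_univ.symm (by simp) Obs.measurable_wx hm.comap_le hm.comap_le le_rfl le_rfl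
    (by simp) hζ.balance₀ (by simp) ?_ ?_
  · rw [cond_univ]; exact hmom.q₀
  · rw [cond_univ]; exact hmean

lemma isMultiplier_balance₁ (hpos : S.Positivity P) (hproxy : S.ProxyVariables P)
    (hq : S.IsTreatmentBridge P ζ) (hζ : ζ.IsMeasurable) (hmom : S.FiniteSecondMoments P ζ η) :
    IsMultiplier (P.map S.obs) η 1 ζ.balance₁ fun o => (o.w, o.d, o.x) := by
  have hm : Measurable fun ω => (S.W ω, S.D ω, S.X ω) :=
    S.measurable_W.prodMk (S.measurable_D.prodMk S.measurable_X)
  have hm' : Measurable fun ω => (S.D ω, S.W ω, S.X ω) :=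
    S.measurable_D.prodMk (S.measurable_W.prodMk S.measurable_X)
  have hmean : condExp (sigmaOf fun ω => (S.D ω, S.W ω, S.X ω)) P
      (fun ω => (1 - (S.obs ω).a) * ζ.evalQ₁ (S.obs ω) - (S.obs ω).a * ζ.evalQ₀ (S.obs ω))
      =ᵐ[P] 0 := by
    refine condExp_sub_eq_zero (integrable_one_sub_a_mul (hpos.event_ne_zero 0) hq.integrable_q₁)
      (integrable_a_mul (hpos.event_ne_zero 1) hq.integrable_q₀) rfl ?_
    filter_upwards [condExp_a_mul hm' (hpos.event_ne_zero 1) hq.integrable_q₀,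
      condExp_one_sub_a_mul hm' (hpos.event_ne_zero 0) hq.integrable_q₁, hq.eq_q₁,
      hpos.propensity_pos hproxy (f := fun p => (p.1.1.2, p.2, p.1.1.1.2)) (by fun_prop) rfl 0]
      with ω h1 h2 h3 h4
    rw [h1, h2, ← h3]
    field_simp
  refine isMultiplier_of_cond (s := Set.univ) (ε := ζ.balance₁) S.measurable_obs MeasurableSet.univ
    Set.preimage_univ.symm (by simp) Obs.measurable_wdx hm.comap_le hm'.comap_le le_rfl
    (sigmaOf_comp_le (f := fun ω => (S.D ω, S.W ω, S.X ω))
      (g := fun p => (p.2.1, p.1, p.2.2)) (by fun_prop))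
    (by simp) hζ.balance₁ (by simp) ?_ ?_
  · rw [cond_univ]; exact hmom.q₁
  · rw [cond_univ]; exact hmean

lemma isMultiplier_balance₂ (hpos : S.Positivity P) (hproxy : S.ProxyVariables P)
    (hq : S.IsTreatmentBridge P ζ) (hζ : ζ.IsMeasurable) (hmom : S.FiniteSecondMoments P ζ η) :
    IsMultiplier (P.map S.obs) η 1 ζ.balance₂ fun o => (o.w, o.m, o.d, o.x) := by
  have hm : Measurable fun ω => (S.W ω, S.M ω, S.D ω, S.X ω) :=
    S.measurable_W.prodMk (S.measurable_M.prodMk (S.measurable_D.prodMk S.measurable_X))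
  have hm' : Measurable fun ω => (S.M ω, S.D ω, S.W ω, S.X ω) :=
    S.measurable_M.prodMk (S.measurable_D.prodMk (S.measurable_W.prodMk S.measurable_X))
  have hmean : condExp (sigmaOf fun ω => (S.M ω, S.D ω, S.W ω, S.X ω)) P
      (fun ω => (S.obs ω).a * ζ.evalQ₂ (S.obs ω) - (1 - (S.obs ω).a) * ζ.evalQ₁ (S.obs ω))
      =ᵐ[P] 0 := by
    refine condExp_sub_eq_zero (integrable_a_mul (hpos.event_ne_zero 1) hq.integrable_q₂)
      (integrable_one_sub_a_mul (hpos.event_ne_zero 0) hq.integrable_q₁) rfl ?_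
    filter_upwards [condExp_a_mul hm' (hpos.event_ne_zero 1) hq.integrable_q₂,
      condExp_one_sub_a_mul hm' (hpos.event_ne_zero 0) hq.integrable_q₁, hq.eq_q₂,
      hpos.propensity_pos hproxy (f := fun p => (p.1.2, p.1.1.2, p.2, p.1.1.1.2)) (by fun_prop)
        rfl 1] with ω h1 h2 h3 h4
    rw [h1, h2, ← h3]
    field_simp
  refine isMultiplier_of_cond (s := Set.univ) (ε := ζ.balance₂) S.measurable_obs MeasurableSet.univ
    Set.preimage_univ.symm (by simp) Obs.measurable_wmdx hm.comap_le hm'.comap_le le_rfl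
    (sigmaOf_comp_le (f := fun ω => (S.M ω, S.D ω, S.W ω, S.X ω))
      (g := fun p => (p.2.2.1, p.1, p.2.1, p.2.2.2)) (by fun_prop))
    (by simp) hζ.balance₂ (by simp) ?_ ?_
  · rw [cond_univ]; exact hmom.q₂
  · rw [cond_univ]; exact hmean

end Balance

end PathModel

/-! ### Square-integrability and mean of the influence function. -/

lemma IsMultiplier.memLp {α E : Type*} [MeasurableSpace α] [MeasurableSpace E] {Q : Measure α}
    {η : ℝ} {c b : α → ℝ} {t : α → E} (h : IsMultiplier Q η c b t) {g : E → ℝ} (hg : Measurable g)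
    (hc : MemLp (fun o => c o * g (t o)) 2 Q) : MemLp (fun o => b o * g (t o)) 2 Q := by
  have := h.measurable_left
  have := h.measurable_right
  have key (f : α → ℝ) : eLpNorm f 2 Q < ⊤ ↔ ∫⁻ o, ‖f o‖ₑ ^ 2 ∂Q < ⊤ := by
    rw [eLpNorm_lt_top_iff_lintegral_rpow_enorm_lt_top (by norm_num) (by norm_num)]
    simp
  refine ⟨by fun_prop, (key _).2 ?_⟩
  exact (h.lintegral_le g hg).trans_lt (ENNReal.mul_lt_top ENNReal.ofReal_lt_top ((key _).1 hc.2))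

namespace Nuisance

variable {𝓜 𝓓 𝓩 𝓦 𝓧 : Type*} [MeasurableSpace 𝓜] [MeasurableSpace 𝓓] [MeasurableSpace 𝓩]
  [MeasurableSpace 𝓦] [MeasurableSpace 𝓧]

/-- The residuals and balancing weights of the nuisance functions `ζ` have conditional mean zero and
bounded conditional second moments. -/
structure IsBalanced (ζ : Nuisance 𝓜 𝓓 𝓩 𝓦 𝓧) (Q : Measure (Obs 𝓜 𝓓 𝓩 𝓦 𝓧)) (η : ℝ) : Prop where
  residual₀ : IsMultiplier Q η Obs.a ζ.residual₀ fun o => (o.z, o.x)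
  residual₁ : IsMultiplier Q η (fun o => 1 - o.a) ζ.residual₁ fun o => (o.z, o.d, o.x)
  residual₂ : IsMultiplier Q η Obs.a ζ.residual₂ fun o => (o.z, o.m, o.d, o.x)
  balance₀ : IsMultiplier Q η 1 ζ.balance₀ fun o => (o.w, o.x)
  balance₁ : IsMultiplier Q η 1 ζ.balance₁ fun o => (o.w, o.d, o.x)
  balance₂ : IsMultiplier Q η 1 ζ.balance₂ fun o => (o.w, o.m, o.d, o.x)
  memLp_balance₀ : MemLp ζ.balance₀ 2 Q
  memLp_balance₁ : MemLp ζ.balance₁ 2 Q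
  memLp_balance₂ : MemLp ζ.balance₂ 2 Q

variable {ζ : Nuisance 𝓜 𝓓 𝓩 𝓦 𝓧} {Q : Measure (Obs 𝓜 𝓓 𝓩 𝓦 𝓧)} [IsProbabilityMeasure Q] {η : ℝ}

/-- Square-integrability of the `q`'s, on the strata where they are used, comes from telescoping:
start from the constant `1` and add one balancing weight at a time. -/
lemma IsBalanced.memLp_q₀ (h : ζ.IsBalanced Q η) : MemLp (fun o => o.a * ζ.evalQ₀ o) 2 Q := by
  convert h.memLp_balance₀.add (memLp_const 1) using 1
  ext o
  simp [Nuisance.balance₀]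

lemma IsBalanced.memLp_q₁ (h : ζ.IsBalanced Q η) :
    MemLp (fun o => (1 - o.a) * ζ.evalQ₁ o) 2 Q := by
  convert h.memLp_balance₁.add h.memLp_q₀ using 1
  ext o
  simp [Nuisance.balance₁]

lemma IsBalanced.memLp_q₂ (h : ζ.IsBalanced Q η) : MemLp (fun o => o.a * ζ.evalQ₂ o) 2 Q := by
  convert h.memLp_balance₂.add h.memLp_q₁ using 1
  ext o
  simp [Nuisance.balance₂]

/-- Each term is a residual times a function of its conditioning variables, so the conditional
moment bound reduces the claim to the `q`'s. -/
theorem IsBalanced.memLp_eif (h : ζ.IsBalanced Q η) (hζ : ζ.IsMeasurable)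
    (hh₀ : MemLp ζ.evalH₀ 2 Q) (ψ : ℝ) : MemLp (ζ.eif ψ) 2 Q := by
  have : ζ.eif ψ = _ := funext (ζ.eif_eq ψ)
  rw [this]
  exact (((h.residual₀.memLp hζ.q₀ h.memLp_q₀).add (h.residual₁.memLp hζ.q₁ h.memLp_q₁)).add
    (h.residual₂.memLp hζ.q₂ h.memLp_q₂)).add (hh₀.sub (memLp_const ψ))

theorem IsBalanced.integral_eif (h : ζ.IsBalanced Q η) (hζ : ζ.IsMeasurable)
    (hh₀ : MemLp ζ.evalH₀ 2 Q) {ψ : ℝ} (hψ : ∫ o, ζ.evalH₀ o ∂Q = ψ) :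
    ∫ o, ζ.eif ψ o ∂Q = 0 := by
  have i0 : Integrable (fun o => ζ.residual₀ o * ζ.evalQ₀ o) Q :=
    (h.residual₀.memLp hζ.q₀ h.memLp_q₀).integrable (by norm_num)
  have i1 : Integrable (fun o => ζ.residual₁ o * ζ.evalQ₁ o) Q :=
    (h.residual₁.memLp hζ.q₁ h.memLp_q₁).integrable (by norm_num)
  have i2 : Integrable (fun o => ζ.residual₂ o * ζ.evalQ₂ o) Q :=
    (h.residual₂.memLp hζ.q₂ h.memLp_q₂).integrable (by norm_num)
  have ih : Integrable ζ.evalH₀ Q := hh₀.integrable (by norm_num)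
  have z0 : ∫ o, ζ.residual₀ o * ζ.evalQ₀ o ∂Q = 0 :=
    h.residual₀.integral_eq_zero _ hζ.q₀ h.memLp_q₀
  have z1 : ∫ o, ζ.residual₁ o * ζ.evalQ₁ o ∂Q = 0 :=
    h.residual₁.integral_eq_zero _ hζ.q₁ h.memLp_q₁
  have z2 : ∫ o, ζ.residual₂ o * ζ.evalQ₂ o ∂Q = 0 :=
    h.residual₂.integral_eq_zero _ hζ.q₂ h.memLp_q₂
  have : ζ.eif ψ = (fun o => ζ.residual₀ o * ζ.evalQ₀ o) + (fun o => ζ.residual₁ o * ζ.evalQ₁ o)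
      + (fun o => ζ.residual₂ o * ζ.evalQ₂ o) + (ζ.evalH₀ - fun _ => ψ) := funext (ζ.eif_eq ψ)
  rw [this, integral_add' ((i0.add i1).add i2) (ih.sub (integrable_const _)),
    integral_add' (i0.add i1) i2, integral_add' i0 i1, integral_sub' ih (integrable_const _),
    z0, z1, z2, hψ]
  simp

end Nuisance

namespace PathModel

variable {Ω 𝓤 𝓜 𝓓 𝓩 𝓦 𝓧 : Type*} [mΩ : MeasurableSpace Ω] [StandardBorelSpace Ω]
    [MeasurableSpace 𝓤] [MeasurableSpace 𝓜] [MeasurableSpace 𝓓] [MeasurableSpace 𝓩]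
    [MeasurableSpace 𝓦] [MeasurableSpace 𝓧]
    {S : PathModel Ω 𝓤 𝓜 𝓓 𝓩 𝓦 𝓧} {P : Measure Ω} {ζ : Nuisance 𝓜 𝓓 𝓩 𝓦 𝓧} {η : ℝ}

theorem isBalanced_bridge [IsProbabilityMeasure P] (hpos : S.Positivity P)
    (hproxy : S.ProxyVariables P) (hh : S.IsOutcomeBridge P ζ) (hq : S.IsTreatmentBridge P ζ)
    (hmom : S.FiniteSecondMoments P ζ η) : ζ.IsBalanced (P.map S.obs) η := by
  have hζ := isMeasurable_bridge hh hq
  have key {f : Obs 𝓜 𝓓 𝓩 𝓦 𝓧 → ℝ} (hf : Measurable f) (h : MemLp (fun ω => f (S.obs ω)) 2 P) :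
      MemLp f 2 (P.map S.obs) :=
    (memLp_map_measure_iff hf.aestronglyMeasurable S.measurable_obs.aemeasurable).2 h
  exact ⟨isMultiplier_residual₀ hpos hh hζ hmom, isMultiplier_residual₁ hpos hh hζ hmom,
    isMultiplier_residual₂ hpos hh hζ hmom, isMultiplier_balance₀ hpos hproxy hq hζ hmom,
    isMultiplier_balance₁ hpos hproxy hq hζ hmom, isMultiplier_balance₂ hpos hproxy hq hζ hmom,
    key hζ.balance₀ hmom.q₀.1, key hζ.balance₁ hmom.q₁.1, key hζ.balance₂ hmom.q₂.1⟩

end PathModel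

/-! ### Second moments of cross-fitted sums. -/

section Independence

variable {Ω α β : Type*} [MeasurableSpace Ω] [MeasurableSpace α] [MeasurableSpace β]
  {P : Measure Ω} [IsFiniteMeasure P]

lemma ProbabilityTheory.IndepFun.lintegral_eq_lintegral_lintegral {X : Ω → α} {Y : Ω → β}
    (h : IndepFun X Y P) (hX : Measurable X) (hY : Measurable Y) {Φ : α × β → ℝ≥0∞}
    (hΦ : Measurable Φ) :
    ∫⁻ s, Φ (X s, Y s) ∂P = ∫⁻ s, ∫⁻ s', Φ (X s, Y s') ∂P ∂P := by
  rw [← lintegral_map hΦ (hX.prodMk hY),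
    (indepFun_iff_map_prod_eq_prod_map_map hX.aemeasurable hY.aemeasurable).1 h,
    lintegral_prod _ hΦ.aemeasurable, lintegral_map hΦ.lintegral_prod_right' hX]
  refine lintegral_congr fun s => ?_
  exact lintegral_map (hΦ.comp measurable_prodMk_left) hY

/-- An inequality between integrals that holds for fixed values of an independent discrete random
variable also holds on average. -/
lemma lintegral_le_of_indepFun [Countable α] [MeasurableSingletonClass α] {J : Ω → α} {X : Ω → β}
    (h : IndepFun J X P) (hJ : Measurable J) (hX : Measurable X) {A : Set α}
    (hA : ∀ᵐ s ∂P, J s ∈ A) {Φ Ψ : α → β → ℝ≥0∞} (hΦ : ∀ j, Measurable (Φ j))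
    (hΨ : ∀ j, Measurable (Ψ j)) {C : ℝ≥0∞} (hC : C ≠ ⊤)
    (hle : ∀ j ∈ A, ∫⁻ s, Φ j (X s) ∂P ≤ C * ∫⁻ s, Ψ j (X s) ∂P) :
    ∫⁻ s, Φ (J s) (X s) ∂P ≤ C * ∫⁻ s, Ψ (J s) (X s) ∂P := by
  rw [h.lintegral_eq_lintegral_lintegral hJ hX (Φ := fun p => Φ p.1 p.2)
      (measurable_from_prod_countable_right hΦ),
    h.lintegral_eq_lintegral_lintegral hJ hX (Φ := fun p => Ψ p.1 p.2)
      (measurable_from_prod_countable_right hΨ), ← lintegral_const_mul' _ _ hC]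
  refine lintegral_mono_ae ?_
  filter_upwards [hA] with s hs using hle _ hs

end Independence

lemma lintegral_enorm_sq_eq {α : Type*} [MeasurableSpace α] {μ : Measure α} (f : α → ℝ) :
    ∫⁻ x, ‖f x‖ₑ ^ 2 ∂μ = eLpNorm f 2 μ ^ 2 := by
  have := eLpNorm_nnreal_pow_eq_lintegral (f := f) (μ := μ) (p := 2) (by norm_num)
  simpa using this.symm

section IID

variable {Ω α E : Type*} [MeasurableSpace Ω] [MeasurableSpace α] [MeasurableSpace E]
  {P : Measure Ω} [IsProbabilityMeasure P] {Q : Measure α} {n : ℕ} {X : Fin n → Ω → α}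

/-- The second moment of a sum of i.i.d. terms with mean zero. -/
lemma lintegral_sum_sq_eq (hX : ∀ i, Measurable (X i)) (hind : iIndepFun X P)
    (hlaw : ∀ i, P.map (X i) = Q) (I : Finset (Fin n)) {f : α → ℝ} (hf : Measurable f)
    (hL : MemLp f 2 Q) (h0 : ∫ o, f o ∂Q = 0) :
    ∫⁻ s, ‖∑ i ∈ I, f (X i s)‖ₑ ^ 2 ∂P = I.card * ∫⁻ o, ‖f o‖ₑ ^ 2 ∂Q := by
  have hfL (i : Fin n) : MemLp (fun s => f (X i s)) 2 P :=
    hL.comp_measurePreserving ⟨hX i, hlaw i⟩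
  have hmean (i : Fin n) : ∫ s, f (X i s) ∂P = 0 := by
    rw [← integral_map (hX i).aemeasurable hf.aestronglyMeasurable, hlaw i, h0]
  have hvar (i : Fin n) : eVar[fun s => f (X i s); P] = ∫⁻ o, ‖f o‖ₑ ^ 2 ∂Q := by
    rw [evariance, hmean i, ← hlaw i, lintegral_map (by fun_prop) (hX i)]
    simp
  have hmeans : ∫ s, (∑ i ∈ I, fun s => f (X i s)) s ∂P = 0 := by
    simp only [Finset.sum_apply]
    rw [integral_finsetSum _ fun i _ => (hfL i).integrable (by norm_num)]
    simp [hmean]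
  calc ∫⁻ s, ‖∑ i ∈ I, f (X i s)‖ₑ ^ 2 ∂P = eVar[∑ i ∈ I, fun s => f (X i s); P] := by
        rw [evariance, hmeans]
        simp
    _ = ∑ i ∈ I, eVar[fun s => f (X i s); P] := by
        rw [← ofReal_variance (memLp_finsetSum' _ fun i _ => hfL i),
          IndepFun.variance_sum (fun i _ => hfL i) fun i _ j _ hij =>
            (hind.indepFun hij).comp hf hf,
          ENNReal.ofReal_sum_of_nonneg fun _ _ => variance_nonneg _ _]
        exact Finset.sum_congr rfl fun i _ => ofReal_variance (hfL i)
    _ = I.card * ∫⁻ o, ‖f o‖ₑ ^ 2 ∂Q := by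
        simp [hvar]

lemma IsMultiplier.lintegral_sum_le {η : ℝ} (hη : 0 < η) {c b : α → ℝ} {t : α → E}
    (h : IsMultiplier Q η c b t) (hcm : Measurable c) (hc : ∀ o, |c o| ≤ 1)
    (hX : ∀ i, Measurable (X i))
    (hind : iIndepFun X P) (hlaw : ∀ i, P.map (X i) = Q) (I : Finset (Fin n)) {g : E → ℝ}
    (hg : Measurable g) :
    ∫⁻ s, ‖∑ i ∈ I, b (X i s) * g (t (X i s))‖ₑ ^ 2 ∂P
      ≤ I.card * ENNReal.ofReal η * ∫⁻ o, ‖g (t o)‖ₑ ^ 2 ∂Q := by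
  have hb := h.measurable_left
  have ht := h.measurable_right
  rcases I.eq_empty_or_nonempty with rfl | hI
  · simp
  have hcg : ∫⁻ o, ‖c o * g (t o)‖ₑ ^ 2 ∂Q ≤ ∫⁻ o, ‖g (t o)‖ₑ ^ 2 ∂Q := by
    refine lintegral_mono fun o => ?_
    gcongr
    rw [enorm_mul]
    refine mul_le_of_le_one_left' ?_
    rw [Real.enorm_eq_ofReal_abs]
    exact ENNReal.ofReal_le_one.2 (hc o)
  -- If `g` is not square-integrable, the bound is infinite because `η > 0` and `I` is nonempty.
  -- Hence nothing is required of the estimated functions that will replace `g`.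
  by_cases htop : ∫⁻ o, ‖g (t o)‖ₑ ^ 2 ∂Q = ⊤
  · rw [htop, ENNReal.mul_top]
    · exact le_top
    · simp [hI.ne_empty, hη]
  have hcL : MemLp (fun o => c o * g (t o)) 2 Q := by
    refine ⟨by fun_prop, ?_⟩
    have := (hcg.trans_lt (lt_top_iff_ne_top.2 htop))
    rw [lintegral_enorm_sq_eq] at this
    exact (ENNReal.pow_lt_top_iff.1 this).resolve_right (by norm_num)
  rw [lintegral_sum_sq_eq hX hind hlaw I (f := fun o => b o * g (t o)) (by fun_prop)
    (h.memLp hg hcL) (h.integral_eq_zero g hg hcL), mul_assoc]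
  gcongr
  exact (h.lintegral_le g hg).trans (by gcongr)

/-- The observations in `I` are independent of those outside `I`. -/
lemma lintegral_train_test (hX : ∀ i, Measurable (X i)) (hind : iIndepFun X P) (I : Finset (Fin n))
    {Φ : ((Iᶜ : Finset (Fin n)) → α) × (I → α) → ℝ≥0∞} (hΦ : Measurable Φ) :
    ∫⁻ s, Φ (fun i => X i s, fun i => X i s) ∂P
      = ∫⁻ s, ∫⁻ s', Φ (fun i => X i s, fun i => X i s') ∂P ∂P :=
  (hind.indepFun_finset _ _ disjoint_compl_left hX).lintegral_eq_lintegral_lintegral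
    (by fun_prop) (by fun_prop) hΦ

variable {L k : ℕ} {J : Ω → Fin n → Fin L}

/-- Cross-fitted first-order terms: products of multipliers with functions estimated from the data
outside the fold. -/
theorem IsMultiplier.lintegral_crossFit_le {η : ℝ} (hη : 0 < η) {c b : α → ℝ} {t : α → E}
    (h : IsMultiplier Q η c b t) (hcm : Measurable c) (hc : ∀ o, |c o| ≤ 1)
    (hX : ∀ i, Measurable (X i)) (hind : iIndepFun X P) (hlaw : ∀ i, P.map (X i) = Q)
    (hJ : Measurable J) (hJX : IndepFun J (fun s i => X i s) P) {l : Fin L}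
    (hcard : ∀ᵐ s ∂P, (fold (J s) l).card = k)
    {γ : (K : Finset (Fin n)) → (K → α) → E → ℝ}
    (hγ : ∀ K : Finset (Fin n), Measurable fun p : (K → α) × E => γ K p.1 p.2) :
    ∫⁻ s, ‖∑ i ∈ fold (J s) l,
        b (X i s) * γ (fold (J s) l)ᶜ (fun i => X i s) (t (X i s))‖ₑ ^ 2 ∂P
      ≤ k * ENNReal.ofReal η
        * ∫⁻ s, ∫⁻ o, ‖γ (fold (J s) l)ᶜ (fun i => X i s) (t o)‖ₑ ^ 2 ∂Q ∂P := by
  have hb := h.measurable_left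
  have ht := h.measurable_right
  by_cases hn : Nonempty (Fin n)
  swap
  · have (s : Ω) : fold (J s) l = ∅ := Finset.eq_empty_of_forall_notMem fun i => (hn ⟨i⟩).elim
    simp [this]
  obtain ⟨i₀⟩ := hn
  have : IsProbabilityMeasure Q :=
    hlaw i₀ ▸ Measure.isProbabilityMeasure_map (hX i₀).aemeasurable
  -- The assignment is independent of the data and has finitely many values, so it may be frozen at
  -- a `j` whose fold has `k` members.
  refine lintegral_le_of_indepFun hJX hJ (by fun_prop) (A := {j | (fold j l).card = k}) hcard
    (Φ := fun j x => ‖∑ i ∈ fold j l, b (x i) * γ (fold j l)ᶜ (fun i => x i) (t (x i))‖ₑ ^ 2)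
    (Ψ := fun j x => ∫⁻ o, ‖γ (fold j l)ᶜ (fun i => x i) (t o)‖ₑ ^ 2 ∂Q)
    (fun j => ?_) (fun j => ?_) (ENNReal.mul_ne_top (by simp) ENNReal.ofReal_ne_top) fun j hj => ?_
  · refine (Measurable.enorm (Finset.measurable_sum _ fun i _ => ?_)).pow_const 2
    exact (hb.comp (measurable_pi_apply i)).mul ((hγ (fold j l)ᶜ).comp
      (f := fun x : Fin n → α => (fun i : ↥(fold j l)ᶜ => x i, t (x i))) (by fun_prop))
  · exact Measurable.lintegral_prod_right' (f := fun p : (Fin n → α) × α =>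
      ‖γ (fold j l)ᶜ (fun i => p.1 i) (t p.2)‖ₑ ^ 2) (((hγ (fold j l)ᶜ).comp
      (f := fun p : (Fin n → α) × α => (fun i : ↥(fold j l)ᶜ => p.1 i, t p.2)) (by fun_prop)).enorm.pow_const 2)
  -- With the data outside the fold held fixed, `γ` is a deterministic function and the fold is a
  -- fresh i.i.d. sample.
  · have e1 := lintegral_train_test hX hind (fold j l)
      (Φ := fun p => ‖∑ i : fold j l, b (p.2 i) * γ (fold j l)ᶜ p.1 (t (p.2 i))‖ₑ ^ 2) (by
        refine (Measurable.enorm (Finset.measurable_sum _ fun i _ => ?_)).pow_const 2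
        exact (hb.comp ((measurable_pi_apply i).comp measurable_snd)).mul ((hγ (fold j l)ᶜ).comp
          (f := fun p : (((fold j l)ᶜ : Finset (Fin n)) → α) × (fold j l → α) => (p.1, t (p.2 i)))
          (by fun_prop)))
    have e2 (s s' : Ω) : ∑ i : fold j l, b (X i s') * γ (fold j l)ᶜ (fun i => X i s) (t (X i s'))
        = ∑ i ∈ fold j l, b (X i s') * γ (fold j l)ᶜ (fun i => X i s) (t (X i s')) :=
      Finset.sum_coe_sort (fold j l)
        fun i => b (X i s') * γ (fold j l)ᶜ (fun i => X i s) (t (X i s'))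
    simp only [e2] at e1
    rw [e1, ← lintegral_const_mul' _ _ (ENNReal.mul_ne_top (by simp) ENNReal.ofReal_ne_top)]
    refine lintegral_mono fun s => ?_
    have e3 := h.lintegral_sum_le hη hcm hc hX hind hlaw (fold j l)
      (g := γ (fold j l)ᶜ fun i => X i s) ((hγ _).comp measurable_prodMk_left)
    rwa [show (fold j l).card = k from hj] at e3

/-- Cross-fitted second-order terms. -/
theorem lintegral_sum_crossFit_le
    (hX : ∀ i, Measurable (X i)) (hind : iIndepFun X P) (hlaw : ∀ i, P.map (X i) = Q)
    (hJ : Measurable J) (hJX : IndepFun J (fun s i => X i s) P) {l : Fin L}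
    (hcard : ∀ᵐ s ∂P, (fold (J s) l).card = k)
    {G : (K : Finset (Fin n)) → (K → α) → α → ℝ≥0∞}
    (hG : ∀ K : Finset (Fin n), Measurable fun p : (K → α) × α => G K p.1 p.2) :
    ∫⁻ s, ∑ i ∈ fold (J s) l, G (fold (J s) l)ᶜ (fun i => X i s) (X i s) ∂P
      ≤ k * ∫⁻ s, ∫⁻ o, G (fold (J s) l)ᶜ (fun i => X i s) o ∂Q ∂P := by
  by_cases hn : Nonempty (Fin n)
  swap
  · have (s : Ω) : fold (J s) l = ∅ := Finset.eq_empty_of_forall_notMem fun i => (hn ⟨i⟩).elim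
    simp [this]
  obtain ⟨i₀⟩ := hn
  have : IsProbabilityMeasure Q :=
    hlaw i₀ ▸ Measure.isProbabilityMeasure_map (hX i₀).aemeasurable
  refine lintegral_le_of_indepFun hJX hJ (by fun_prop) (A := {j | (fold j l).card = k}) hcard
    (Φ := fun j x => ∑ i ∈ fold j l, G (fold j l)ᶜ (fun i => x i) (x i))
    (Ψ := fun j x => ∫⁻ o, G (fold j l)ᶜ (fun i => x i) o ∂Q)
    (fun j => ?_) (fun j => ?_) (by simp) fun j hj => ?_
  · refine Finset.measurable_sum _ fun i _ => ?_
    exact (hG (fold j l)ᶜ).comp (f := fun x : Fin n → α => (fun i : ↥(fold j l)ᶜ => x i, x i)) (by fun_prop)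
  · exact Measurable.lintegral_prod_right' (f := fun p : (Fin n → α) × α =>
      G (fold j l)ᶜ (fun i => p.1 i) p.2) ((hG (fold j l)ᶜ).comp
      (f := fun p : (Fin n → α) × α => (fun i : ↥(fold j l)ᶜ => p.1 i, p.2)) (by fun_prop))
  · have hGm (i : fold j l) : Measurable
        fun p : (((fold j l)ᶜ : Finset (Fin n)) → α) × (fold j l → α) => G (fold j l)ᶜ p.1 (p.2 i) :=
      (hG (fold j l)ᶜ).comp
        (f := fun p : (((fold j l)ᶜ : Finset (Fin n)) → α) × (fold j l → α) => (p.1, p.2 i))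
        (by fun_prop)
    have hGs (i : fold j l) :
        ∫⁻ s, G (fold j l)ᶜ (fun i => X i s) (X i s) ∂P
          = ∫⁻ s, ∫⁻ o, G (fold j l)ᶜ (fun i => X i s) o ∂Q ∂P := by
      rw [lintegral_train_test hX hind (fold j l) (hGm i)]
      refine lintegral_congr fun s => ?_
      rw [← hlaw i]
      exact (lintegral_map ((hG (fold j l)ᶜ).comp measurable_prodMk_left) (hX i)).symm
    have hm (i : Fin n) : Measurable fun s => G (fold j l)ᶜ (fun i => X i s) (X i s) :=
      (hG (fold j l)ᶜ).comp (f := fun s => (fun i : ↥(fold j l)ᶜ => X i s, X i s)) (by fun_prop)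
    rw [lintegral_finsetSum _ fun i _ => hm i, ← Finset.sum_coe_sort (fold j l),
      Finset.sum_congr rfl fun i _ => hGs i]
    simp [show (fold j l).card = k from hj]

end IID

/-! ### Negligible first- and second-order terms. -/

section Negligible

variable {Ω : Type*} [MeasurableSpace Ω] {P : Measure Ω} {w : ℕ → ℝ≥0∞} {f g : ℕ → Ω → ℝ}

/-- The sequence `w k * f k` converges to zero in mean. -/
structure IsNegligible (P : Measure Ω) (w : ℕ → ℝ≥0∞) (f : ℕ → Ω → ℝ) : Prop where
  measurable : ∀ k, Measurable (f k)
  tendsto : Tendsto (fun k => w k * eLpNorm (f k) 1 P) atTop (𝓝 0)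

lemma IsNegligible.add (hf : IsNegligible P w f) (hg : IsNegligible P w g) :
    IsNegligible P w fun k s => f k s + g k s := by
  refine ⟨fun k => (hf.measurable k).add (hg.measurable k), ?_⟩
  have h := hf.tendsto.add hg.tendsto
  rw [add_zero] at h
  refine tendsto_of_tendsto_of_tendsto_of_le_of_le tendsto_const_nhds h (fun _ => zero_le)
    fun k => ?_
  rw [← mul_add]
  gcongr
  exact eLpNorm_add_le (hf.measurable k).aestronglyMeasurable (hg.measurable k).aestronglyMeasurable
    le_rfl

lemma IsNegligible.neg (hf : IsNegligible P w f) : IsNegligible P w fun k s => -f k s := by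
  refine ⟨fun k => (hf.measurable k).neg, ?_⟩
  convert hf.tendsto using 3 with k
  exact eLpNorm_neg (f k) 1 P

lemma IsNegligible.sub (hf : IsNegligible P w f) (hg : IsNegligible P w g) :
    IsNegligible P w fun k s => f k s - g k s := by
  simpa only [sub_eq_add_neg] using hf.add hg.neg

lemma IsNegligible.sum {ι : Type*} {I : Finset ι} {f : ι → ℕ → Ω → ℝ}
    (h : ∀ i ∈ I, IsNegligible P w (f i)) : IsNegligible P w fun k s => ∑ i ∈ I, f i k s := by
  classical
  induction I using Finset.induction_on with
  | empty => exact ⟨fun _ => by simp, by simp⟩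
  | insert i I hi ih =>
    simp only [Finset.sum_insert hi]
    exact (h i (Finset.mem_insert_self i I)).add
      (ih fun j hj => h j (Finset.mem_insert_of_mem hj))

end Negligible

lemma eLpNorm_one_le_of_sq_le {Ω α : Type*} [MeasurableSpace Ω] [MeasurableSpace α]
    {P : Measure Ω} [IsProbabilityMeasure P] {ν : Measure α} {f : Ω → ℝ} (hf : Measurable f)
    {g : α → ℝ} {c : ℝ} (hc : 0 ≤ c)
    (h : ∫⁻ s, ‖f s‖ₑ ^ 2 ∂P ≤ ENNReal.ofReal c * ∫⁻ x, ‖g x‖ₑ ^ 2 ∂ν) :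
    eLpNorm f 1 P ≤ ENNReal.ofReal √c * eLpNorm g 2 ν := by
  refine (eLpNorm_le_eLpNorm_of_exponent_le one_le_two hf.aestronglyMeasurable).trans ?_
  rw [lintegral_enorm_sq_eq, lintegral_enorm_sq_eq, ← Real.sq_sqrt hc,
    ENNReal.ofReal_pow (Real.sqrt_nonneg c), ← mul_pow] at h
  exact (ENNReal.pow_right_strictMono two_ne_zero).le_iff_le.1 h

lemma eLpNorm_mul_le {α : Type*} [MeasurableSpace α] {μ : Measure α} {f g : α → ℝ}
    (hf : Measurable f) (hg : Measurable g) :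
    eLpNorm (fun x => f x * g x) 1 μ ≤ eLpNorm f 2 μ * eLpNorm g 2 μ :=
  eLpNorm_smul_le_mul_eLpNorm (p := 2) (q := 2) (r := 1) (φ := f) (f := g)
    hg.aestronglyMeasurable hf.aestronglyMeasurable

/-- An i.i.d. sample from `Q`, with independent random partitions of the first `L * k` indices into
`L` folds of size `k`. -/
structure IsCrossFitSample {Ω α : Type*} [MeasurableSpace Ω] [MeasurableSpace α] (P : Measure Ω)
    (Q : Measure α) (O : ℕ → Ω → α) (L : ℕ) (J : (k : ℕ) → Ω → Fin (L * k) → Fin L) : Prop where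
  pos : 0 < L
  measurable : ∀ i, Measurable (O i)
  indep : iIndepFun O P
  law : ∀ i, P.map (O i) = Q
  measurable_fold : ∀ k, Measurable (J k)
  card_fold : ∀ k, ∀ᵐ s ∂P, ∀ l, (fold (J k s) l).card = k
  indep_fold : ∀ k, IndepFun (J k) (fun s i => O i s) P

namespace IsCrossFitSample

variable {Ω α E : Type*} [MeasurableSpace Ω] [MeasurableSpace α] [MeasurableSpace E]
  {P : Measure Ω} [IsProbabilityMeasure P] {Q : Measure α}
  {O : ℕ → Ω → α} {L : ℕ} {J : (k : ℕ) → Ω → Fin (L * k) → Fin L}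

omit [IsProbabilityMeasure P] in
lemma iIndepFun_fin (h : IsCrossFitSample P Q O L J) (n : ℕ) :
    iIndepFun (fun i : Fin n => O i) P :=
  h.indep.precomp (g := Fin.val) Fin.val_injective

omit [IsProbabilityMeasure P] in
lemma indep_fold_fin (h : IsCrossFitSample P Q O L J) (k : ℕ) :
    IndepFun (J k) (fun s (i : Fin (L * k)) => O i s) P :=
  (h.indep_fold k).comp measurable_id
    (measurable_pi_lambda (fun (x : ℕ → α) (i : Fin (L * k)) => x i) fun _ => measurable_pi_apply _)

omit [IsProbabilityMeasure P] in
-- Ranges of summation and the type of the training data depend on the assignment; as there are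
-- finitely many assignments, measurability may be checked for each one.
lemma measurable_of_forall_fold (h : IsCrossFitSample P Q O L J) {β δ : Type*} [MeasurableSpace β]
    [MeasurableSpace δ] {k : ℕ} {φ : β → Ω} (hφ : Measurable φ) {X : Type*} [MeasurableSpace X]
    {ξ : β → X} (hξ : Measurable ξ) {Φ : (Fin (L * k) → Fin L) → (Fin (L * k) → α) × X → δ}
    (hΦ : ∀ j, Measurable (Φ j)) :
    Measurable fun b => Φ (J k (φ b)) (fun i => O i (φ b), ξ b) := by
  have hO := h.measurable
  exact (measurable_from_prod_countable_right (f := fun p => Φ p.1 p.2) hΦ).comp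
    (((h.measurable_fold k).comp hφ).prodMk
      ((measurable_pi_lambda _ fun i : Fin (L * k) => (hO i).comp hφ).prodMk hξ))

lemma isProbabilityMeasure (h : IsCrossFitSample P Q O L J) : IsProbabilityMeasure Q :=
  h.law 0 ▸ Measure.isProbabilityMeasure_map (h.measurable 0).aemeasurable

variable {l : Fin L} {α₀ : ℝ}

omit [IsProbabilityMeasure P] in
lemma measurable_estimate (h : IsCrossFitSample P Q O L J) {k : ℕ}
    {γ : (K : Finset (Fin (L * k))) → (K → α) → E → ℝ}
    (hγ : ∀ K : Finset (Fin (L * k)), Measurable fun p : (K → α) × E => γ K p.1 p.2)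
    {t : α → E} (ht : Measurable t) :
    Measurable fun p : Ω × α => γ (fold (J k p.1) l)ᶜ (fun i => O i p.1) (t p.2) := by
  refine h.measurable_of_forall_fold measurable_fst (ξ := fun p => t p.2) (by fun_prop)
    (Φ := fun j p => γ (fold j l)ᶜ (fun i => p.1 i) p.2) fun j => ?_
  exact (hγ (fold j l)ᶜ).comp
    (f := fun p : (Fin (L * k) → α) × E => (fun i : ↥(fold j l)ᶜ => p.1 i, p.2)) (by fun_prop)

omit [IsProbabilityMeasure P] in
lemma measurable_sum_fold (h : IsCrossFitSample P Q O L J) {k : ℕ}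
    {γ : (K : Finset (Fin (L * k))) → (K → α) → α → ℝ}
    (hγ : ∀ K : Finset (Fin (L * k)), Measurable fun p : (K → α) × α => γ K p.1 p.2) :
    Measurable fun s => ∑ i ∈ fold (J k s) l, γ (fold (J k s) l)ᶜ (fun i => O i s) (O i s) := by
  refine h.measurable_of_forall_fold measurable_id (ξ := fun _ => ()) (by fun_prop)
    (Φ := fun j p => ∑ i ∈ fold j l, γ (fold j l)ᶜ (fun i => p.1 i) (p.1 i)) fun j => ?_
  refine Finset.measurable_sum _ fun i _ => (hγ (fold j l)ᶜ).comp
    (f := fun p : (Fin (L * k) → α) × Unit => (fun i : ↥(fold j l)ᶜ => p.1 i, p.1 i)) (by fun_prop)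

/-- First-order terms of the estimation error are negligible. -/
theorem isNegligible_first_order (h : IsCrossFitSample P Q O L J) {η : ℝ} (hη : 0 < η)
    {c b : α → ℝ} {t : α → E} (hmul : IsMultiplier Q η c b t) (hcm : Measurable c)
    (hc : ∀ o, |c o| ≤ 1) {γ : (k : ℕ) → (K : Finset (Fin (L * k))) → (K → α) → E → ℝ}
    (hγ : ∀ k, ∀ K : Finset (Fin (L * k)), Measurable fun p : (K → α) × E => γ k K p.1 p.2)
    {τ : ℝ} (hτ : α₀ ≤ τ)
    (hrate : IsLittleORate L (fun k => eLpNorm (fun p : Ω × α =>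
      γ k (fold (J k p.1) l)ᶜ (fun i => O i p.1) (t p.2)) 2 (P.prod Q)) τ) :
    IsNegligible P (fun k => ENNReal.ofReal (((L * k : ℕ) : ℝ) ^ α₀ / √((L * k : ℕ) : ℝ)))
      fun k s => ∑ i ∈ fold (J k s) l,
        b (O i s) * γ k (fold (J k s) l)ᶜ (fun i => O i s) (t (O i s)) := by
  have := h.isProbabilityMeasure
  have hb := hmul.measurable_left
  have ht := hmul.measurable_right
  have hm (k : ℕ) : Measurable fun s => ∑ i ∈ fold (J k s) l,
        b (O i s) * γ k (fold (J k s) l)ᶜ (fun i => O i s) (t (O i s)) :=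
    h.measurable_sum_fold (γ := fun K x o => b o * γ k K x (t o)) fun K =>
      (hb.comp measurable_snd).mul ((hγ k K).comp (measurable_fst.prodMk (ht.comp measurable_snd)))
  refine ⟨hm, ?_⟩
  have hlim := ENNReal.Tendsto.const_mul (a := ENNReal.ofReal √η) hrate
    (Or.inr ENNReal.ofReal_ne_top)
  rw [mul_zero] at hlim
  refine tendsto_of_tendsto_of_tendsto_of_le_of_le' tendsto_const_nhds hlim
    (Eventually.of_forall fun _ => zero_le) ?_
  filter_upwards [eventually_ge_atTop 1] with k hk
  have hkn : k ≤ L * k := Nat.le_mul_of_pos_left k h.pos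
  have h1n : (1 : ℝ) ≤ (L * k : ℕ) := by exact_mod_cast hk.trans hkn
  have hkn' : (k : ℝ) ≤ (L * k : ℕ) := by exact_mod_cast hkn
  have h1 := hmul.lintegral_crossFit_le hη hcm hc (fun i : Fin (L * k) => h.measurable i)
    (h.iIndepFun_fin _) (fun i => h.law i) (h.measurable_fold k) (h.indep_fold_fin k) (l := l)
    ((h.card_fold k).mono fun s hs => hs l) (hγ k)
  have hmeas := h.measurable_estimate (l := l) (hγ k) ht
  rw [← lintegral_prod (fun p : Ω × α =>
      ‖γ k (fold (J k p.1) l)ᶜ (fun i => O i p.1) (t p.2)‖ₑ ^ 2) (by fun_prop),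
    ← ENNReal.ofReal_natCast, ← ENNReal.ofReal_mul (by positivity)] at h1
  have h2 := eLpNorm_one_le_of_sq_le (hm k) (by positivity) h1
  refine (mul_le_mul_right h2 _).trans ?_
  rw [← mul_assoc, ← mul_assoc, ← ENNReal.ofReal_mul (by positivity),
    ← ENNReal.ofReal_mul (by positivity)]
  -- With `n = L k`, the factor `√k` from the second moment cancels against `1 / √n`, and `n ^ α₀ ≤
  -- n ^ τ` because `n ≥ 1`.
  refine mul_le_mul' (ENNReal.ofReal_le_ofReal ?_) le_rfl
  rw [Real.sqrt_mul (by positivity), div_mul_eq_mul_div, div_le_iff₀ (by positivity)]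
  have h3 : ((L * k : ℕ) : ℝ) ^ α₀ ≤ ((L * k : ℕ) : ℝ) ^ τ := Real.rpow_le_rpow_of_exponent_le h1n hτ
  have h4 : √(k : ℝ) ≤ √((L * k : ℕ) : ℝ) := Real.sqrt_le_sqrt hkn'
  calc ((L * k : ℕ) : ℝ) ^ α₀ * (√(k : ℝ) * √η)
      ≤ ((L * k : ℕ) : ℝ) ^ τ * (√((L * k : ℕ) : ℝ) * √η) := by gcongr
    _ = _ := by ring

/-- Second-order terms of the estimation error are negligible. -/
theorem isNegligible_second_order (h : IsCrossFitSample P Q O L J) {b : α → ℝ} (hb : Measurable b)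
    (hb1 : ∀ o, |b o| ≤ 1) {γ δ : (k : ℕ) → (K : Finset (Fin (L * k))) → (K → α) → α → ℝ}
    (hγ : ∀ k, ∀ K : Finset (Fin (L * k)), Measurable fun p : (K → α) × α => γ k K p.1 p.2)
    (hδ : ∀ k, ∀ K : Finset (Fin (L * k)), Measurable fun p : (K → α) × α => δ k K p.1 p.2)
    {τ τ' : ℝ} (hτ : α₀ ≤ τ + τ' - 1 / 2)
    (hrate : IsLittleORate L (fun k => eLpNorm (fun p : Ω × α =>
      γ k (fold (J k p.1) l)ᶜ (fun i => O i p.1) p.2) 2 (P.prod Q)) τ)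
    (hrate' : IsLittleORate L (fun k => eLpNorm (fun p : Ω × α =>
      δ k (fold (J k p.1) l)ᶜ (fun i => O i p.1) p.2) 2 (P.prod Q)) τ') :
    IsNegligible P (fun k => ENNReal.ofReal (((L * k : ℕ) : ℝ) ^ α₀ / √((L * k : ℕ) : ℝ)))
      fun k s => ∑ i ∈ fold (J k s) l, b (O i s) * (γ k (fold (J k s) l)ᶜ (fun i => O i s) (O i s)
        * δ k (fold (J k s) l)ᶜ (fun i => O i s) (O i s)) := by
  have := h.isProbabilityMeasure
  have hm (k : ℕ) : Measurable fun s => ∑ i ∈ fold (J k s) l,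
        b (O i s) * (γ k (fold (J k s) l)ᶜ (fun i => O i s) (O i s)
          * δ k (fold (J k s) l)ᶜ (fun i => O i s) (O i s)) :=
    h.measurable_sum_fold (γ := fun K x o => b o * (γ k K x o * δ k K x o)) fun K =>
      (hb.comp measurable_snd).mul ((hγ k K).mul (hδ k K))
  refine ⟨hm, ?_⟩
  have hlim := ENNReal.Tendsto.mul hrate (Or.inr ENNReal.zero_ne_top) hrate'
    (Or.inr ENNReal.zero_ne_top)
  rw [mul_zero] at hlim
  refine tendsto_of_tendsto_of_tendsto_of_le_of_le' tendsto_const_nhds hlim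
    (Eventually.of_forall fun _ => zero_le) ?_
  filter_upwards [eventually_ge_atTop 1] with k hk
  have hkn : k ≤ L * k := Nat.le_mul_of_pos_left k h.pos
  have h1n : (1 : ℝ) ≤ (L * k : ℕ) := by exact_mod_cast hk.trans hkn
  have hkn' : (k : ℝ) ≤ (L * k : ℕ) := by exact_mod_cast hkn
  have hmγ := h.measurable_estimate (l := l) (hγ k) measurable_id
  have hmδ := h.measurable_estimate (l := l) (hδ k) measurable_id
  set r := eLpNorm (fun p : Ω × α =>
      γ k (fold (J k p.1) l)ᶜ (fun i => O i p.1) p.2) 2 (P.prod Q)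
  set r' := eLpNorm (fun p : Ω × α =>
      δ k (fold (J k p.1) l)ᶜ (fun i => O i p.1) p.2) 2 (P.prod Q)
  have h1 : eLpNorm (fun s => ∑ i ∈ fold (J k s) l,
        b (O i s) * (γ k (fold (J k s) l)ᶜ (fun i => O i s) (O i s)
          * δ k (fold (J k s) l)ᶜ (fun i => O i s) (O i s))) 1 P ≤ k * (r * r') := by
    have e1 := lintegral_sum_crossFit_le (fun i : Fin (L * k) => h.measurable i)
      (h.iIndepFun_fin _) (fun i => h.law i) (h.measurable_fold k) (h.indep_fold_fin k) (l := l)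
      ((h.card_fold k).mono fun s hs => hs l) (G := fun K x o => ‖γ k K x o * δ k K x o‖ₑ)
      fun K => ((hγ k K).mul (hδ k K)).enorm
    rw [eLpNorm_one_eq_lintegral_enorm]
    refine (lintegral_mono fun s => ?_).trans (e1.trans ?_)
    · refine (enorm_sum_le _ _).trans (Finset.sum_le_sum fun i _ => ?_)
      rw [enorm_mul]
      refine mul_le_of_le_one_left' ?_
      rw [Real.enorm_eq_ofReal_abs]
      exact ENNReal.ofReal_le_one.2 (hb1 _)
    · refine mul_le_mul' le_rfl ?_
      rw [← lintegral_prod (fun p : Ω × α => ‖γ k (fold (J k p.1) l)ᶜ (fun i => O i p.1) p.2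
        * δ k (fold (J k p.1) l)ᶜ (fun i => O i p.1) p.2‖ₑ) (hmγ.mul hmδ).enorm.aemeasurable,
        ← eLpNorm_one_eq_lintegral_enorm]
      exact eLpNorm_mul_le hmγ hmδ
  refine (mul_le_mul_right h1 _).trans ?_
  rw [mul_mul_mul_comm (ENNReal.ofReal (_ ^ τ)), ← mul_assoc, ← ENNReal.ofReal_natCast,
    ← ENNReal.ofReal_mul (by positivity),
    ← ENNReal.ofReal_mul (by positivity)]
  -- Products are not centred: the factor is `k` instead of `√k`, and after division by `√n` a loss
  -- of `n ^ (1/2)` remains. This is the `1 / 2` in the exponents of `alpha`.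
  refine mul_le_mul' (ENNReal.ofReal_le_ofReal ?_) le_rfl
  rw [← Real.rpow_add (by positivity), div_mul_eq_mul_div, div_le_iff₀ (by positivity),
    Real.sqrt_eq_rpow, ← Real.rpow_add (by positivity)]
  calc ((L * k : ℕ) : ℝ) ^ α₀ * (k : ℝ) ≤ ((L * k : ℕ) : ℝ) ^ α₀ * ((L * k : ℕ) : ℝ) ^ (1 : ℝ) := by
        rw [Real.rpow_one]; gcongr
    _ = ((L * k : ℕ) : ℝ) ^ (α₀ + 1) := (Real.rpow_add (by positivity) _ _).symm
    _ ≤ _ := Real.rpow_le_rpow_of_exponent_le h1n (by linarith)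

end IsCrossFitSample

/-! ### Expansion of the score and the remainder. -/

section Expansion

variable {𝓜 𝓓 𝓩 𝓦 𝓧 : Type*}

/-- The expansion of the score: a sum of first-order terms and of products of two errors. -/
lemma Nuisance.score_sub_score (ξ ζ : Nuisance 𝓜 𝓓 𝓩 𝓦 𝓧) (o : Obs 𝓜 𝓓 𝓩 𝓦 𝓧) :
    ξ.score o - ζ.score o
      = ζ.residual₀ o * (ξ.evalQ₀ o - ζ.evalQ₀ o) + ζ.residual₁ o * (ξ.evalQ₁ o - ζ.evalQ₁ o)
        + ζ.residual₂ o * (ξ.evalQ₂ o - ζ.evalQ₂ o) - ζ.balance₀ o * (ξ.evalH₀ o - ζ.evalH₀ o)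
        - ζ.balance₁ o * (ξ.evalH₁ o - ζ.evalH₁ o) - ζ.balance₂ o * (ξ.evalH₂ o - ζ.evalH₂ o)
        + o.a * ((ξ.evalH₁ o - ζ.evalH₁ o) * (ξ.evalQ₀ o - ζ.evalQ₀ o))
        - o.a * ((ξ.evalH₀ o - ζ.evalH₀ o) * (ξ.evalQ₀ o - ζ.evalQ₀ o))
        + (1 - o.a) * ((ξ.evalH₂ o - ζ.evalH₂ o) * (ξ.evalQ₁ o - ζ.evalQ₁ o))
        - (1 - o.a) * ((ξ.evalH₁ o - ζ.evalH₁ o) * (ξ.evalQ₁ o - ζ.evalQ₁ o))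
        - o.a * ((ξ.evalH₂ o - ζ.evalH₂ o) * (ξ.evalQ₂ o - ζ.evalQ₂ o)) := by
  simp only [score, residual₀, residual₁, residual₂, balance₀, balance₁, balance₂]
  ring

lemma Obs.abs_a_le (o : Obs 𝓜 𝓓 𝓩 𝓦 𝓧) : |o.a| ≤ 1 := by
  unfold Obs.a; split_ifs <;> simp

lemma Obs.abs_one_sub_a_le (o : Obs 𝓜 𝓓 𝓩 𝓦 𝓧) : |1 - o.a| ≤ 1 := by
  unfold Obs.a; split_ifs <;> simp

/-- The remainder of the linear expansion of the estimator. -/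
lemma scaledError_sub_leadingTerm (learn : Learner 𝓜 𝓓 𝓩 𝓦 𝓧) (ζ : Nuisance 𝓜 𝓓 𝓩 𝓦 𝓧) (ψ : ℝ)
    {n L : ℕ} (hL : 0 < L) (J : Fin n → Fin L) (o : Fin n → Obs 𝓜 𝓓 𝓩 𝓦 𝓧) :
    scaledError learn ψ J o - leadingTerm ζ ψ o
      = 1 / √(n : ℝ) * ∑ l, ∑ i ∈ fold J l, ((crossFit learn J o l).score (o i) - ζ.score (o i)) := by
  have hsum : ∑ l, ∑ i ∈ fold J l, ζ.score (o i) = ∑ i, ζ.score (o i) :=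
    Finset.sum_fiberwise _ _ _
  have heif : ∑ i, ζ.eif ψ (o i) = ∑ i, ζ.score (o i) - n * ψ := by
    have (i : Fin n) : ζ.eif ψ (o i) = ζ.score (o i) - ψ := rfl
    simp [this]
  simp only [Finset.sum_sub_distrib]
  rw [hsum, leadingTerm, heif, scaledError, dmlEstimator]
  simp only [foldEstimator, ← Finset.mul_sum]
  have hL' : (L : ℝ) ≠ 0 := by exact_mod_cast hL.ne'
  rcases Nat.eq_zero_or_pos n with rfl | hn
  · simp
  have hn' : (0 : ℝ) < n := by exact_mod_cast hn
  have hs : √(n : ℝ) ≠ 0 := (Real.sqrt_pos.2 hn').ne'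
  have hsq : √(n : ℝ) ^ 2 = n := Real.sq_sqrt hn'.le
  field_simp
  rw [hsq]
  ring

end Expansion

section Remainder

variable {Ω 𝓜 𝓓 𝓩 𝓦 𝓧 : Type*} [MeasurableSpace Ω] [MeasurableSpace 𝓜] [MeasurableSpace 𝓓]
  [MeasurableSpace 𝓩] [MeasurableSpace 𝓦] [MeasurableSpace 𝓧] {P : Measure Ω}
  [IsProbabilityMeasure P] {Q : Measure (Obs 𝓜 𝓓 𝓩 𝓦 𝓧)} {O : ℕ → Ω → Obs 𝓜 𝓓 𝓩 𝓦 𝓧} {L : ℕ}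
  {J : (k : ℕ) → Ω → Fin (L * k) → Fin L} {ζ : Nuisance 𝓜 𝓓 𝓩 𝓦 𝓧} {η : ℝ}
  {learn : Learner 𝓜 𝓓 𝓩 𝓦 𝓧} {τ : Rates} {α₀ : ℝ}

/-- The six single exponents in `Rates.alpha` control the first-order terms, and its five pair sums
control the products of errors that occur in the score. -/
theorem IsCrossFitSample.isNegligible_fold_remainder (h : IsCrossFitSample P Q O L J) (hη : 0 < η)
    (hbal : ζ.IsBalanced Q η) (hζ : ζ.IsMeasurable) (hlearn : learn.IsMeasurable)
    (hrate : HasRates P Q L (fun k l s => crossFit learn (J k s) (fun i => O i s) l) ζ τ)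
    (hα : α₀ ≤ τ.alpha) (l : Fin L) :
    IsNegligible P (fun k => ENNReal.ofReal (((L * k : ℕ) : ℝ) ^ α₀ / √((L * k : ℕ) : ℝ)))
      fun k s => ∑ i ∈ fold (J k s) l,
        ((crossFit learn (J k s) (fun i => O i s) l).score (O i s) - ζ.score (O i s)) := by
  simp only [Rates.alpha, le_min_iff] at hα
  obtain ⟨a1, a2, a3, a4, a5, a6, b1, b2, b3, b4, b5⟩ := hα
  have ha : Measurable (Obs.a : Obs 𝓜 𝓓 𝓩 𝓦 𝓧 → ℝ) := Obs.measurable_a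
  have ha' : Measurable fun o : Obs 𝓜 𝓓 𝓩 𝓦 𝓧 => 1 - o.a := measurable_const.sub ha
  have one_le (o : Obs 𝓜 𝓓 𝓩 𝓦 𝓧) : |(1 : Obs 𝓜 𝓓 𝓩 𝓦 𝓧 → ℝ) o| ≤ 1 := by simp
  have m2 (k : ℕ) (K : Finset (Fin (L * k))) := (hlearn.h₂ (L * k) K).sub (hζ.h₂.comp measurable_snd)
  have m1 (k : ℕ) (K : Finset (Fin (L * k))) := (hlearn.h₁ (L * k) K).sub (hζ.h₁.comp measurable_snd)
  have m0 (k : ℕ) (K : Finset (Fin (L * k))) := (hlearn.h₀ (L * k) K).sub (hζ.h₀.comp measurable_snd)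
  have p2 (k : ℕ) (K : Finset (Fin (L * k))) := (hlearn.q₂ (L * k) K).sub (hζ.q₂.comp measurable_snd)
  have p1 (k : ℕ) (K : Finset (Fin (L * k))) := (hlearn.q₁ (L * k) K).sub (hζ.q₁.comp measurable_snd)
  have p0 (k : ℕ) (K : Finset (Fin (L * k))) := (hlearn.q₀ (L * k) K).sub (hζ.q₀.comp measurable_snd)
  have t2 := Obs.measurable_wmdx (𝓜 := 𝓜) (𝓓 := 𝓓) (𝓩 := 𝓩) (𝓦 := 𝓦) (𝓧 := 𝓧)
  have t1 := Obs.measurable_wdx (𝓜 := 𝓜) (𝓓 := 𝓓) (𝓩 := 𝓩) (𝓦 := 𝓦) (𝓧 := 𝓧)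
  have t0 := Obs.measurable_wx (𝓜 := 𝓜) (𝓓 := 𝓓) (𝓩 := 𝓩) (𝓦 := 𝓦) (𝓧 := 𝓧)
  have u2 := Obs.measurable_zmdx (𝓜 := 𝓜) (𝓓 := 𝓓) (𝓩 := 𝓩) (𝓦 := 𝓦) (𝓧 := 𝓧)
  have u1 := Obs.measurable_zdx (𝓜 := 𝓜) (𝓓 := 𝓓) (𝓩 := 𝓩) (𝓦 := 𝓦) (𝓧 := 𝓧)
  have u0 := Obs.measurable_zx (𝓜 := 𝓜) (𝓓 := 𝓓) (𝓩 := 𝓩) (𝓦 := 𝓦) (𝓧 := 𝓧)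
  have f1 := h.isNegligible_first_order hη hbal.residual₀ ha Obs.abs_a_le
    (γ := fun k K x e => (learn (L * k) K x).q₀ e - ζ.q₀ e) p0 a6 (hrate.q₀ l)
  have f2 := h.isNegligible_first_order hη hbal.residual₁ ha' Obs.abs_one_sub_a_le
    (γ := fun k K x e => (learn (L * k) K x).q₁ e - ζ.q₁ e) p1 a5 (hrate.q₁ l)
  have f3 := h.isNegligible_first_order hη hbal.residual₂ ha Obs.abs_a_le
    (γ := fun k K x e => (learn (L * k) K x).q₂ e - ζ.q₂ e) p2 a4 (hrate.q₂ l)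
  have f4 := h.isNegligible_first_order hη hbal.balance₀ measurable_one one_le
    (γ := fun k K x e => (learn (L * k) K x).h₀ e - ζ.h₀ e) m0 a3 (hrate.h₀ l)
  have f5 := h.isNegligible_first_order hη hbal.balance₁ measurable_one one_le
    (γ := fun k K x e => (learn (L * k) K x).h₁ e - ζ.h₁ e) m1 a2 (hrate.h₁ l)
  have f6 := h.isNegligible_first_order hη hbal.balance₂ measurable_one one_le
    (γ := fun k K x e => (learn (L * k) K x).h₂ e - ζ.h₂ e) m2 a1 (hrate.h₂ l)
  have M2 (k : ℕ) (K : Finset (Fin (L * k))) :=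
    (m2 k K).comp (measurable_fst.prodMk (t2.comp measurable_snd))
  have M1 (k : ℕ) (K : Finset (Fin (L * k))) :=
    (m1 k K).comp (measurable_fst.prodMk (t1.comp measurable_snd))
  have M0 (k : ℕ) (K : Finset (Fin (L * k))) :=
    (m0 k K).comp (measurable_fst.prodMk (t0.comp measurable_snd))
  have N2 (k : ℕ) (K : Finset (Fin (L * k))) :=
    (p2 k K).comp (measurable_fst.prodMk (u2.comp measurable_snd))
  have N1 (k : ℕ) (K : Finset (Fin (L * k))) :=
    (p1 k K).comp (measurable_fst.prodMk (u1.comp measurable_snd))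
  have N0 (k : ℕ) (K : Finset (Fin (L * k))) :=
    (p0 k K).comp (measurable_fst.prodMk (u0.comp measurable_snd))
  have s1 := h.isNegligible_second_order ha Obs.abs_a_le
    (γ := fun k K x o => (learn (L * k) K x).evalH₁ o - ζ.evalH₁ o)
    (δ := fun k K x o => (learn (L * k) K x).evalQ₀ o - ζ.evalQ₀ o)
    M1 N0 b3 (hrate.h₁ l) (hrate.q₀ l)
  have s2 := h.isNegligible_second_order ha Obs.abs_a_le
    (γ := fun k K x o => (learn (L * k) K x).evalH₀ o - ζ.evalH₀ o)
    (δ := fun k K x o => (learn (L * k) K x).evalQ₀ o - ζ.evalQ₀ o)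
    M0 N0 b5 (hrate.h₀ l) (hrate.q₀ l)
  have s3 := h.isNegligible_second_order ha' Obs.abs_one_sub_a_le
    (γ := fun k K x o => (learn (L * k) K x).evalH₂ o - ζ.evalH₂ o)
    (δ := fun k K x o => (learn (L * k) K x).evalQ₁ o - ζ.evalQ₁ o)
    M2 N1 b2 (hrate.h₂ l) (hrate.q₁ l)
  have s4 := h.isNegligible_second_order ha' Obs.abs_one_sub_a_le
    (γ := fun k K x o => (learn (L * k) K x).evalH₁ o - ζ.evalH₁ o)
    (δ := fun k K x o => (learn (L * k) K x).evalQ₁ o - ζ.evalQ₁ o)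
    M1 N1 b4 (hrate.h₁ l) (hrate.q₁ l)
  have s5 := h.isNegligible_second_order ha Obs.abs_a_le
    (γ := fun k K x o => (learn (L * k) K x).evalH₂ o - ζ.evalH₂ o)
    (δ := fun k K x o => (learn (L * k) K x).evalQ₂ o - ζ.evalQ₂ o)
    M2 N2 b1 (hrate.h₂ l) (hrate.q₂ l)
  have key := (((((((((f1.add f2).add f3).sub f4).sub f5).sub f6).add s1).sub s2).add s3).sub
    s4).sub s5
  simp only [← Finset.sum_add_distrib, ← Finset.sum_sub_distrib] at key
  simp only [Nuisance.score_sub_score]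
  exact key

/-- The remainder of the linear expansion, multiplied by `n ^ α₀`, tends to zero in probability. -/
theorem IsCrossFitSample.tendstoInMeasure_remainder (h : IsCrossFitSample P Q O L J) (hη : 0 < η)
    (hbal : ζ.IsBalanced Q η) (hζ : ζ.IsMeasurable) (hlearn : learn.IsMeasurable)
    (hrate : HasRates P Q L (fun k l s => crossFit learn (J k s) (fun i => O i s) l) ζ τ)
    (hα : α₀ ≤ τ.alpha) (ψ : ℝ) :
    (∀ k, Measurable fun s => scaledError learn ψ (J k s) (fun i => O i s)
      - leadingTerm ζ ψ (fun i : Fin (L * k) => O i s)) ∧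
    TendstoInMeasure P (fun k s => (scaledError learn ψ (J k s) (fun i => O i s)
        - leadingTerm ζ ψ (fun i : Fin (L * k) => O i s)) / ((L * k : ℕ) : ℝ) ^ (-α₀))
      atTop (fun _ => 0) := by
  have hneg := IsNegligible.sum (I := Finset.univ) fun l _ =>
    h.isNegligible_fold_remainder hη hbal hζ hlearn hrate hα l
  have hm (k : ℕ) : Measurable fun s => scaledError learn ψ (J k s) (fun i => O i s)
      - leadingTerm ζ ψ (fun i : Fin (L * k) => O i s) := by
    simp only [scaledError_sub_leadingTerm learn ζ ψ h.pos]
    exact (hneg.measurable k).const_mul _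
  -- The weight `n ^ α₀ / √n` in `IsNegligible` already contains the factor `1 / √n` of the
  -- remainder, so convergence in mean is what `hneg` states.
  refine ⟨hm, tendstoInMeasure_of_tendsto_eLpNorm one_ne_zero
    (fun k => ((hm k).div_const _).aestronglyMeasurable) aestronglyMeasurable_const ?_⟩
  convert hneg.tendsto using 2 with k
  have hn : (0 : ℝ) ≤ (L * k : ℕ) := Nat.cast_nonneg _
  have hc : 0 ≤ ((L * k : ℕ) : ℝ) ^ α₀ / √((L * k : ℕ) : ℝ) := by positivity
  rw [← Real.enorm_of_nonneg hc, ← eLpNorm_const_smul]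
  congr 1
  ext s
  simp only [Pi.sub_apply, Pi.smul_apply, sub_zero, smul_eq_mul,
    scaledError_sub_leadingTerm learn ζ ψ h.pos, Real.rpow_neg hn]
  rw [div_inv_eq_mul]
  ring

end Remainder

/-! ### Exponents, fold sizes, and boundedness in probability. -/

lemma Rates.alpha_nonneg {τ : Rates} (hτ : τ.Positive) (h : 1 / 2 ≤ τ.pairwise) : 0 ≤ τ.alpha := by
  simp only [Rates.pairwise, le_min_iff] at h
  obtain ⟨h1, h2, h3, h4, h5⟩ := h
  simp only [Rates.alpha, le_min_iff]
  exact ⟨hτ.h₂.le, hτ.h₁.le, hτ.h₀.le, hτ.q₂.le, hτ.q₁.le, hτ.q₀.le, by linarith, by linarith,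
    by linarith, by linarith, by linarith⟩

lemma ae_card_fold {Ω : Type*} [MeasurableSpace Ω] {P : Measure Ω} {L k : ℕ}
    {J : Ω → Fin (L * k) → Fin L} (hJ : Measurable J)
    (hlaw : P.map J = uniformOn (balancedAssignments L k)) :
    ∀ᵐ s ∂P, ∀ l, (fold (J s) l).card = k := by
  have h : ∀ᵐ j ∂P.map J, j ∈ balancedAssignments L k := by
    rw [hlaw]
    exact ae_cond_mem (Set.toFinite _).measurableSet
  exact ae_of_ae_map hJ.aemeasurable h

/-- A sequence is bounded in probability if it differs by a null sequence from one with bounded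
second moments. -/
lemma isBigOpOne_of_sub {Ω : Type*} [MeasurableSpace Ω] {P : Measure Ω} {R S : ℕ → Ω → ℝ}
    (hS : ∀ k, Measurable (S k)) {V : ℝ≥0∞} (hV : V ≠ ⊤) (hle : ∀ k, ∫⁻ s, ‖S k s‖ₑ ^ 2 ∂P ≤ V)
    (hRS : TendstoInMeasure P (fun k s => R k s - S k s) atTop fun _ => 0) : IsBigOpOne P R := by
  intro ε hε
  have hε2 : ε / 2 ≠ 0 := (ENNReal.half_pos hε.ne').ne'
  -- Markov's inequality for the square at level `m`: as `m ≥ 1`, `m < |S|` implies `m ≤ S ^ 2`, so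
  -- the probability is at most `V / m`.
  obtain ⟨m, hm⟩ := ENNReal.exists_nat_mul_gt hε2 hV
  have hm0 : m ≠ 0 := by
    rintro rfl
    simp at hm
  have h1 (k : ℕ) : P {s | (m : ℝ) < |S k s|} ≤ ε / 2 := by
    have hsub : {s | (m : ℝ) < |S k s|} ⊆ {s | (m : ℝ≥0∞) ≤ ‖S k s‖ₑ ^ 2} := by
      intro s hs
      have h2 : (m : ℝ≥0∞) ≤ ‖S k s‖ₑ := by
        rw [Real.enorm_eq_ofReal_abs, ← ENNReal.ofReal_natCast]
        exact ENNReal.ofReal_le_ofReal (le_of_lt hs)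
      have h3 : (1 : ℝ≥0∞) ≤ m := by exact_mod_cast Nat.one_le_iff_ne_zero.2 hm0
      exact h2.trans (le_self_pow₀ (h3.trans h2) two_ne_zero)
    have h4 := (mul_meas_ge_le_lintegral (((hS k).enorm).pow_const 2) (m : ℝ≥0∞)).trans (hle k)
    have h5 : (m : ℝ≥0∞) * P {s | (m : ℝ) < |S k s|} ≤ m * (ε / 2) :=
      (mul_le_mul' le_rfl (measure_mono hsub)).trans (h4.trans hm.le)
    exact (ENNReal.mul_le_mul_iff_right (by simpa using hm0) (by simp)).1 h5
  -- The additional `1` leaves room for the null sequence `R - S`.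
  refine ⟨m + 1, ?_⟩
  have h2 := (ENNReal.tendsto_nhds_zero.1 (hRS 1 one_pos)) (ε / 2) (pos_iff_ne_zero.2 hε2)
  filter_upwards [h2] with k hk
  have hsub : {s | (m : ℝ) + 1 < |R k s|}
      ⊆ {s | (m : ℝ) < |S k s|} ∪ {s | 1 ≤ edist (R k s - S k s) 0} := by
    intro s hs
    by_contra hcon
    simp only [Set.mem_union, Set.mem_ofPred_eq, not_or, not_lt, not_le] at hcon hs
    obtain ⟨c1, c2⟩ := hcon
    rw [edist_dist, ← ENNReal.ofReal_one, ENNReal.ofReal_lt_ofReal_iff one_pos, Real.dist_eq,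
      sub_zero] at c2
    have := abs_sub_abs_le_abs_sub (R k s) (S k s)
    linarith
  calc P {s | (m : ℝ) + 1 < |R k s|} ≤ _ := measure_mono hsub
    _ ≤ ε / 2 + ε / 2 := (measure_union_le _ _).trans (add_le_add (h1 k) hk)
    _ = ε := ENNReal.add_halves ε

/-! ### The leading term and its central limit theorem. -/

section LeadingTerm

variable {Ω 𝓜 𝓓 𝓩 𝓦 𝓧 : Type*} [MeasurableSpace Ω] [MeasurableSpace 𝓜] [MeasurableSpace 𝓓]
  [MeasurableSpace 𝓩] [MeasurableSpace 𝓦] [MeasurableSpace 𝓧] {P : Measure Ω}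
  {Q : Measure (Obs 𝓜 𝓓 𝓩 𝓦 𝓧)} {O : ℕ → Ω → Obs 𝓜 𝓓 𝓩 𝓦 𝓧}
  {ζ : Nuisance 𝓜 𝓓 𝓩 𝓦 𝓧} {ψ : ℝ}

lemma Nuisance.IsMeasurable.eif (h : ζ.IsMeasurable) : Measurable (ζ.eif ψ) := by
  rw [show ζ.eif ψ = _ from funext (ζ.eif_eq ψ)]
  exact (((h.residual₀.mul h.evalQ₀).add (h.residual₁.mul h.evalQ₁)).add
    (h.residual₂.mul h.evalQ₂)).add (h.evalH₀.sub_const ψ)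

lemma measurable_leadingTerm (h : ζ.IsMeasurable) (hO : ∀ i, Measurable (O i)) (n : ℕ) :
    Measurable fun s => leadingTerm ζ ψ (fun i : Fin n => O i s) :=
  (Finset.measurable_sum (f := fun (i : Fin n) s => ζ.eif ψ (O i s)) _
    fun i _ => h.eif.comp (hO i)).const_mul _

variable [IsProbabilityMeasure P]

lemma lintegral_leadingTerm_sq_le (h : ζ.IsMeasurable) (hO : ∀ i, Measurable (O i))
    (hind : iIndepFun O P) (hlaw : ∀ i, P.map (O i) = Q) (hL : MemLp (ζ.eif ψ) 2 Q)
    (h0 : ∫ o, ζ.eif ψ o ∂Q = 0) (n : ℕ) :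
    ∫⁻ s, ‖leadingTerm ζ ψ (fun i : Fin n => O i s)‖ₑ ^ 2 ∂P ≤ ∫⁻ o, ‖ζ.eif ψ o‖ₑ ^ 2 ∂Q := by
  rcases Nat.eq_zero_or_pos n with rfl | hn
  · simp [leadingTerm]
  have hn' : (0 : ℝ) < n := by exact_mod_cast hn
  have hm : Measurable fun s => ∑ i : Fin n, ζ.eif ψ (O i s) :=
    Finset.measurable_sum _ fun i _ => h.eif.comp (hO i)
  have e := lintegral_sum_sq_eq (fun i : Fin n => hO i)
    (hind.precomp (g := Fin.val) Fin.val_injective) (fun i => hlaw i) Finset.univ h.eif hL h0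
  simp only [leadingTerm, enorm_mul, mul_pow]
  rw [lintegral_const_mul _ (by fun_prop), e, ← mul_assoc, Finset.card_univ, Fintype.card_fin,
    Real.enorm_of_nonneg (by positivity), ← ENNReal.ofReal_pow (by positivity), div_pow,
    Real.sq_sqrt hn'.le, ← ENNReal.ofReal_natCast, ← ENNReal.ofReal_mul (by positivity)]
  simp [hn'.ne']

/-- The central limit theorem for the leading term. -/
lemma tendstoInDistribution_leadingTerm (h : ζ.IsMeasurable) (hO : ∀ i, Measurable (O i))
    (hind : iIndepFun O P) (hlaw : ∀ i, P.map (O i) = Q) (hL : MemLp (ζ.eif ψ) 2 Q)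
    (h0 : ∫ o, ζ.eif ψ o ∂Q = 0) :
    TendstoInDistribution (fun n s => leadingTerm ζ ψ (fun i : Fin n => O i s)) atTop (id : ℝ → ℝ)
      (fun _ => P) (gaussianReal 0 (Real.toNNReal (∫ o, ζ.eif ψ o ^ 2 ∂Q))) := by
  have hmp (i : ℕ) : MeasurePreserving (O i) P Q := ⟨hO i, hlaw i⟩
  have hmean : ∫ s, ζ.eif ψ (O 0 s) ∂P = 0 := by
    rw [← integral_map (hO 0).aemeasurable h.eif.aestronglyMeasurable, hlaw, h0]
  have hvar : Var[fun s => ζ.eif ψ (O 0 s); P] = ∫ o, ζ.eif ψ o ^ 2 ∂Q := by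
    rw [variance_of_integral_eq_zero (X := fun s => ζ.eif ψ (O 0 s))
      (h.eif.comp (hO 0)).aemeasurable hmean, ← hlaw 0,
      integral_map (hO 0).aemeasurable (h.eif.pow_const 2).aestronglyMeasurable]
  have hid : HasLaw (id : ℝ → ℝ)
      (gaussianReal 0 Var[fun s => ζ.eif ψ (O 0 s); P].toNNReal)
      (gaussianReal 0 (Real.toNNReal (∫ o, ζ.eif ψ o ^ 2 ∂Q))) := by
    rw [hvar]
    exact HasLaw.id
  have key := tendstoInDistribution_inv_sqrt_mul_sum_sub (X := fun i s => ζ.eif ψ (O i s)) hid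
    (hL.comp_measurePreserving (hmp 0)) (hind.comp (fun _ => ζ.eif ψ) fun _ => h.eif)
    fun i => (IdentDistrib.mk (hO i).aemeasurable (hO 0).aemeasurable
      ((hlaw i).trans (hlaw 0).symm)).comp h.eif
  convert key using 3 with n s
  rw [leadingTerm, hmean, mul_zero, sub_zero, one_div, Finset.sum_range]

end LeadingTerm

/-! ### Assembly. -/

theorem theorem7
    {Ω Ω' 𝓤 𝓜 𝓓 𝓩 𝓦 𝓧 : Type*}
    [MeasurableSpace Ω] [StandardBorelSpace Ω] [MeasurableSpace Ω']
    [MeasurableSpace 𝓤] [StandardBorelSpace 𝓤] [MeasurableSpace 𝓜] [StandardBorelSpace 𝓜]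
    [MeasurableSpace 𝓓] [StandardBorelSpace 𝓓] [MeasurableSpace 𝓩] [StandardBorelSpace 𝓩]
    [MeasurableSpace 𝓦] [StandardBorelSpace 𝓦] [MeasurableSpace 𝓧] [StandardBorelSpace 𝓧]
    -- the causal model of one unit, and the standing assumptions
    (S : PathModel Ω 𝓤 𝓜 𝓓 𝓩 𝓦 𝓧) (P : Measure Ω) [IsProbabilityMeasure P]
    (hcons : S.Consistency P) (hpos : S.Positivity P) (hexch : S.LatentExchangeability P)
    (hcross : S.CrossWorld P) (hproxy : S.ProxyVariables P) (hcompl : S.CompletenessZ P)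
    (hpsi : Integrable S.Ynested P)
    -- the bridge functions
    (ζ : Nuisance 𝓜 𝓓 𝓩 𝓦 𝓧) (hh : S.IsOutcomeBridge P ζ) (hq : S.IsTreatmentBridge P ζ)
    (hh₀ : MemLp (fun ω => ζ.evalH₀ (S.obs ω)) 2 P)
    (hmom : ∃ η : ℝ, 0 < η ∧ S.FiniteSecondMoments P ζ η)
    -- an i.i.d. sample of the observed data
    (Pr : Measure Ω') [IsProbabilityMeasure Pr] (O : ℕ → Ω' → Obs 𝓜 𝓓 𝓩 𝓦 𝓧)
    (hO : ∀ i, Measurable (O i)) (hind : iIndepFun O Pr)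
    (hlaw : ∀ i, Pr.map (O i) = P.map S.obs)
    -- uniformly random folds of equal sizes, independent of the data; the sample size is `L * k`
    (L : ℕ) (hL : 0 < L) (J : (k : ℕ) → Ω' → Fin (L * k) → Fin L) (hJ : ∀ k, Measurable (J k))
    (hJlaw : ∀ k, Pr.map (J k) = uniformOn (balancedAssignments L k))
    (hJind : ∀ k, IndepFun (J k) (fun s i => O i s) Pr)
    -- the machine learning estimators and their rates
    (learn : Learner 𝓜 𝓓 𝓩 𝓦 𝓧) (hlearn : learn.IsMeasurable)
    (τ : Rates) (hτ : τ.Positive)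
    (hrate : HasRates Pr (P.map S.obs) L
      (fun k l s => crossFit learn (J k s) (fun i => O i s) l) ζ τ) :
    TendstoInMeasure Pr
      (fun k s => (scaledError learn (S.psi P) (J k s) (fun i => O i s)
        - leadingTerm ζ (S.psi P) (fun i : Fin (L * k) => O i s))
          / ((L * k : ℕ) : ℝ) ^ (-τ.alpha))
      atTop (fun _ => 0) ∧
    (1 / 2 ≤ τ.pairwise →
      TendstoInMeasure Pr
        (fun k s => scaledError learn (S.psi P) (J k s) (fun i => O i s)
          - leadingTerm ζ (S.psi P) (fun i : Fin (L * k) => O i s))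
        atTop (fun _ => 0) ∧
      IsBigOpOne Pr (fun k s => scaledError learn (S.psi P) (J k s) (fun i => O i s)) ∧
      Integrable (fun ω => ζ.eif (S.psi P) (S.obs ω) ^ 2) P ∧
      TendstoInDistribution
        (fun k s => scaledError learn (S.psi P) (J k s) (fun i => O i s))
        atTop (id : ℝ → ℝ) (fun _ => Pr)
        (gaussianReal 0 (Real.toNNReal (∫ ω, ζ.eif (S.psi P) (S.obs ω) ^ 2 ∂P)))) := by
  obtain ⟨η, hη, hmom⟩ := hmom
  have hζ := PathModel.isMeasurable_bridge hh hq
  have hbal := PathModel.isBalanced_bridge hpos hproxy hh hq hmom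
  have : Nonempty Ω := P.nonempty_of_neZero
  have hobs := S.measurable_obs
  have : IsProbabilityMeasure (P.map S.obs) := Measure.isProbabilityMeasure_map hobs.aemeasurable
  have hsample : IsCrossFitSample Pr (P.map S.obs) O L J :=
    ⟨hL, hO, hind, hlaw, hJ, fun k => ae_card_fold (hJ k) (hJlaw k), hJind⟩
  have hh₀' : MemLp ζ.evalH₀ 2 (P.map S.obs) :=
    (memLp_map_measure_iff hζ.evalH₀.aestronglyMeasurable hobs.aemeasurable).2 hh₀
  have hψ : ∫ o, ζ.evalH₀ o ∂P.map S.obs = S.psi P := by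
    rw [integral_map hobs.aemeasurable hζ.evalH₀.aestronglyMeasurable]
    exact PathModel.integral_evalH₀_eq_psi hcons hpos hexch hcross hproxy hcompl hpsi hh hmom
  have hL2 := hbal.memLp_eif hζ hh₀' (S.psi P)
  have h0 := hbal.integral_eif hζ hh₀' hψ
  refine ⟨(hsample.tendstoInMeasure_remainder hη hbal hζ hlearn hrate le_rfl (S.psi P)).2,
    fun hpair => ?_⟩
  -- The expansion once more, with exponent `0`; equality in the pairwise condition is allowed
  -- because the rates are little-o.
  obtain ⟨hmeas, hrem⟩ := hsample.tendstoInMeasure_remainder hη hbal hζ hlearn hrate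
    (Rates.alpha_nonneg hτ hpair) (S.psi P)
  simp only [neg_zero, Real.rpow_zero, div_one] at hrem
  have hlead (k : ℕ) := measurable_leadingTerm (ψ := S.psi P) hζ hO (L * k)
  have hV : ∫⁻ o, ‖ζ.eif (S.psi P) o‖ₑ ^ 2 ∂P.map S.obs ≠ ⊤ := by
    rw [lintegral_enorm_sq_eq]
    exact (ENNReal.pow_lt_top hL2.2).ne
  refine ⟨hrem, isBigOpOne_of_sub hlead hV
    (fun k => lintegral_leadingTerm_sq_le hζ hO hind hlaw hL2 h0 (L * k)) hrem,
    (hL2.comp_measurePreserving (hobs.measurePreserving P)).integrable_sq, ?_⟩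
  have hclt := tendstoInDistribution_leadingTerm hζ hO hind hlaw hL2 h0
  rw [integral_map hobs.aemeasurable (hζ.eif.pow_const 2).aestronglyMeasurable] at hclt
  -- The central limit theorem runs over all sample sizes; the multiples of `L` form a subsequence.
  have hsub : TendstoInDistribution
      (fun k s => leadingTerm ζ (S.psi P) (fun i : Fin (L * k) => O i s)) atTop (id : ℝ → ℝ)
      (fun _ => Pr)
      (gaussianReal 0 (Real.toNNReal (∫ ω, ζ.eif (S.psi P) (S.obs ω) ^ 2 ∂P))) :=
    ⟨fun k => (hlead k).aemeasurable, hclt.aemeasurable_limit,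
      hclt.tendsto.comp (tendsto_id.const_mul_atTop' hL)⟩
  -- Slutsky's lemma: the scaled error and the leading term differ by a null sequence.
  refine tendstoInDistribution_of_tendstoInMeasure_sub _ id hsub hrem fun k => ?_
  refine ((hmeas k).add (hlead k)).aemeasurable.congr (ae_of_all _ fun s => ?_)
  simp
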